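/- Let $G$ be a graph without loops or multiple edges. A \emph{drawing} $D$ of $G$ represents the vertices by distinct points of the plane and each edge by a simple continuous arc connecting its endpoints, so that edges pass through no vertices other than their endpoints, any two edges have only finitely many points in common, no two edges touch at a common interior point (that is, they properly cross at every common interior point), and no three edges meet at a common interior point. A \emph{crossing} of $D$ is a common interior point of two edges where they properly cross; $\mathrm{cr}(D)$ is the number of crossings of $D$, and $\mathrm{ocr}(D)$ is the number of unordered pairs of edges that cross an odd number of times. The drawing $D$ is \emph{monotone} if no two vertices share the same $x$-coordinate and every vertical line intersects each edge in at most one point. It is \emph{semisimple} if adjacent edges do not cross, and \emph{weakly semisimple} if every pair of adjacent edges cross an even number of times. Let $\text{mon-cr}(G)$ be the minimum of $\mathrm{cr}(D)$ over all monotone drawings $D$ of $G$, let $\text{mon-ocr}_+(G)$ be the minimum of $\mathrm{ocr}(D)$ over all monotone semisimple drawings $D$ of $G$, and let $\text{mon-ocr}_{\pm}(G)$ be the minimum of $\mathrm{ocr}(D)$ over all monotone weakly semisimple drawings $D$ of $G$. \textbf{Theorem.} For every $n\in\mathbb{N}$, the complete graph $K_n$ on $n$ vertices satisfies \[\text{mon-ocr}_{\pm}(K_n)=\text{mon-ocr}_+(K_n)=\text{mon-cr}(K_n)=Z(n),\]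 where \[Z(n)=\frac14\left\lfloor\frac n2\right\rfloor\left\lfloor\frac{n-1}2\right\rfloor\left\lfloor\frac{n-2}2\right\rfloor\left\lfloor\frac{n-3}2\right\rfloor .\] -/

import Mathlib

/-- `A` is a simple continuous arc in the plane with endpoints `a` and `b`. -/
def IsSimpleArc (A : Set (ℝ × ℝ)) (a b : ℝ × ℝ) : Prop :=
  ∃ γ : Path a b, Function.Injective γ ∧ Set.range γ = A

/-- The planar sets `A` and `B` cross properly at `p`: some homeomorphism from an open neighbourhood
of `p` onto an open neighbourhood of the origin sends `p` to the origin, and `A` and `B` to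
the two coordinate axes (within these neighbourhoods). Two arcs with an isolated common interior
point `p` that do not cross properly at `p` touch at `p`. -/
def CrossProperlyAt (A B : Set (ℝ × ℝ)) (p : ℝ × ℝ) : Prop :=
  ∃ h : OpenPartialHomeomorph (ℝ × ℝ) (ℝ × ℝ), p ∈ h.source ∧ h p = (0, 0) ∧
    ∀ q ∈ h.source, (q ∈ A ↔ (h q).2 = 0) ∧ (q ∈ B ↔ (h q).1 = 0)

/-- A drawing of a simple graph in the plane. -/
structure Drawing {V : Type*} (G : SimpleGraph V) where
  /-- the point representing a vertex -/
  point : V → ℝ × ℝ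
  /-- the arc representing an edge, as a set of points -/
  arc : G.edgeSet → Set (ℝ × ℝ)
  /-- vertices are represented by distinct points -/
  point_injective : Function.Injective point
  /-- each edge is represented by a simple arc connecting its endpoints -/
  isSimpleArc : ∀ (u v : V) (huv : G.Adj u v),
    IsSimpleArc (arc ⟨s(u, v), huv⟩) (point u) (point v)
  /-- edges pass through no vertices other than their endpoints -/
  mem_of_point_mem : ∀ (e : G.edgeSet) (w : V), point w ∈ arc e → w ∈ (e : Sym2 V)
  /-- any two edges have only finitely many points in common -/
  finite_inter : ∀ e f : G.edgeSet, e ≠ f → (arc e ∩ arc f).Finite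
  /-- no two edges touch at an interior point -/
  not_touch : ∀ e f : G.edgeSet, e ≠ f →
    ∀ p ∈ (arc e \ point '' {v | v ∈ (e : Sym2 V)}) ∩ (arc f \ point '' {v | v ∈ (f : Sym2 V)}),
      CrossProperlyAt (arc e) (arc f) p
  /-- no three edges meet at a common interior point -/
  no_triple : ∀ e f g : G.edgeSet, e ≠ f → e ≠ g → f ≠ g →
    (arc e \ point '' {v | v ∈ (e : Sym2 V)}) ∩ (arc f \ point '' {v | v ∈ (f : Sym2 V)}) ∩
      (arc g \ point '' {v | v ∈ (g : Sym2 V)}) = ∅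

namespace Drawing

variable {V : Type*} {G : SimpleGraph V}

/-- The interior of an edge: its arc without the two endpoints. -/
def edgeInterior (D : Drawing G) (e : G.edgeSet) : Set (ℝ × ℝ) :=
  D.arc e \ D.point '' {v | v ∈ (e : Sym2 V)}

/-- The crossings of two edges: the common interior points at which they cross properly. -/
def crossings (D : Drawing G) (e f : G.edgeSet) : Set (ℝ × ℝ) :=
  {p | p ∈ D.edgeInterior e ∩ D.edgeInterior f ∧ CrossProperlyAt (D.arc e) (D.arc f) p}

/-- The crossing number of a drawing: its number of crossings. -/
noncomputable def cr (D : Drawing G) : ℕ∞ :=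
  {p : ℝ × ℝ | ∃ e f : G.edgeSet, e ≠ f ∧ p ∈ D.crossings e f}.encard

/-- The number of (unordered) pairs of edges that cross an odd number of times. -/
noncomputable def ocr (D : Drawing G) : ℕ∞ :=
  {P : Sym2 G.edgeSet | ∃ e f : G.edgeSet, P = s(e, f) ∧ e ≠ f ∧
    Odd (D.crossings e f).ncard}.encard

/-- A drawing is monotone if no two vertices share the same `x`-coordinate and every vertical line
meets every edge in at most one point. -/
def IsMonotone (D : Drawing G) : Prop :=
  (∀ u v : V, (D.point u).1 = (D.point v).1 → u = v) ∧
    ∀ e : G.edgeSet, ∀ p ∈ D.arc e, ∀ q ∈ D.arc e, p.1 = q.1 → p = q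

/-- A drawing is semisimple if adjacent edges do not cross. -/
def IsSemisimple (D : Drawing G) : Prop :=
  ∀ e f : G.edgeSet, e ≠ f → (∃ v : V, v ∈ (e : Sym2 V) ∧ v ∈ (f : Sym2 V)) →
    D.crossings e f = ∅

/-- A drawing is weakly semisimple if adjacent edges cross an even number of times. -/
def IsWeaklySemisimple (D : Drawing G) : Prop :=
  ∀ e f : G.edgeSet, e ≠ f → (∃ v : V, v ∈ (e : Sym2 V) ∧ v ∈ (f : Sym2 V)) →
    Even (D.crossings e f).ncard

end Drawing

/-- The monotone crossing number. As an infimum in `ℕ∞`, it is `⊤` if there is no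
monotone drawing, and otherwise the minimum; the same holds for the next two definitions. -/
noncomputable def monCr {V : Type*} (G : SimpleGraph V) : ℕ∞ :=
  ⨅ (D : Drawing G) (_ : D.IsMonotone), D.cr

/-- The monotone semisimple odd crossing number. -/
noncomputable def monOcrPlus {V : Type*} (G : SimpleGraph V) : ℕ∞ :=
  ⨅ (D : Drawing G) (_ : D.IsMonotone ∧ D.IsSemisimple), D.ocr

/-- The monotone weakly semisimple odd crossing number. -/
noncomputable def monOcrPlusMinus {V : Type*} (G : SimpleGraph V) : ℕ∞ :=
  ⨅ (D : Drawing G) (_ : D.IsMonotone ∧ D.IsWeaklySemisimple), D.ocr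

/-- `Z(n)`, in natural-number arithmetic; `hillZ_eq` shows that neither the truncated subtraction
nor the division by `4` changes the value. -/
def hillZ (n : ℕ) : ℕ :=
  (n / 2) * ((n - 1) / 2) * ((n - 2) / 2) * ((n - 3) / 2) / 4

theorem hillZ_eq (n : ℕ) :
    (hillZ n : ℚ) = 1 / 4 * ⌊(n : ℚ) / 2⌋ * ⌊((n : ℚ) - 1) / 2⌋ * ⌊((n : ℚ) - 2) / 2⌋ *
      ⌊((n : ℚ) - 3) / 2⌋ := by
  have fl : ∀ a : ℤ, ⌊(a : ℚ) / 2⌋ = a / 2 := fun a => by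
    exact_mod_cast Rat.floor_intCast_div_natCast a 2
  have h0 := fl n
  have h1 := fl (n - 1)
  have h2 := fl (n - 2)
  have h3 := fl (n - 3)
  push_cast at h0 h1 h2 h3
  rw [h0, h1, h2, h3]
  rcases lt_or_ge n 3 with hn | hn
  · interval_cases n <;> simp [hillZ]
  obtain ⟨k, rfl⟩ := Nat.exists_eq_add_of_le hn
  have hd : 4 ∣ ((3 + k) / 2) * ((3 + k - 1) / 2) * ((3 + k - 2) / 2) * ((3 + k - 3) / 2) := by
    obtain ⟨m, hm | hm⟩ : ∃ m, k = 2 * m ∨ k = 2 * m + 1 := ⟨k / 2, by omega⟩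
    · rw [show (3 + k) / 2 = m + 1 by omega, show (3 + k - 1) / 2 = m + 1 by omega,
        show (3 + k - 2) / 2 = m by omega, show (3 + k - 3) / 2 = m by omega]
      obtain ⟨c, hc⟩ := (Nat.even_mul_succ_self m).two_dvd
      exact ⟨c * c, by linear_combination (m * (m + 1) + 2 * c) * hc⟩
    · rw [show (3 + k) / 2 = m + 2 by omega, show (3 + k - 1) / 2 = m + 1 by omega,
        show (3 + k - 2) / 2 = m + 1 by omega, show (3 + k - 3) / 2 = m by omega]
      obtain ⟨c, hc⟩ := (Nat.even_mul_succ_self m).two_dvd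
      obtain ⟨d, hd⟩ := (Nat.even_mul_succ_self (m + 1)).two_dvd
      exact ⟨c * d, by linear_combination (m + 1) * (m + 2) * hc + 2 * c * hd⟩
  obtain ⟨c, hc⟩ := hd
  have hz : hillZ (3 + k) = c := by rw [hillZ, hc]; omega
  rw [hz]
  have e1 : ((3 + k : ℕ) : ℤ) - 1 = ((3 + k - 1 : ℕ) : ℤ) := by omega
  have e2 : ((3 + k : ℕ) : ℤ) - 2 = ((3 + k - 2 : ℕ) : ℤ) := by omega
  have e3 : ((3 + k : ℕ) : ℤ) - 3 = ((3 + k - 3 : ℕ) : ℤ) := by omega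
  rw [e1, e2, e3]
  have hq : (((3 + k) / 2 : ℕ) : ℚ) * ((3 + k - 1) / 2 : ℕ) * ((3 + k - 2) / 2 : ℕ) *
      ((3 + k - 3) / 2 : ℕ) = 4 * c := by exact_mod_cast hc
  have cast2 : ∀ m : ℕ, (((m : ℤ) / 2 : ℤ) : ℚ) = ((m / 2 : ℕ) : ℚ) := fun m => by
    norm_cast
  rw [cast2, cast2, cast2, cast2]
  linear_combination (-1 / 4 : ℚ) * hq

/-! The upper bound comes from two-page drawings: the vertices lie on a line and each edge stays in
one of the two half-planes. Two edges then need to cross only if they lie in the same half-plane and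
their ends alternate. `exists_page_crossCount_le` chooses the half-planes: for `n = 2 * h` by the
Blažek–Koman rule, which depends on `i + j`, and for odd `n` by deleting a well-chosen vertex from
the drawing on `n + 1` vertices. Parabolic arcs over generic abscissas realize the choice as a
monotone semisimple drawing (`exists_drawing_le_hillZ`).

For the lower bound, a monotone drawing is reduced to its signature, which records for each triple
whether the middle vertex lies above the edge joining the outer two. If adjacent edges cross evenly,
the edges leaving a vertex to one side are linearly ordered, so the signature is `Consistent`. On
four vertices the signature forces either no odd crossing, and then three edges separate the other
two vertices, or at least one, and then only two edges do. Summation gives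
`Consistent.crossCount_add`: the forced crossings number `3 * n.choose 4` minus the sum over all
edges of the product of the numbers of vertices on the two sides. Hence many unbalanced edges are
wanted. `Consistent.le_edgeDefect` provides them; it is a cumulative bound of the kind known for `≤
k`-edges of point sets, proved by deleting the rightmost vertex. `Consistent.hillZ_le` adds these
bounds up.

For `monCr` adjacent edges may cross arbitrarily and the signature need not be consistent. Here a
drawing is recorded by the heights of its edges at the vertices. If two edges with a common end are
inverted in a gap between consecutive vertices, exchanging their parts between that end and the gap
lowers the number of inversions. The process stops at a system without adjacent inversions, whose
signature is consistent; so every system has at least `hillZ n` inversions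
(`HeightSystem.hillZ_le_card_inversions`), and distinct inversions give distinct crossings. -/

/-! ### Consistent signatures and the cumulative bound on unbalanced edges -/

section Signatures

open Finset

/-- The side of the edge `ij` (`i < j`) on which the vertex `m` lies, for the signature `s`, where
`s a b c` says that `b` lies above the edge `ac` (`a < b < c`). -/
def sideOf (s : ℕ → ℕ → ℕ → Bool) (i j m : ℕ) : Bool :=
  if m < i then !s m i j else if m < j then s i m j else !s i j m

/-- The number of vertices below `n` on the side `β` of the edge `ij`. -/
def sideCount (s : ℕ → ℕ → ℕ → Bool) (n : ℕ) (β : Bool) (i j : ℕ) : ℕ :=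
  #{m ∈ range n | m ≠ i ∧ m ≠ j ∧ sideOf s i j m = β}

/-- The edges leaving each vertex to the right, and those leaving it to the left, are linearly
ordered by the signature `s`. -/
structure Consistent (s : ℕ → ℕ → ℕ → Bool) (n : ℕ) : Prop where
  right : ∀ a b c d, a < b → b < c → c < d → d < n → s a b c = s a c d → s a b d = s a b c
  left : ∀ a b c d, a < b → b < c → c < d → d < n → s a b d = s b c d → s a c d = s a b d

theorem Consistent.mono {s : ℕ → ℕ → ℕ → Bool} {m n : ℕ} (h : Consistent s n) (hmn : m ≤ n) :
    Consistent s m :=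
  ⟨fun a b c d h1 h2 h3 h4 => h.right a b c d h1 h2 h3 (h4.trans_le hmn),
    fun a b c d h1 h2 h3 h4 => h.left a b c d h1 h2 h3 (h4.trans_le hmn)⟩

/-- In a finite strict linear order the number of predecessors is a bijection onto an initial
segment. -/
theorem injOn_rank {α : Type*} (A : Finset α) (r : α → α → Prop) [DecidableRel r]
    (irrefl : ∀ x ∈ A, ¬ r x x) (trans : ∀ x ∈ A, ∀ y ∈ A, ∀ z ∈ A, r x y → r y z → r x z)
    (total : ∀ x ∈ A, ∀ y ∈ A, x ≠ y → r x y ∨ r y x) :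
    Set.InjOn (fun j => #{m ∈ A | r m j}) A := by
  have key : ∀ x ∈ A, ∀ y ∈ A, r x y → #{m ∈ A | r m x} < #{m ∈ A | r m y} := by
    intro x hx y hy hxy
    apply card_lt_card
    refine ⟨fun m hm => ?_, fun h => ?_⟩
    · simp only [mem_filter] at hm ⊢
      exact ⟨hm.1, trans m hm.1 x hx y hy hm.2 hxy⟩
    · have := h (mem_filter.2 ⟨hx, hxy⟩)
      exact irrefl x hx (mem_filter.1 this).2
  intro x hx y hy hxy
  by_contra hne
  rcases total x hx y hy hne with h | h
  · exact (key x hx y hy h).ne hxy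
  · exact (key y hy x hx h).ne hxy.symm

/-- The ranks run through `0, …, #A - 1`, each once, so such a sum does not depend on the order. -/
theorem sum_rank {α : Type*} (A : Finset α) (r : α → α → Prop) [DecidableRel r]
    (irrefl : ∀ x ∈ A, ¬ r x x) (trans : ∀ x ∈ A, ∀ y ∈ A, ∀ z ∈ A, r x y → r y z → r x z)
    (total : ∀ x ∈ A, ∀ y ∈ A, x ≠ y → r x y ∨ r y x) (g : ℕ → ℕ) :
    ∑ j ∈ A, g #{m ∈ A | r m j} = ∑ i ∈ range #A, g i := by
  have hinj := injOn_rank A r irrefl trans total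
  have himg : A.image (fun j => #{m ∈ A | r m j}) = range #A := by
    apply eq_of_subset_of_card_le
    · intro i hi
      obtain ⟨j, hj, rfl⟩ := mem_image.1 hi
      rw [mem_range]
      apply card_lt_card
      refine ⟨filter_subset _ _, fun h => irrefl j hj (mem_filter.1 (h hj)).2⟩
    · rw [card_image_of_injOn hinj, card_range]
  rw [← himg, sum_image hinj]

theorem sum_range_sub_mul_two {K n : ℕ} (h : K ≤ n) :
    2 * ∑ i ∈ range n, (K - i) = K * (K + 1) := by
  induction n, h using Nat.le_induction with
  | base =>
    induction K with
    | zero => simp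
    | succ K ih =>
      rw [sum_range_succ']
      simp only [Nat.add_sub_add_right, Nat.sub_zero, mul_add, ih]
      ring
  | succ n hn ih => rw [sum_range_succ, Nat.sub_eq_zero_of_le hn, add_zero, ih]

section
variable {s : ℕ → ℕ → ℕ → Bool} {n : ℕ}

/-- Antisymmetry of the vertical order of the edges ending at `n`: `jn` passes below `m` exactly
when `mn` passes above `j`. -/
theorem sideOf_last_comm {j m : ℕ} (hj : j < n) (hm : m < n) (hne : m ≠ j) :
    sideOf s j n m = !sideOf s m n j := by
  unfold sideOf
  rcases lt_or_gt_of_ne hne with h | h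
  · simp [h, h.not_gt, hj]
  · simp [h, h.not_gt, hm]

theorem sideOf_first_comm {i j m : ℕ} (hj : i < j) (hm : i < m) (hne : m ≠ j) :
    sideOf s i j m = !sideOf s i m j := by
  unfold sideOf
  rcases lt_or_gt_of_ne hne with h | h
  · simp [h, h.not_gt, hj.not_gt, hm.not_gt]
  · simp [h, h.not_gt, hm.not_gt, hj.not_gt]

/-- Transitivity of the same order. The six instances of `Consistent.left` cover the possible
left-to-right orders of `x`, `y`, `z`; the rest is a finite check. -/
theorem Consistent.sideOf_last_trans (hs : Consistent s (n + 1)) (β : Bool) {x y z : ℕ} (hx : x < n)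
    (hy : y < n) (hz : z < n) (h1 : x ≠ y ∧ sideOf s y n x = β) (h2 : y ≠ z ∧ sideOf s z n y = β) :
    x ≠ z ∧ sideOf s z n x = β := by
  have hl := fun a b c h1 h2 h3 => hs.left a b c n h1 h2 h3 (Nat.lt_succ_self n)
  have hxz : x ≠ z := by
    rintro rfl
    have := sideOf_last_comm (s := s) hy hx h1.1
    rw [h1.2, h2.2] at this
    cases β <;> simp at this
  refine ⟨hxz, ?_⟩
  obtain ⟨h1n, h1⟩ := h1
  obtain ⟨h2n, h2⟩ := h2
  unfold sideOf at *
  have a1 := hl x y z; have a2 := hl x z y; have a3 := hl y x z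
  have a4 := hl y z x; have a5 := hl z x y; have a6 := hl z y x
  clear hl hs
  cases β <;> grind

theorem Consistent.sideOf_first_trans (hs : Consistent s n) (β : Bool) {i x y z : ℕ} (hx : x < n)
    (hy : y < n) (hz : z < n) (hix : i < x) (hiy : i < y) (hiz : i < z)
    (h1 : x ≠ y ∧ sideOf s i y x = β) (h2 : y ≠ z ∧ sideOf s i z y = β) :
    x ≠ z ∧ sideOf s i z x = β := by
  have hl := fun b c d h1 h2 h3 h4 => hs.right i b c d h1 h2 h3 h4
  have hxz : x ≠ z := by
    rintro rfl
    have := sideOf_first_comm (s := s) hiy hix h1.1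
    rw [h1.2, h2.2] at this
    cases β <;> simp at this
  refine ⟨hxz, ?_⟩
  obtain ⟨h1n, h1⟩ := h1
  obtain ⟨h2n, h2⟩ := h2
  unfold sideOf at *
  have a1 := hl x y z; have a2 := hl x z y; have a3 := hl y x z
  have a4 := hl y z x; have a5 := hl z x y; have a6 := hl z y x
  clear hl hs
  cases β <;> grind

theorem sideCount_last {j : ℕ} (β : Bool) :
    sideCount s (n + 1) β j n = #{m ∈ range n | m ≠ j ∧ sideOf s j n m = β} := by
  unfold sideCount
  congr 1
  ext m
  simp only [mem_filter, mem_range]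
  constructor
  · rintro ⟨h1, h2, h3, h4⟩; exact ⟨by omega, h2, h4⟩
  · rintro ⟨h1, h2, h3⟩; exact ⟨by omega, h2, by omega, h3⟩

/-- The edges ending at `n` are linearly ordered, so the numbers of vertices on their `β` sides are
`0, …, n - 1` in some order. The last vertex therefore contributes the same amount for every
consistent signature. -/
theorem Consistent.sum_last (hs : Consistent s (n + 1)) (β : Bool) (g : ℕ → ℕ) :
    ∑ j ∈ range n, g (sideCount s (n + 1) β j n) = ∑ i ∈ range n, g i := by
  have := sum_rank (range n) (fun m j => m ≠ j ∧ sideOf s j n m = β) (by simp)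
    (fun x hx y hy z hz => hs.sideOf_last_trans β (mem_range.1 hx) (mem_range.1 hy)
      (mem_range.1 hz))
    (fun x hx y hy hne => by
      have := sideOf_last_comm (s := s) (mem_range.1 hy) (mem_range.1 hx) hne
      cases β <;> cases h : sideOf s x n y <;> simp_all [Ne.symm])
    g
  rw [card_range] at this
  rw [← this]
  exact sum_congr rfl fun j _ => by rw [sideCount_last]

/-- The edges `ij`, `j < n`, that have the vertex `n` on the side other than `β`. -/
def awayEdges (s : ℕ → ℕ → ℕ → Bool) (n : ℕ) (β : Bool) (i : ℕ) : Finset ℕ :=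
  {j ∈ Ioo i n | sideOf s i j n ≠ β}

theorem card_awayEdges (i : ℕ) (hi : i < n) :
    #(awayEdges s n true i) + #(awayEdges s n false i) + i + 1 = n := by
  have h := card_filter_add_card_filter_not (s := Ioo i n) (fun j => sideOf s i j n ≠ true)
  have h2 : ({j ∈ Ioo i n | ¬ sideOf s i j n ≠ true} : Finset ℕ) = awayEdges s n false i := by
    unfold awayEdges
    congr 1
    ext j
    simp
  rw [h2, Nat.card_Ioo] at h
  unfold awayEdges at *
  omega

/-- At most `i` of the counted vertices lie to the left of `i`. If `m` to the right of `i` is on the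
side `β` of `ij` and `n` is not, transitivity puts `n` off the side `β` of `im` too, so `m` is again
in `awayEdges s n β i`. -/
theorem Consistent.sideCount_le (hs : Consistent s (n + 1)) (β : Bool) {i j : ℕ}
    (hj : j ∈ awayEdges s n β i) :
    sideCount s n β i j ≤ i + #{m ∈ awayEdges s n β i | m ≠ j ∧ sideOf s i j m = β} := by
  obtain ⟨hj1, hj2⟩ := mem_filter.1 hj
  rw [mem_Ioo] at hj1
  calc sideCount s n β i j
      ≤ #(range i ∪ {m ∈ awayEdges s n β i | m ≠ j ∧ sideOf s i j m = β}) := by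
        apply card_le_card
        intro m hm
        simp only [mem_filter, mem_range] at hm
        simp only [mem_union, mem_range, mem_filter, awayEdges, mem_Ioo]
        obtain ⟨h1, h2, h3, h4⟩ := hm
        by_cases hmi : m < i
        · exact Or.inl hmi
        have him : i < m := by omega
        refine Or.inr ⟨⟨⟨him, h1⟩, ?_⟩, h3, h4⟩
        have hjn := sideOf_first_comm (s := s) (i := i) (j := j) (m := n) hj1.1 (by omega)
          (by omega)
        have := hs.sideOf_first_trans β (x := m) (y := j) (z := n) (by omega) (by omega)
          (by omega) him hj1.1 (by omega) ⟨h3, h4⟩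
          ⟨by omega, by rw [hjn] at hj2; cases β <;> simpa using hj2⟩
        have hmn := sideOf_first_comm (s := s) (i := i) (j := m) (m := n) him (by omega)
          (by omega)
        rw [hmn, this.2]
        cases β <;> simp
    _ ≤ _ := (card_union_le _ _).trans (by rw [card_range])

/-- The last summand in `Consistent.sideCount_le` is the rank of `ij` among the away edges. Every
rank occurs once, and the ranks up to `k - i` give counts of at most `k`. -/
theorem Consistent.le_card_away (hs : Consistent s (n + 1)) (β : Bool) {i : ℕ} (k : ℕ)
    (hi : i ≤ k) :
    min #(awayEdges s n β i) (k + 1 - i) ≤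
      ∑ j ∈ Ioo i n, if sideOf s i j n ≠ β ∧ sideCount s n β i j ≤ k then 1 else 0 := by
  have hm : ∀ x ∈ awayEdges s n β i, i < x ∧ x < n := fun x hx => by
    simpa using (mem_filter.1 hx).1
  have h := sum_rank (awayEdges s n β i) (fun m j => m ≠ j ∧ sideOf s i j m = β) (by simp)
    (fun x hx y hy z hz => by
      have := hm x hx; have := hm y hy; have := hm z hz
      exact hs.sideOf_first_trans β (by omega) (by omega) (by omega) (by omega) (by omega)
        (by omega))
    (fun x hx y hy hne => by
      have := sideOf_first_comm (s := s) (hm y hy).1 (hm x hx).1 hne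
      cases β <;> cases h : sideOf s i x y <;> simp_all [Ne.symm])
    (fun r => if r ≤ k - i then 1 else 0)
  calc min #(awayEdges s n β i) (k + 1 - i)
      = ∑ r ∈ range #(awayEdges s n β i), (if r ≤ k - i then 1 else 0) := by
        rw [sum_boole]
        have : ({x ∈ range #(awayEdges s n β i) | x ≤ k - i} : Finset ℕ) =
            range (min #(awayEdges s n β i) (k + 1 - i)) := by
          ext x; simp only [mem_filter, mem_range, lt_min_iff]; omega
        rw [this, card_range, Nat.cast_id]
    _ = _ := h.symm
    _ ≤ ∑ j ∈ awayEdges s n β i,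
        (if sideOf s i j n ≠ β ∧ sideCount s n β i j ≤ k then 1 else 0) := by
        refine sum_le_sum fun j hj => ?_
        have h1 := hs.sideCount_le β hj
        have h2 := (mem_filter.1 hj).2
        split_ifs with h3 h4 <;> first | omega | skip
        exact absurd ⟨h2, by omega⟩ h4
    _ ≤ _ := sum_le_sum_of_subset (filter_subset _ _)

/-- The sum over all edges and both sides of the amount by which the number of vertices on that side
falls short of `K`. -/
def edgeDefect (s : ℕ → ℕ → ℕ → Bool) (K n : ℕ) : ℕ :=
  ∑ j ∈ range n, ∑ i ∈ range j, ∑ β : Bool, (K - sideCount s n β i j)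

theorem sideCount_succ {i j : ℕ} (β : Bool) (hij : i < j) (hj : j < n) :
    sideCount s (n + 1) β i j = sideCount s n β i j + if sideOf s i j n = β then 1 else 0 := by
  unfold sideCount
  rw [range_add_one, filter_insert]
  split_ifs with h1 h2 h2
  · rw [card_insert_of_notMem (by simp)]
  · exact absurd h1.2.2 h2
  · exact absurd ⟨by omega, by omega, h2⟩ h1
  · rfl

/-- The sum counts the pairs of an edge and a side with at most `k` vertices that do not gain the
new vertex `n`. For `i ≤ k` the away edges of both sides number `n - 1 - i ≥ k + 1 - i` together, so
the two minima in `Consistent.le_card_away` add up to at least `k + 1 - i`. -/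
theorem Consistent.le_sum_invariant (hs : Consistent s (n + 1)) {k : ℕ} (hk : k + 2 ≤ n) :
    (k + 1) * (k + 2) ≤ 2 * ∑ j ∈ range n, ∑ i ∈ range j, ∑ β : Bool,
      if sideOf s i j n ≠ β ∧ sideCount s n β i j ≤ k then 1 else 0 := by
  have hsw : ∑ j ∈ range n, ∑ i ∈ range j, ∑ β : Bool,
      (if sideOf s i j n ≠ β ∧ sideCount s n β i j ≤ k then 1 else 0) =
      ∑ i ∈ range n, ∑ j ∈ Ioo i n, ∑ β : Bool,
      (if sideOf s i j n ≠ β ∧ sideCount s n β i j ≤ k then 1 else 0) := by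
    apply sum_comm'
    intro x y
    simp only [mem_range, mem_Ioo]
    omega
  rw [hsw, ← sum_range_sub_mul_two (K := k + 1) (n := n) (by omega)]
  refine Nat.mul_le_mul_left 2 (sum_le_sum fun i hi => ?_)
  rw [mem_range] at hi
  by_cases hik : i ≤ k
  · have h1 := hs.le_card_away true k hik
    have h2 := hs.le_card_away false k hik
    have h3 := card_awayEdges (s := s) (n := n) i hi
    simp only [Fintype.sum_bool, sum_add_distrib]
    omega
  · rw [Nat.sub_eq_zero_of_le (by omega)]; exact Nat.zero_le _

/-- Deleting the rightmost vertex lowers `K` and `n` by one. The edges ending there contribute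
exactly `(k + 1) * (k + 2)`. For an older edge with `c` vertices on a side, the shortfall is `k - c`
if that side gains the vertex; otherwise, if `c ≤ k`, it exceeds `k - c` by one, which happens at
least `(k + 1) * (k + 2) / 2` times. The total of `3 * (k + 1) * (k + 2) / 2` is the increment of `K
* (K + 1) * (K + 2) / 2`. -/
theorem Consistent.le_edgeDefect {K : ℕ} (hs : Consistent s n) (h : 2 * K < n) :
    K * (K + 1) * (K + 2) ≤ 2 * edgeDefect s K n := by
  induction K generalizing n with
  | zero => simp
  | succ k ih =>
    obtain ⟨n, rfl⟩ : ∃ m, n = m + 1 := ⟨n - 1, by omega⟩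
    have h0 := ih (hs.mono (Nat.le_succ n)) (by omega)
    have h1 := hs.le_sum_invariant (k := k) (by omega)
    have h2 := sum_range_sub_mul_two (K := k + 1) (n := n) (by omega)
    have h3 := hs.sum_last true (fun c => k + 1 - c)
    have h4 := hs.sum_last false (fun c => k + 1 - c)
    have h5 : edgeDefect s k n + ∑ j ∈ range n, ∑ i ∈ range j, ∑ β : Bool,
        (if sideOf s i j n ≠ β ∧ sideCount s n β i j ≤ k then 1 else 0) ≤
        ∑ j ∈ range n, ∑ i ∈ range j, ∑ β : Bool, (k + 1 - sideCount s (n + 1) β i j) := by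
      unfold edgeDefect
      simp only [← sum_add_distrib]
      refine sum_le_sum fun j hj => sum_le_sum fun i hi => sum_le_sum fun β _ => ?_
      rw [mem_range] at hi hj
      rw [sideCount_succ β hi hj]
      by_cases hside : sideOf s i j n = β
      · simp [hside]
      · by_cases hc : sideCount s n β i j ≤ k
        · simp only [ne_eq, hside, not_false_eq_true, hc, and_self, if_true, if_false]; omega
        · simp only [hc, and_false, if_false, hside]; omega
    have h6 : edgeDefect s (k + 1) (n + 1) =
        ∑ j ∈ range n, ∑ i ∈ range j, ∑ β : Bool, (k + 1 - sideCount s (n + 1) β i j) +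
        (∑ i ∈ range n, (k + 1 - sideCount s (n + 1) true i n) +
          ∑ i ∈ range n, (k + 1 - sideCount s (n + 1) false i n)) := by
      unfold edgeDefect
      rw [sum_range_succ]
      simp only [Fintype.sum_bool, sum_add_distrib]
    rw [h6]
    nlinarith

end

end Signatures

/-! ### Crossings and separating edges on four vertices -/

section CrossCount

open Finset

/-- The increasing quadruples of vertices below `n`. -/
def quads (n : ℕ) : Finset (ℕ × ℕ × ℕ × ℕ) :=
  {q ∈ range n ×ˢ range n ×ˢ range n ×ˢ range n |
    q.1 < q.2.1 ∧ q.2.1 < q.2.2.1 ∧ q.2.2.1 < q.2.2.2}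

theorem mem_quads {n a b c d : ℕ} : (a, b, c, d) ∈ quads n ↔ a < b ∧ b < c ∧ c < d ∧ d < n := by
  simp only [quads, mem_filter, mem_product, mem_range]
  omega

/-- The quadruple spans a crossing: the edges `ac`, `bd` or the edges `ad`, `bc` cross oddly. -/
def IsCrossing (s : ℕ → ℕ → ℕ → Bool) (q : ℕ × ℕ × ℕ × ℕ) : Prop :=
  s q.1 q.2.1 q.2.2.1 = s q.2.1 q.2.2.1 q.2.2.2 ∨ s q.1 q.2.1 q.2.2.2 ≠ s q.1 q.2.2.1 q.2.2.2

instance (s : ℕ → ℕ → ℕ → Bool) : DecidablePred (IsCrossing s) := fun q => by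
  unfold IsCrossing; infer_instance

/-- The number of quadruples that span a crossing. -/
def crossCount (s : ℕ → ℕ → ℕ → Bool) (n : ℕ) : ℕ := #{q ∈ quads n | IsCrossing s q}

theorem sum_range_choose_right (n k : ℕ) : ∑ i ∈ range n, i.choose k = n.choose (k + 1) := by
  induction n with
  | zero => simp
  | succ n ih => rw [sum_range_succ, ih, Nat.choose_succ_succ', add_comm]

theorem sum_quads (n : ℕ) (f : ℕ → ℕ → ℕ → ℕ → ℕ) :
    ∑ q ∈ quads n, f q.1 q.2.1 q.2.2.1 q.2.2.2 =
      ∑ d ∈ range n, ∑ c ∈ range d, ∑ b ∈ range c, ∑ a ∈ range b, f a b c d := by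
  simp only [sum_sigma']
  refine sum_nbij' (fun q => ⟨q.2.2.2, q.2.2.1, q.2.1, q.1⟩)
    (fun q => (q.2.2.2, q.2.2.1, q.2.1, q.1)) ?_ ?_ ?_ ?_ ?_
  · rintro ⟨a, b, c, d⟩ h
    rw [mem_quads] at h
    simp only [mem_sigma, mem_range]
    omega
  · rintro ⟨d, c, b, a⟩ h
    simp only [mem_sigma, mem_range] at h
    dsimp only
    rw [mem_quads]
    omega
  all_goals intros; rfl

theorem card_quads (n : ℕ) : #(quads n) = n.choose 4 := by
  rw [card_eq_sum_ones, sum_quads n (fun _ _ _ _ => 1)]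
  simp only [sum_const, card_range, smul_eq_mul, mul_one]
  have h1 : ∀ c, ∑ b ∈ range c, b = c.choose 2 := fun c => by
    simpa using sum_range_choose_right c 1
  simp only [h1, sum_range_choose_right]

/-- Reindexing of a sum over quadruples that are increasing after a permutation of the entries. -/
theorem sum_perm_quads (n : ℕ) (P : ℕ × ℕ × ℕ × ℕ → Prop) [DecidablePred P]
    (φ ψ : ℕ × ℕ × ℕ × ℕ → ℕ × ℕ × ℕ × ℕ)
    (h1 : ∀ q, P q ∧ q ∈ range n ×ˢ range n ×ˢ range n ×ˢ range n → φ q ∈ quads n)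
    (h2 : ∀ q ∈ quads n, P (ψ q) ∧ ψ q ∈ range n ×ˢ range n ×ˢ range n ×ˢ range n)
    (h3 : ∀ q, ψ (φ q) = q) (h4 : ∀ q, φ (ψ q) = q) (g : ℕ × ℕ × ℕ × ℕ → ℕ) :
    ∑ q ∈ range n ×ˢ range n ×ˢ range n ×ˢ range n, (if P q then g q else 0) =
      ∑ q ∈ quads n, g (ψ q) := by
  rw [← sum_filter]
  refine sum_nbij' φ ψ ?_ ?_ ?_ ?_ ?_
  · intro q hq; rw [mem_filter] at hq; exact h1 q hq.symm
  · intro q hq; rw [mem_filter]; exact (h2 q hq).symm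
  · intro q _; exact h3 q
  · intro q _; exact h4 q
  · intro q _; rw [h3]

/-- Of four given vertices, two form the edge, in six ways, and the other two can be ordered in two
ways: twelve terms for each increasing quadruple. -/
theorem sum_split_orders (n : ℕ) (g : ℕ → ℕ → ℕ → ℕ → ℕ) :
    ∑ q ∈ range n ×ˢ range n ×ˢ range n ×ˢ range n,
      (if q.1 < q.2.1 ∧ q.2.2.1 ≠ q.1 ∧ q.2.2.1 ≠ q.2.1 ∧ q.2.2.2 ≠ q.1 ∧ q.2.2.2 ≠ q.2.1 ∧
        q.2.2.1 ≠ q.2.2.2 then g q.1 q.2.1 q.2.2.1 q.2.2.2 else 0) =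
    ∑ q ∈ quads n, (let (a, b, c, d) := q
      (g a b c d + g a b d c) + (g a c b d + g a c d b) + (g a d b c + g a d c b) +
      (g b c a d + g b c d a) + (g b d a c + g b d c a) + (g c d a b + g c d b a)) := by
  have key : ∀ q : ℕ × ℕ × ℕ × ℕ,
      (if q.1 < q.2.1 ∧ q.2.2.1 ≠ q.1 ∧ q.2.2.1 ≠ q.2.1 ∧ q.2.2.2 ≠ q.1 ∧ q.2.2.2 ≠ q.2.1 ∧
        q.2.2.1 ≠ q.2.2.2 then g q.1 q.2.1 q.2.2.1 q.2.2.2 else 0) =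
      ((if q.1 < q.2.1 ∧ q.2.1 < q.2.2.1 ∧ q.2.2.1 < q.2.2.2 then g q.1 q.2.1 q.2.2.1 q.2.2.2 else 0)
      + (if q.1 < q.2.1 ∧ q.2.1 < q.2.2.2 ∧ q.2.2.2 < q.2.2.1 then g q.1 q.2.1 q.2.2.1 q.2.2.2 else 0))
      + ((if q.1 < q.2.2.1 ∧ q.2.2.1 < q.2.1 ∧ q.2.1 < q.2.2.2 then g q.1 q.2.1 q.2.2.1 q.2.2.2 else 0)
      + (if q.1 < q.2.2.2 ∧ q.2.2.2 < q.2.1 ∧ q.2.1 < q.2.2.1 then g q.1 q.2.1 q.2.2.1 q.2.2.2 else 0))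
      + ((if q.1 < q.2.2.1 ∧ q.2.2.1 < q.2.2.2 ∧ q.2.2.2 < q.2.1 then g q.1 q.2.1 q.2.2.1 q.2.2.2 else 0)
      + (if q.1 < q.2.2.2 ∧ q.2.2.2 < q.2.2.1 ∧ q.2.2.1 < q.2.1 then g q.1 q.2.1 q.2.2.1 q.2.2.2 else 0))
      + ((if q.2.2.1 < q.1 ∧ q.1 < q.2.1 ∧ q.2.1 < q.2.2.2 then g q.1 q.2.1 q.2.2.1 q.2.2.2 else 0)
      + (if q.2.2.2 < q.1 ∧ q.1 < q.2.1 ∧ q.2.1 < q.2.2.1 then g q.1 q.2.1 q.2.2.1 q.2.2.2 else 0))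
      + ((if q.2.2.1 < q.1 ∧ q.1 < q.2.2.2 ∧ q.2.2.2 < q.2.1 then g q.1 q.2.1 q.2.2.1 q.2.2.2 else 0)
      + (if q.2.2.2 < q.1 ∧ q.1 < q.2.2.1 ∧ q.2.2.1 < q.2.1 then g q.1 q.2.1 q.2.2.1 q.2.2.2 else 0))
      + ((if q.2.2.1 < q.2.2.2 ∧ q.2.2.2 < q.1 ∧ q.1 < q.2.1 then g q.1 q.2.1 q.2.2.1 q.2.2.2 else 0)
      + (if q.2.2.2 < q.2.2.1 ∧ q.2.2.1 < q.1 ∧ q.1 < q.2.1 then g q.1 q.2.1 q.2.2.1 q.2.2.2 else 0)) := by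
    rintro ⟨i, j, m, p⟩
    dsimp only
    generalize g i j m p = t
    by_cases hd : i < j ∧ m ≠ i ∧ m ≠ j ∧ p ≠ i ∧ p ≠ j ∧ m ≠ p
    · have h : m < p ∨ p < m := by omega
      have h1 : m < i ∨ i < m ∧ m < j ∨ j < m := by omega
      have h2 : p < i ∨ i < p ∧ p < j ∨ j < p := by omega
      rcases h with h | h <;> rcases h1 with h1 | h1 | h1 <;> rcases h2 with h2 | h2 | h2 <;>
        first | omega | simp (disch := omega) only [if_pos, if_neg, add_zero, zero_add]
    · simp (disch := omega) only [if_neg, add_zero]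
  rw [sum_congr rfl fun q _ => key q]
  simp only [sum_add_distrib]
  have mem4 (q : ℕ × ℕ × ℕ × ℕ) : q ∈ quads n ↔
      (q.1 < q.2.1 ∧ q.2.1 < q.2.2.1 ∧ q.2.2.1 < q.2.2.2) ∧ q.2.2.2 < n := by
    obtain ⟨a, b, c, d⟩ := q
    rw [mem_quads]; tauto
  have perm (φ ψ : ℕ × ℕ × ℕ × ℕ → ℕ × ℕ × ℕ × ℕ) h1 h2 h3 h4 := sum_perm_quads n
    (fun q => (φ q).1 < (φ q).2.1 ∧ (φ q).2.1 < (φ q).2.2.1 ∧ (φ q).2.2.1 < (φ q).2.2.2) φ ψ h1 h2 h3 h4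
    (fun q => g q.1 q.2.1 q.2.2.1 q.2.2.2)
  rw [perm (fun q => (q.1, q.2.1, q.2.2.1, q.2.2.2))
      (fun q => (q.1, q.2.1, q.2.2.1, q.2.2.2))
      (by simp only [mem4, mem_product, mem_range]; omega) (by simp only [mem4, mem_product, mem_range]; omega)
      (fun _ => rfl) (fun _ => rfl),
    perm (fun q => (q.1, q.2.1, q.2.2.2, q.2.2.1))
      (fun q => (q.1, q.2.1, q.2.2.2, q.2.2.1))
      (by simp only [mem4, mem_product, mem_range]; omega) (by simp only [mem4, mem_product, mem_range]; omega)
      (fun _ => rfl) (fun _ => rfl),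
    perm (fun q => (q.1, q.2.2.1, q.2.1, q.2.2.2))
      (fun q => (q.1, q.2.2.1, q.2.1, q.2.2.2))
      (by simp only [mem4, mem_product, mem_range]; omega) (by simp only [mem4, mem_product, mem_range]; omega)
      (fun _ => rfl) (fun _ => rfl),
    perm (fun q => (q.1, q.2.2.2, q.2.1, q.2.2.1))
      (fun q => (q.1, q.2.2.1, q.2.2.2, q.2.1))
      (by simp only [mem4, mem_product, mem_range]; omega) (by simp only [mem4, mem_product, mem_range]; omega)
      (fun _ => rfl) (fun _ => rfl),
    perm (fun q => (q.1, q.2.2.1, q.2.2.2, q.2.1))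
      (fun q => (q.1, q.2.2.2, q.2.1, q.2.2.1))
      (by simp only [mem4, mem_product, mem_range]; omega) (by simp only [mem4, mem_product, mem_range]; omega)
      (fun _ => rfl) (fun _ => rfl),
    perm (fun q => (q.1, q.2.2.2, q.2.2.1, q.2.1))
      (fun q => (q.1, q.2.2.2, q.2.2.1, q.2.1))
      (by simp only [mem4, mem_product, mem_range]; omega) (by simp only [mem4, mem_product, mem_range]; omega)
      (fun _ => rfl) (fun _ => rfl),
    perm (fun q => (q.2.2.1, q.1, q.2.1, q.2.2.2))
      (fun q => (q.2.1, q.2.2.1, q.1, q.2.2.2))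
      (by simp only [mem4, mem_product, mem_range]; omega) (by simp only [mem4, mem_product, mem_range]; omega)
      (fun _ => rfl) (fun _ => rfl),
    perm (fun q => (q.2.2.2, q.1, q.2.1, q.2.2.1))
      (fun q => (q.2.1, q.2.2.1, q.2.2.2, q.1))
      (by simp only [mem4, mem_product, mem_range]; omega) (by simp only [mem4, mem_product, mem_range]; omega)
      (fun _ => rfl) (fun _ => rfl),
    perm (fun q => (q.2.2.1, q.1, q.2.2.2, q.2.1))
      (fun q => (q.2.1, q.2.2.2, q.1, q.2.2.1))
      (by simp only [mem4, mem_product, mem_range]; omega) (by simp only [mem4, mem_product, mem_range]; omega)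
      (fun _ => rfl) (fun _ => rfl),
    perm (fun q => (q.2.2.2, q.1, q.2.2.1, q.2.1))
      (fun q => (q.2.1, q.2.2.2, q.2.2.1, q.1))
      (by simp only [mem4, mem_product, mem_range]; omega) (by simp only [mem4, mem_product, mem_range]; omega)
      (fun _ => rfl) (fun _ => rfl),
    perm (fun q => (q.2.2.1, q.2.2.2, q.1, q.2.1))
      (fun q => (q.2.2.1, q.2.2.2, q.1, q.2.1))
      (by simp only [mem4, mem_product, mem_range]; omega) (by simp only [mem4, mem_product, mem_range]; omega)
      (fun _ => rfl) (fun _ => rfl),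
    perm (fun q => (q.2.2.2, q.2.2.1, q.1, q.2.1))
      (fun q => (q.2.2.1, q.2.2.2, q.2.1, q.1))
      (by simp only [mem4, mem_product, mem_range]; omega) (by simp only [mem4, mem_product, mem_range]; omega)
      (fun _ => rfl) (fun _ => rfl)]

/-- The product counts the pairs of a vertex above the edge and a vertex below it; these are
automatically distinct. -/
theorem sum_sideCount_mul (s : ℕ → ℕ → ℕ → Bool) (n : ℕ) :
    ∑ j ∈ range n, ∑ i ∈ range j, sideCount s n true i j * sideCount s n false i j =
    ∑ q ∈ range n ×ˢ range n ×ˢ range n ×ˢ range n,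
      (if q.1 < q.2.1 ∧ q.2.2.1 ≠ q.1 ∧ q.2.2.1 ≠ q.2.1 ∧ q.2.2.2 ≠ q.1 ∧ q.2.2.2 ≠ q.2.1 ∧
        q.2.2.1 ≠ q.2.2.2 then (if sideOf s q.1 q.2.1 q.2.2.1 = true ∧
          sideOf s q.1 q.2.1 q.2.2.2 = false then 1 else 0) else 0) := by
  have h1 : ∀ j ∈ range n, ∑ i ∈ range j, sideCount s n true i j * sideCount s n false i j =
      ∑ i ∈ range n, if i < j then sideCount s n true i j * sideCount s n false i j else 0 := by
    intro j hj
    rw [← sum_filter]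
    congr 1
    ext i
    simp only [mem_filter, mem_range] at *
    omega
  rw [sum_congr rfl h1, sum_comm, sum_product]
  refine sum_congr rfl fun i _ => ?_
  rw [sum_product]
  refine sum_congr rfl fun j _ => ?_
  rw [sum_product]
  unfold sideCount
  rw [card_filter, card_filter, sum_mul_sum]
  split_ifs with hij
  · refine sum_congr rfl fun m _ => sum_congr rfl fun p _ => ?_
    simp only [hij, true_and]
    by_cases hmp : m = p
    · subst hmp; cases sideOf s i j m <;> simp
    · split_ifs <;> simp_all
  · simp [hij]


/-- A complete graph on four vertices has three edges separating the other two vertices, or only two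
if it has a crossing. -/
theorem Consistent.crossCount_add {s : ℕ → ℕ → ℕ → Bool} {n : ℕ} (hs : Consistent s n) :
    crossCount s n + ∑ j ∈ range n, ∑ i ∈ range j, sideCount s n true i j * sideCount s n false i j =
      3 * n.choose 4 := by
  rw [sum_sideCount_mul, sum_split_orders n fun i j m p =>
    if sideOf s i j m = true ∧ sideOf s i j p = false then 1 else 0, crossCount, card_filter,
    ← card_quads, card_eq_sum_ones, mul_sum, ← sum_add_distrib]
  refine sum_congr rfl ?_
  rintro ⟨a, b, c, d⟩ hq
  obtain ⟨hab, hbc, hcd, hd⟩ := mem_quads.1 hq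
  have h1 := hs.right a b c d hab hbc hcd hd
  have h2 := hs.left a b c d hab hbc hcd hd
  have hac := hab.trans hbc
  have hbd := hbc.trans hcd
  have had := hac.trans hcd
  simp only [IsCrossing, sideOf, hab, hbc, hcd, hac, hbd, had, hab.not_gt, hbc.not_gt, hcd.not_gt,
    hac.not_gt, hbd.not_gt, had.not_gt, if_true, if_false]
  -- The claim now concerns the four signs on one quadruple. Consistency discards some of the
  -- sixteen patterns; the others are counted directly.
  rcases Bool.eq_false_or_eq_true (s a b c) with e1 | e1 <;>
    rcases Bool.eq_false_or_eq_true (s a b d) with e2 | e2 <;>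
    rcases Bool.eq_false_or_eq_true (s a c d) with e3 | e3 <;>
    rcases Bool.eq_false_or_eq_true (s b c d) with e4 | e4 <;>
    simp [e1, e2, e3, e4] at h1 h2 ⊢

end CrossCount

/-! ### From unbalanced edges to the lower bound for consistent signatures -/

section LowerBound

open Finset

theorem sideCount_add {s : ℕ → ℕ → ℕ → Bool} {n i j : ℕ} (hij : i < j) (hj : j < n) :
    sideCount s n true i j + sideCount s n false i j + 2 = n := by
  have h1 : sideCount s n true i j = #{m ∈ (range n \ {i, j}) | sideOf s i j m = true} := by
    unfold sideCount
    congr 1; ext m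
    simp only [mem_filter, mem_sdiff, mem_insert, mem_singleton]; tauto
  have h2 : sideCount s n false i j = #{m ∈ (range n \ {i, j}) | ¬ sideOf s i j m = true} := by
    unfold sideCount
    congr 1; ext m
    simp only [mem_filter, mem_sdiff, mem_insert, mem_singleton, Bool.not_eq_true]; tauto
  rw [h1, h2, card_filter_add_card_filter_not, card_sdiff_of_subset, card_pair hij.ne, card_range]
  · omega
  · intro x hx
    simp only [mem_insert, mem_singleton] at hx
    rw [mem_range]; omega

theorem two_mul_sum_range_sub (M L : ℕ) :
    2 * ∑ K ∈ range (M + 1), (K - L) = (M - L) * (M - L + 1) := by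
  induction M with
  | zero => simp
  | succ M ih =>
    rw [sum_range_succ, mul_add, ih]
    rcases le_or_gt L M with h | h
    · rw [Nat.succ_sub h, Nat.succ_eq_add_one]; ring
    · simp [Nat.sub_eq_zero_of_le h.le, Nat.sub_eq_zero_of_le (Nat.succ_le_of_lt h)]

theorem sum_edges_const (n c : ℕ) : ∑ j ∈ range n, ∑ _i ∈ range j, c = n.choose 2 * c := by
  simp only [sum_const, card_range, smul_eq_mul]
  rw [← sum_mul]
  congr 1
  simpa using sum_range_choose_right n 1

/-- A product with fixed sum is its largest value minus a correction made of the shortfalls `K - L`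
and `K - R`, where only the smaller factor contributes. This turns `Consistent.crossCount_add` into
a statement about `edgeDefect`. -/
theorem mul_add_sum_odd {L R M : ℕ} (h : L + R = 2 * M + 1) :
    L * R + ∑ K ∈ range (M + 1), 2 * ((K - L) + (K - R)) = M * (M + 1) := by
  rw [← mul_sum, sum_add_distrib, mul_add, two_mul_sum_range_sub, two_mul_sum_range_sub]
  rcases le_or_gt L M with h1 | h1
  · obtain ⟨x, rfl⟩ := Nat.exists_eq_add_of_le h1
    obtain rfl : R = L + 2 * x + 1 := by omega
    rw [Nat.sub_eq_zero_of_le (show L + x ≤ L + 2 * x + 1 by omega), Nat.add_sub_cancel_left]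
    ring
  · obtain ⟨x, rfl⟩ := Nat.exists_eq_add_of_le (show R ≤ M by omega)
    obtain rfl : L = R + 2 * x + 1 := by omega
    rw [Nat.sub_eq_zero_of_le (show R + x ≤ R + 2 * x + 1 by omega), Nat.add_sub_cancel_left]
    ring

/-- Here the correction is the square of the deviation from `M + 1`, which is a sum of two
consecutive triangular numbers; hence the two ranges. -/
theorem mul_add_sum_even {L R M : ℕ} (h : L + R = 2 * (M + 1)) :
    L * R + (∑ K ∈ range (M + 2), ((K - L) + (K - R)) + ∑ K ∈ range (M + 1), ((K - L) + (K - R))) =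
      (M + 1) ^ 2 := by
  have e1 := two_mul_sum_range_sub (M + 1) L
  have e2 := two_mul_sum_range_sub (M + 1) R
  have e3 := two_mul_sum_range_sub M L
  have e4 := two_mul_sum_range_sub M R
  simp only [sum_add_distrib]
  apply Nat.eq_of_mul_eq_mul_left (show 0 < 2 by norm_num)
  rcases lt_trichotomy L (M + 1) with h1 | h1 | h1
  · obtain ⟨x, rfl⟩ := Nat.exists_eq_add_of_le (show L ≤ M by omega)
    obtain rfl : R = L + 2 * x + 2 := by omega
    rw [show L + x + 1 - L = x + 1 by omega] at e1
    rw [Nat.sub_eq_zero_of_le (by omega)] at e2 e4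
    rw [Nat.add_sub_cancel_left] at e3
    linear_combination e1 + e2 + e3 + e4
  · subst h1
    obtain rfl : R = M + 1 := by omega
    rw [Nat.sub_eq_zero_of_le (by omega)] at e1 e2 e3 e4
    linear_combination e1 + e2 + e3 + e4
  · obtain ⟨x, rfl⟩ := Nat.exists_eq_add_of_le (show R ≤ M by omega)
    obtain rfl : L = R + 2 * x + 2 := by omega
    rw [show R + x + 1 - R = x + 1 by omega] at e2
    rw [Nat.sub_eq_zero_of_le (by omega)] at e1 e3
    rw [Nat.add_sub_cancel_left] at e4
    linear_combination e1 + e2 + e3 + e4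

theorem four_mul_sum_range_prod (M : ℕ) :
    4 * ∑ K ∈ range (M + 1), K * (K + 1) * (K + 2) = M * (M + 1) * (M + 2) * (M + 3) := by
  induction M with
  | zero => simp
  | succ M ih => rw [sum_range_succ, mul_add, ih]; ring

theorem choose_two_cast (n : ℕ) : (2 : ℤ) * (n + 2).choose 2 = (n + 2) * (n + 1) := by
  induction n with
  | zero => simp
  | succ n ih =>
    rw [Nat.choose_succ_succ' (n + 2) 1, Nat.choose_one_right]
    push_cast
    linear_combination ih

theorem choose_four_cast (n : ℕ) :
    (24 : ℤ) * (n + 2).choose 4 = (n + 2) * (n + 1) * n * (n - 1) := by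
  induction n with
  | zero => simp [Nat.choose]
  | succ n ih =>
    have h3 : ∀ m : ℕ, (6 : ℤ) * (m + 2).choose 3 = (m + 2) * (m + 1) * m := by
      intro m
      induction m with
      | zero => simp [Nat.choose]
      | succ m ih =>
        rw [Nat.choose_succ_succ' (m + 2) 2]
        have := choose_two_cast m
        push_cast
        linear_combination ih + 3 * this
    rw [Nat.choose_succ_succ' (n + 2) 3]
    have := h3 n
    push_cast
    linear_combination ih + 4 * this

theorem Consistent.hillZ_le {s : ℕ → ℕ → ℕ → Bool} {n : ℕ} (hs : Consistent s n) :
    hillZ n ≤ crossCount s n := by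
  rcases lt_or_ge n 4 with h4 | h4
  · interval_cases n <;> simp [hillZ]
  have hid := hs.crossCount_add
  have hW : ∀ K, 2 * K < n → K * (K + 1) * (K + 2) ≤ 2 * edgeDefect s K n := fun K h =>
    hs.le_edgeDefect h
  have hL : ∀ j ∈ range n, ∀ i ∈ range j,
      sideCount s n true i j + sideCount s n false i j + 2 = n := fun j hj i hi =>
    sideCount_add (mem_range.1 hi) (mem_range.1 hj)
  have hWdef : ∀ K, edgeDefect s K n = ∑ j ∈ range n, ∑ i ∈ range j,
      ((K - sideCount s n true i j) + (K - sideCount s n false i j)) := fun K => by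
    simp only [edgeDefect, Fintype.sum_bool]
  have hsw : ∀ m, ∑ K ∈ range m, edgeDefect s K n = ∑ j ∈ range n, ∑ i ∈ range j,
      ∑ K ∈ range m, ((K - sideCount s n true i j) + (K - sideCount s n false i j)) := fun m => by
    simp only [hWdef]
    rw [sum_comm]
    exact sum_congr rfl fun j _ => sum_comm
  have hlow : ∀ m, 2 * m < n →
      m * (m + 1) * (m + 2) * (m + 3) ≤ 8 * ∑ K ∈ range (m + 1), edgeDefect s K n := by
    intro m hm
    rw [← four_mul_sum_range_prod, show (8 : ℕ) = 4 * 2 by rfl, mul_assoc]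
    refine Nat.mul_le_mul_left 4 ?_
    rw [mul_sum]
    refine (sum_le_sum fun K hK => hW K ?_)
    rw [mem_range] at hK; omega
  apply Nat.div_le_of_le_mul
  -- An edge leaves `2 * M + 1` or `2 * M + 2` other vertices, which decides between the odd and the
  -- even form of the product identity.
  obtain ⟨M, hM | hM⟩ : ∃ M, n = 2 * M + 3 ∨ n = 2 * (M + 1) + 2 := ⟨(n - 3) / 2, by omega⟩
  · have h1 : ∑ j ∈ range n, ∑ i ∈ range j, sideCount s n true i j * sideCount s n false i j +
        2 * ∑ K ∈ range (M + 1), edgeDefect s K n = n.choose 2 * (M * (M + 1)) := by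
      rw [hsw, mul_sum, ← sum_add_distrib, ← sum_edges_const]
      refine sum_congr rfl fun j hj => ?_
      rw [mul_sum, ← sum_add_distrib]
      refine sum_congr rfl fun i hi => ?_
      rw [mul_sum]
      exact mul_add_sum_odd (by have := hL j hj i hi; omega)
    have h2 := hlow M (by omega)
    have c2 := choose_two_cast (2 * M + 1)
    have c4 := choose_four_cast (2 * M + 1)
    rw [show 2 * M + 1 + 2 = n by omega] at c2 c4
    rw [show n / 2 = M + 1 by omega, show (n - 1) / 2 = M + 1 by omega,
      show (n - 2) / 2 = M by omega, show (n - 3) / 2 = M by omega]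
    zify at hid h1 h2 ⊢
    push_cast at c2 c4
    nlinarith
  · have h1 : ∑ j ∈ range n, ∑ i ∈ range j, sideCount s n true i j * sideCount s n false i j +
        (∑ K ∈ range (M + 2), edgeDefect s K n + ∑ K ∈ range (M + 1), edgeDefect s K n) =
        n.choose 2 * (M + 1) ^ 2 := by
      rw [hsw, hsw, ← sum_add_distrib, ← sum_add_distrib, ← sum_edges_const]
      refine sum_congr rfl fun j hj => ?_
      rw [← sum_add_distrib, ← sum_add_distrib]
      exact sum_congr rfl fun i hi => mul_add_sum_even (by have := hL j hj i hi; omega)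
    have h2 := hlow (M + 1) (by omega)
    have h3 := hlow M (by omega)
    have c2 := choose_two_cast (2 * (M + 1))
    have c4 := choose_four_cast (2 * (M + 1))
    rw [← hM] at c2 c4
    rw [show n / 2 = M + 2 by omega, show (n - 1) / 2 = M + 1 by omega,
      show (n - 2) / 2 = M + 1 by omega, show (n - 3) / 2 = M by omega]
    zify at hid h1 h2 h3 ⊢
    push_cast at c2 c4
    nlinarith

end LowerBound

/-! ### Two-page drawings with few crossings -/

section TwoPage

open Finset

/-- The signature of a two-page drawing: a vertex lies above an edge drawn below the spine. -/
def pageSignature (up : ℕ → ℕ → Bool) (a _b c : ℕ) : Bool := !up a c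

theorem consistent_pageSignature (up : ℕ → ℕ → Bool) (n : ℕ) :
    Consistent (pageSignature up) n :=
  ⟨fun _ _ _ _ _ _ _ _ h => h.symm, fun _ _ _ _ _ _ _ _ _ => rfl⟩

theorem isCrossing_pageSignature {up : ℕ → ℕ → Bool} {q : ℕ × ℕ × ℕ × ℕ} :
    IsCrossing (pageSignature up) q ↔ up q.1 q.2.2.1 = up q.2.1 q.2.2.2 := by
  simp [IsCrossing, pageSignature]

/-- The pages of the Blažek–Koman drawing on `2 * h` vertices: the classes of parallel edges are
split evenly between the pages. -/
def stripePage (h i j : ℕ) : Bool := decide (i + j < h ∨ (2 * h ≤ i + j ∧ i + j < 3 * h))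

/-- The vertices between the ends of an upper edge lie below it. An outer vertex lies above it
exactly when its edge to the farther end is upper, and by the stripe rule these vertices fill four
disjoint intervals. -/
theorem sideCount_stripePage_true {h i j : ℕ} (hij : i < j) (hj : j < 2 * h)
    (hup : stripePage h i j = true) :
    sideCount (pageSignature (stripePage h)) (2 * h) true i j + (min j h - min i h) + 1 = h := by
  have hup' := of_decide_eq_true hup
  have : ({m ∈ range (2 * h) | m ≠ i ∧ m ≠ j ∧
      sideOf (pageSignature (stripePage h)) i j m = true} : Finset ℕ) =
      (Ico 0 (min i (h - j)) ∪ Ico (2 * h - j) (min i (3 * h - j))) ∪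
      (Ico (j + 1) (h - i) ∪ Ico (max (j + 1) (2 * h - i)) (min (2 * h) (3 * h - i))) := by
    ext m
    simp only [mem_filter, mem_range, mem_union, mem_Ico, sideOf, pageSignature, hup, lt_min_iff,
      max_le_iff, Nat.sub_le_iff_le_add, Nat.lt_sub_iff_add_lt, ne_eq]
    rcases lt_trichotomy m i with h1 | h1 | h1
    · simp only [h1, if_true, true_and, Bool.not_not, stripePage, decide_eq_true_eq]; omega
    · omega
    · rcases lt_trichotomy m j with h2 | h2 | h2
      · simp only [h1.not_gt, h2, if_true, if_false, and_false, false_and, or_false, false_or, Bool.not_true, Bool.false_eq_true, and_false,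
          false_iff]
        omega
      · omega
      · simp only [h1.not_gt, h2.not_gt, if_false, and_false, false_and, or_false, false_or, Bool.not_not, stripePage, decide_eq_true_eq]
        omega
  rw [sideCount, this, card_union_of_disjoint, card_union_of_disjoint, card_union_of_disjoint]
  · simp only [Nat.card_Ico]; omega
  all_goals
    rw [disjoint_left]
    intro x
    simp only [mem_union, mem_Ico]
    omega

theorem sideCount_stripePage_false {h i j : ℕ} (hij : i < j) (hj : j < 2 * h)
    (hup : stripePage h i j = false) :
    sideCount (pageSignature (stripePage h)) (2 * h) false i j + (max j h - max i h) + 1 = h := by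
  have hup' := of_decide_eq_false hup
  have : ({m ∈ range (2 * h) | m ≠ i ∧ m ≠ j ∧
      sideOf (pageSignature (stripePage h)) i j m = false} : Finset ℕ) =
      (Ico (h - j) (min i (2 * h - j)) ∪ Ico (3 * h - j) i) ∪
      (Ico (max (j + 1) (h - i)) (2 * h - i) ∪ Ico (max (j + 1) (3 * h - i)) (2 * h)) := by
    ext m
    simp only [mem_filter, mem_range, mem_union, mem_Ico, sideOf, pageSignature, hup, lt_min_iff,
      max_le_iff, Nat.sub_le_iff_le_add, Nat.lt_sub_iff_add_lt, ne_eq]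
    rcases lt_trichotomy m i with h1 | h1 | h1
    · simp only [h1, if_true, and_true, true_and, Bool.not_not, stripePage, decide_eq_false_iff_not]; omega
    · omega
    · rcases lt_trichotomy m j with h2 | h2 | h2
      · simp only [h1.not_gt, h2, if_true, if_false, and_false, false_and, or_false, false_or, Bool.not_false, Bool.true_eq_false, and_false,
          false_iff]
        omega
      · omega
      · simp only [h1.not_gt, h2.not_gt, if_false, and_false, false_and, or_false, false_or, Bool.not_not, stripePage,
          decide_eq_false_iff_not]
        omega
  rw [sideCount, this, card_union_of_disjoint, card_union_of_disjoint, card_union_of_disjoint]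
  · simp only [Nat.card_Ico]; omega
  all_goals
    rw [disjoint_left]
    intro x
    simp only [mem_union, mem_Ico]
    omega

/-- The squared deviation from the balanced split of the vertices by an edge. -/
def stripeDeviation (h i j : ℕ) : ℕ :=
  if stripePage h i j then (min j h - min i h) ^ 2 else (max j h - max i h) ^ 2

/-- The two sides have `h - 1 - z` and `h - 1 + z` vertices in some order, where `z ^ 2` is the
`stripeDeviation`. -/
theorem sideCount_mul_stripePage {h i j : ℕ} (hij : i < j) (hj : j < 2 * h) :
    sideCount (pageSignature (stripePage h)) (2 * h) true i j *
      sideCount (pageSignature (stripePage h)) (2 * h) false i j + stripeDeviation h i j =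
      (h - 1) ^ 2 := by
  have hs := sideCount_add (s := pageSignature (stripePage h)) hij hj
  unfold stripeDeviation
  cases hup : stripePage h i j
  · have h1 := sideCount_stripePage_false hij hj hup
    revert hs h1
    generalize sideCount _ _ true i j = x
    generalize sideCount _ _ false i j = y
    generalize max j h - max i h = z
    intro hs h1
    obtain rfl : h = y + z + 1 := by omega
    obtain rfl : x = y + 2 * z := by omega
    simp only [Nat.add_sub_cancel]
    simp; ring
  · have h1 := sideCount_stripePage_true hij hj hup
    revert hs h1
    generalize sideCount _ _ true i j = x
    generalize sideCount _ _ false i j = y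
    generalize min j h - min i h = z
    intro hs h1
    obtain rfl : h = x + z + 1 := by omega
    obtain rfl : y = x + 2 * z := by omega
    simp only [Nat.add_sub_cancel]
    simp; ring

theorem sum_range_sq (n : ℕ) : 6 * ∑ i ∈ range (n + 1), i ^ 2 = n * (n + 1) * (2 * n + 1) := by
  induction n with
  | zero => simp
  | succ n ih => rw [sum_range_succ, mul_add, ih]; ring

theorem sum_range_sub_sq (n : ℕ) : ∑ i ∈ range n, (n - i) ^ 2 = ∑ i ∈ range (n + 1), i ^ 2 := by
  rw [sum_range_succ', ← sum_range_reflect]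
  simp only [ne_eq, OfNat.ofNat_ne_zero, not_false_eq_true, zero_pow, add_zero]
  refine sum_congr rfl fun i hi => ?_
  rw [mem_range] at hi
  congr 1; omega

theorem sum_differences_sq (h : ℕ) :
    12 * ∑ j ∈ range h, ∑ i ∈ range j, (j - i) ^ 2 + h ^ 2 = h ^ 4 := by
  induction h with
  | zero => simp
  | succ h ih =>
    rw [sum_range_succ, sum_range_sub_sq]
    have := sum_range_sq h
    linear_combination ih + 2 * this

theorem sum_min_sq (h : ℕ) :
    6 * ∑ j ∈ range h, ∑ i ∈ range h, (min (i + 1) j) ^ 2 + h ^ 2 = h ^ 4 := by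
  induction h with
  | zero => simp
  | succ h ih =>
    have e1 : ∑ i ∈ range (h + 1), (min (i + 1) h) ^ 2 = ∑ i ∈ range (h + 1), i ^ 2 + h ^ 2 := by
      rw [sum_range_succ, sum_range_succ' (fun i => i ^ 2)]
      rw [Nat.min_eq_right (Nat.le_succ h)]
      simp only [ne_eq, OfNat.ofNat_ne_zero, not_false_eq_true, zero_pow, add_zero]
      congr 1
      refine sum_congr rfl fun i hi => ?_
      rw [Nat.min_eq_left (mem_range.1 hi)]
    have e2 : ∑ j ∈ range h, (min (h + 1) j) ^ 2 + h ^ 2 = ∑ i ∈ range (h + 1), i ^ 2 := by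
      rw [sum_range_succ]
      congr 1
      refine sum_congr rfl fun i hi => ?_
      rw [mem_range] at hi
      rw [Nat.min_eq_right (by omega)]
    have e3 : ∑ j ∈ range (h + 1), ∑ i ∈ range (h + 1), (min (i + 1) j) ^ 2 =
        ∑ j ∈ range h, ∑ i ∈ range h, (min (i + 1) j) ^ 2 + ∑ j ∈ range h, (min (h + 1) j) ^ 2 +
        ∑ i ∈ range (h + 1), (min (i + 1) h) ^ 2 := by
      rw [sum_range_succ, ← sum_add_distrib]
      congr 1
      exact sum_congr rfl fun j _ => sum_range_succ _ _
    rw [e3]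
    have := sum_range_sq h
    linear_combination ih + 6 * e1 + 6 * e2 + 2 * this

/-- Of the edges `ij` and `(h + i)(h + j)` inside the two halves, one has deviation zero and the
other `(j - i) ^ 2`. After reflection of the left half, an edge between the halves has deviation
`(min (i + 1) j) ^ 2`. -/
theorem sum_stripeDeviation (h : ℕ) :
    4 * ∑ j ∈ range (2 * h), ∑ i ∈ range j, stripeDeviation h i j + h ^ 2 = h ^ 4 := by
  have key : ∑ j ∈ range (2 * h), ∑ i ∈ range j, stripeDeviation h i j =
      ∑ j ∈ range h, ∑ i ∈ range j, (j - i) ^ 2 +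
      ∑ j ∈ range h, ∑ i ∈ range h, (min (i + 1) j) ^ 2 := by
    rw [two_mul, sum_range_add, ← sum_add_distrib, ← sum_add_distrib]
    refine sum_congr rfl fun j hj => ?_
    rw [mem_range] at hj
    rw [sum_range_add, add_left_comm, add_comm, ← sum_add_distrib]
    congr 1
    · refine sum_congr rfl fun i hi => ?_
      rw [mem_range] at hi
      unfold stripeDeviation stripePage
      rcases lt_or_ge (i + j) h with h1 | h1
      · rw [if_pos (by simp only [decide_eq_true_eq]; omega),
          if_pos (by simp only [decide_eq_true_eq]; omega),
          show min j h - min i h = j - i by omega, show min (h + j) h - min (h + i) h = 0 by omega]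
        simp
      · rw [if_neg (by simp only [decide_eq_true_eq]; omega),
          if_neg (by simp only [decide_eq_true_eq]; omega),
          show max j h - max i h = 0 by omega,
          show max (h + j) h - max (h + i) h = j - i by omega]
        simp
    · rw [← sum_range_reflect]
      refine sum_congr rfl fun i hi => ?_
      rw [mem_range] at hi
      unfold stripeDeviation stripePage
      split_ifs with h1 <;> simp only [decide_eq_true_eq] at h1 <;> congr 1 <;> omega
  have h1 := sum_differences_sq h
  have h2 := sum_min_sq h
  rw [key]
  apply Nat.eq_of_mul_eq_mul_left (show 0 < 3 by norm_num)
  linear_combination h1 + 2 * h2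

theorem crossCount_stripePage_le (h : ℕ) :
    crossCount (pageSignature (stripePage h)) (2 * h) ≤ hillZ (2 * h) := by
  have h0 := (consistent_pageSignature (stripePage h) (2 * h)).crossCount_add
  rcases lt_or_ge h 2 with hh | hh
  · have : (2 * h).choose 4 = 0 := Nat.choose_eq_zero_of_lt (by omega)
    rw [this] at h0
    omega
  obtain ⟨k, rfl⟩ := Nat.exists_eq_add_of_le' hh
  have h1 : ∑ j ∈ range (2 * (k + 2)), ∑ i ∈ range j,
      sideCount (pageSignature (stripePage (k + 2))) (2 * (k + 2)) true i j *
      sideCount (pageSignature (stripePage (k + 2))) (2 * (k + 2)) false i j +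
      ∑ j ∈ range (2 * (k + 2)), ∑ i ∈ range j, stripeDeviation (k + 2) i j =
      (2 * (k + 2)).choose 2 * (k + 1) ^ 2 := by
    rw [← sum_edges_const, ← sum_add_distrib]
    refine sum_congr rfl fun j hj => ?_
    rw [← sum_add_distrib]
    exact sum_congr rfl fun i hi => sideCount_mul_stripePage (mem_range.1 hi) (mem_range.1 hj)
  have h2 := sum_stripeDeviation (k + 2)
  have c2 := choose_two_cast (2 * (k + 1))
  have c4 := choose_four_cast (2 * (k + 1))
  rw [show 2 * (k + 1) + 2 = 2 * (k + 2) by omega] at c2 c4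
  rw [hillZ, Nat.le_div_iff_mul_le (by norm_num), show 2 * (k + 2) / 2 = k + 2 by omega,
    show (2 * (k + 2) - 1) / 2 = k + 1 by omega, show (2 * (k + 2) - 2) / 2 = k + 1 by omega,
    show (2 * (k + 2) - 3) / 2 = k by omega]
  zify at h0 h1 h2 ⊢
  push_cast at c2 c4
  nlinarith

/-- The increasing enumeration of the natural numbers other than `v`. -/
def skip (v i : ℕ) : ℕ := if i < v then i else i + 1

theorem skip_lt_skip {v i j : ℕ} (h : i < j) : skip v i < skip v j := by
  unfold skip; split_ifs <;> omega

theorem skip_ne (v i : ℕ) : skip v i ≠ v := by unfold skip; split_ifs <;> omega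

theorem skip_lt {v i n : ℕ} (h : i < n) : skip v i < n + 1 := by unfold skip; split_ifs <;> omega

theorem skip_injective (v : ℕ) : Function.Injective (skip v) := by
  intro i j h; unfold skip at h; split_ifs at h <;> omega

/-- Deleting the vertex `v` leaves a two-page drawing whose crossings are among those avoiding `v`;
`skip v` restores the old numbering. -/
theorem crossCount_skip_le (up : ℕ → ℕ → Bool) (n v : ℕ) :
    crossCount (pageSignature fun i j => up (skip v i) (skip v j)) n ≤
      #{q ∈ {q ∈ quads (n + 1) | IsCrossing (pageSignature up) q} |
        v ∉ ({q.1, q.2.1, q.2.2.1, q.2.2.2} : Finset ℕ)} := by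
  apply card_le_card_of_injOn
    (fun q => (skip v q.1, skip v q.2.1, skip v q.2.2.1, skip v q.2.2.2))
  · rintro ⟨a, b, c, d⟩ hq
    simp only [coe_filter, Set.mem_ofPred_eq, mem_quads, isCrossing_pageSignature] at hq
    simp only [coe_filter, mem_filter, Set.mem_ofPred_eq, mem_quads, isCrossing_pageSignature,
      mem_insert, mem_singleton, not_or]
    exact ⟨⟨⟨skip_lt_skip hq.1.1, skip_lt_skip hq.1.2.1, skip_lt_skip hq.1.2.2.1,
      skip_lt hq.1.2.2.2⟩, hq.2⟩, (skip_ne _ _).symm, (skip_ne _ _).symm, (skip_ne _ _).symm,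
      (skip_ne _ _).symm⟩
  · rintro ⟨a, b, c, d⟩ - ⟨a', b', c', d'⟩ - h
    simp only [Prod.mk.injEq, (skip_injective v).eq_iff] at h ⊢
    exact h

theorem sum_card_avoiding (n : ℕ) (S : Finset (ℕ × ℕ × ℕ × ℕ)) (hS : S ⊆ quads n) :
    ∑ v ∈ range n, #{q ∈ S | v ∉ ({q.1, q.2.1, q.2.2.1, q.2.2.2} : Finset ℕ)} = #S * (n - 4) := by
  simp only [card_filter]
  rw [sum_comm, card_eq_sum_ones, sum_mul]
  refine sum_congr rfl ?_
  rintro ⟨a, b, c, d⟩ hq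
  obtain ⟨hab, hbc, hcd, hd⟩ := mem_quads.1 (hS hq)
  rw [← card_filter, filter_notMem_eq_sdiff, card_sdiff_of_subset, card_range, one_mul]
  · congr 1
    have h1 : a ∉ ({b, c, d} : Finset ℕ) := by simp; omega
    have h2 : b ∉ ({c, d} : Finset ℕ) := by simp; omega
    rw [card_insert_of_notMem h1, card_insert_of_notMem h2, card_pair hcd.ne]
  · intro x hx
    simp only [mem_insert, mem_singleton] at hx
    rw [mem_range]; omega

/-- Some two-page drawing of the complete graph has at most `hillZ n` crossings. -/
theorem exists_page_crossCount_le (n : ℕ) :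
    ∃ up : ℕ → ℕ → Bool, crossCount (pageSignature up) n ≤ hillZ n := by
  rcases Nat.even_or_odd' n with ⟨h, rfl | rfl⟩
  · exact ⟨_, crossCount_stripePage_le h⟩
  -- Averaging over the deleted vertex of the stripe drawing on `n + 1 = 2 * k + 4` vertices: each
  -- crossing survives `2 * k` of the `2 * k + 4` deletions, and `Z(2k + 4) * 2k / (2k + 4) = Z(2k +
  -- 3)`.
  by_contra! hcon
  rcases lt_or_ge h 1 with hh | hh
  · have h1 := hcon (fun _ _ => true)
    have h2 := (consistent_pageSignature (fun _ _ => true) (2 * h + 1)).crossCount_add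
    rw [Nat.choose_eq_zero_of_lt (by omega)] at h2
    omega
  obtain ⟨k, rfl⟩ := Nat.exists_eq_add_of_le' hh
  have h1 := crossCount_stripePage_le (k + 2)
  have h2 := sum_card_avoiding (2 * (k + 2))
    {q ∈ quads (2 * (k + 2)) | IsCrossing (pageSignature (stripePage (k + 2))) q}
    (filter_subset _ _)
  have h3 : 2 * (k + 2) * (hillZ (2 * (k + 1) + 1) + 1) ≤ ∑ v ∈ range (2 * (k + 2)),
      #{q ∈ {q ∈ quads (2 * (k + 2)) | IsCrossing (pageSignature (stripePage (k + 2))) q} |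
        v ∉ ({q.1, q.2.1, q.2.2.1, q.2.2.2} : Finset ℕ)} := by
    conv_lhs => rw [← card_range (2 * (k + 2)), ← smul_eq_mul, ← sum_const]
    refine sum_le_sum fun v _ => ?_
    exact (hcon _).trans_le (crossCount_skip_le (stripePage (k + 2)) (2 * (k + 1) + 1) v)
  rw [h2, ← crossCount] at h3
  -- The floor inequalities in `h4` and `h5` suffice, so no divisibility by `4` is needed here.
  have h4 : 4 * hillZ (2 * (k + 2)) ≤ (k + 2) * (k + 1) * (k + 1) * k := by
    rw [hillZ, show 2 * (k + 2) / 2 = k + 2 by omega,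
      show (2 * (k + 2) - 1) / 2 = k + 1 by omega, show (2 * (k + 2) - 2) / 2 = k + 1 by omega,
      show (2 * (k + 2) - 3) / 2 = k by omega]
    omega
  have h5 : (k + 1) * (k + 1) * k * k < 4 * (hillZ (2 * (k + 1) + 1) + 1) := by
    rw [hillZ, show (2 * (k + 1) + 1) / 2 = k + 1 by omega,
      show (2 * (k + 1) + 1 - 1) / 2 = k + 1 by omega, show (2 * (k + 1) + 1 - 2) / 2 = k by omega,
      show (2 * (k + 1) + 1 - 3) / 2 = k by omega]
    omega
  rw [show 2 * (k + 2) - 4 = 2 * k by omega] at h3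
  have h6 := Nat.mul_le_mul_right (2 * k) (h1)
  nlinarith

end TwoPage

/-! ### Proper crossings of function graphs and parity of zeros -/

section Crossings

open Set Filter Topology

/-- Two function graphs that cross properly do not touch. -/
theorem CrossProperlyAt.not_eventually_lt {A B : Set (ℝ × ℝ)} {p : ℝ × ℝ} {f g : ℝ → ℝ}
    (h : CrossProperlyAt A B p) (hf : Continuous f) (hA : ∀ᶠ q in 𝓝 p, q ∈ A ↔ q.2 = f q.1)
    (hB : ∀ᶠ q in 𝓝 p, q ∈ B ↔ q.2 = g q.1) : ¬ ∀ᶠ x in 𝓝[≠] p.1, g x < f x := by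
  intro hgf
  obtain ⟨h, hp, h0, hAB⟩ := h
  obtain ⟨x0, y0⟩ := p
  have hfy : y0 = f x0 := hA.self_of_nhds.1 ((hAB _ hp).1.2 (by rw [h0]))
  have hgy : y0 = g x0 := hB.self_of_nhds.1 ((hAB _ hp).2.2 (by rw [h0]))
  -- Coordinates that straighten the graph of `f`: the second one is the depth below it. The image
  -- of a thin open rectangle is a connected region just below `A` that misses `A`.
  let Φ : ℝ × ℝ → ℝ × ℝ := fun z => (z.1, f z.1 - z.2)
  have hΦ : Continuous Φ := by fun_prop
  have hΦ0 : Φ (x0, 0) = (x0, y0) := by simp [Φ, hfy]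
  have hU : ∀ᶠ z in 𝓝 (x0, (0 : ℝ)), Φ z ∈ h.source ∧ (Φ z ∈ A ↔ (Φ z).2 = f (Φ z).1) := by
    have : ∀ᶠ q in 𝓝 (Φ (x0, 0)), q ∈ h.source ∧ (q ∈ A ↔ q.2 = f q.1) := by
      rw [hΦ0]; exact Filter.Eventually.and (h.open_source.mem_nhds hp) hA
    exact hΦ.continuousAt.eventually this
  rw [eventually_nhdsWithin_iff] at hgf
  obtain ⟨δ, hδ, hball⟩ := Metric.eventually_nhds_iff.1 hU
  obtain ⟨ε, hε, hball'⟩ := Metric.eventually_nhds_iff.1 hgf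
  have hR : IsPreconnected (Φ '' (Ioo (x0 - δ) (x0 + δ) ×ˢ Ioo 0 δ)) :=
    (isPreconnected_Ioo.prod isPreconnected_Ioo).image _ hΦ.continuousOn
  have hRU : ∀ q ∈ Φ '' (Ioo (x0 - δ) (x0 + δ) ×ˢ Ioo 0 δ), q ∈ h.source ∧ (h q).2 ≠ 0 := by
    rintro _ ⟨⟨x, s⟩, ⟨hx, hs⟩, rfl⟩
    simp only [mem_Ioo] at hx hs
    have := hball (y := (x, s)) (by
      rw [Prod.dist_eq, max_lt_iff, Real.dist_eq, Real.dist_eq, abs_lt, abs_lt]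
      exact ⟨⟨by linarith, by linarith⟩, by linarith, by linarith⟩)
    refine ⟨this.1, fun h1 => ?_⟩
    have h2 := this.2.1 ((hAB _ this.1).1.2 h1)
    simp only [Φ] at h2
    linarith
  -- In the chart `h`, missing `A` means that the second coordinate does not vanish, so on this
  -- connected region it has constant sign.
  have himg : IsPreconnected ((fun q => (h q).2) '' (Φ '' (Ioo (x0 - δ) (x0 + δ) ×ˢ Ioo 0 δ))) :=
    hR.image _ (continuous_snd.comp_continuousOn
      (h.continuousOn.mono fun q hq => (hRU q hq).1))
  have htar : (0, 0) ∈ h.target := h0 ▸ h.map_source hp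
  have hsymm : h.symm (0, 0) = (x0, y0) := by rw [← h0, h.left_inv hp]
  have hcurve : Tendsto (fun t : ℝ => h.symm (0, t)) (𝓝 0) (𝓝 (x0, y0)) := by
    have h1 : ContinuousAt h.symm (0, 0) := h.symm.continuousAt htar
    have h2 : Tendsto (fun t : ℝ => ((0 : ℝ), t)) (𝓝 0) (𝓝 (0, 0)) :=
      Continuous.tendsto' (by fun_prop) _ _ rfl
    rw [← hsymm]
    exact h1.tendsto.comp h2
  have hnear : ∀ᶠ q : ℝ × ℝ in 𝓝 (x0, y0), |q.1 - x0| < δ ∧ |q.1 - x0| < ε ∧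
      f q.1 - q.2 < δ := by
    have e1 : Tendsto (fun q : ℝ × ℝ => |q.1 - x0|) (𝓝 (x0, y0)) (𝓝 0) :=
      Continuous.tendsto' (by fun_prop) _ _ (by simp)
    have e2 : Tendsto (fun q : ℝ × ℝ => f q.1 - q.2) (𝓝 (x0, y0)) (𝓝 0) :=
      Continuous.tendsto' (by fun_prop) _ _ (by simp [hfy])
    exact (e1.eventually (gt_mem_nhds hδ)).and
      ((e1.eventually (gt_mem_nhds hε)).and (e2.eventually (gt_mem_nhds hδ)))
  have htarget : ∀ᶠ t : ℝ in 𝓝 0, ((0 : ℝ), t) ∈ h.target :=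
    (Continuous.tendsto' (f := fun t : ℝ => ((0 : ℝ), t)) (by fun_prop) 0 (0, 0) rfl).eventually
      (h.open_target.mem_nhds htar)
  -- If `g < f` around `p`, the points of `B` near `p` other than `p` lie in that region. In the
  -- chart they are the points `(0, t)` with `t` of both signs, a contradiction.
  have hmem : ∀ᶠ t : ℝ in 𝓝 0, t ≠ 0 →
      t ∈ (fun q => (h q).2) '' (Φ '' (Ioo (x0 - δ) (x0 + δ) ×ˢ Ioo 0 δ)) := by
    filter_upwards [htarget, hcurve.eventually hnear, hcurve.eventually hB] with t h1 h2 h3 ht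
    have hh : h (h.symm (0, t)) = (0, t) := h.right_inv h1
    have hB' := h3.1 ((hAB _ (h.map_target h1)).2.2 (by rw [hh]))
    revert h2 hB' hh
    generalize h.symm (0, t) = q
    obtain ⟨x, y⟩ := q
    simp only
    rintro ⟨hx1, hx2, hy⟩ hh rfl
    have hne : x ≠ x0 := by
      rintro rfl
      rw [← hgy, h0] at hh
      exact ht (congrArg Prod.snd hh).symm
    have hlt := hball' (by rw [Real.dist_eq]; exact hx2) hne
    rw [abs_lt] at hx1
    refine ⟨(x, g x), ⟨(x, f x - g x), ⟨?_, ?_⟩, ?_⟩, ?_⟩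
    · exact ⟨by linarith, by linarith⟩
    · exact ⟨by simpa using hlt, by simpa using hy⟩
    · simp [Φ]
    · simp [hh]
  obtain ⟨η, hη, hη'⟩ := Metric.eventually_nhds_iff.1 hmem
  have hpos := hη' (y := η / 2) (by rw [Real.dist_eq, sub_zero, abs_of_pos] <;> linarith)
    (by positivity)
  have hneg := hη' (y := -(η / 2)) (by rw [Real.dist_eq, sub_zero, abs_neg, abs_of_pos] <;> linarith)
    (by linarith)
  obtain ⟨q, hq, hq0⟩ := himg.ordConnected.out hneg hpos
    (show (0 : ℝ) ∈ Icc (-(η / 2)) (η / 2) from ⟨by linarith, by linarith⟩)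
  exact (hRU q hq).2 hq0

theorem mul_pos_of_continuous_of_ne_zero {g : ℝ → ℝ} (hg : Continuous g) {l r : ℝ} (hlr : l ≤ r)
    (h : ∀ x ∈ Icc l r, g x ≠ 0) : 0 < g l * g r := by
  by_contra hcon
  have hl := h l (left_mem_Icc.2 hlr)
  have hr := h r (right_mem_Icc.2 hlr)
  have hneg : g l * g r < 0 := lt_of_le_of_ne (not_lt.1 hcon) (mul_ne_zero hl hr)
  have h0 : (0 : ℝ) ∈ g '' Icc l r := by
    rcases mul_neg_iff.1 hneg with ⟨h1, h2⟩ | ⟨h1, h2⟩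
    · exact intermediate_value_Icc' hlr hg.continuousOn ⟨h2.le, h1.le⟩
    · exact intermediate_value_Icc hlr hg.continuousOn ⟨h1.le, h2.le⟩
  obtain ⟨x, hx, hx0⟩ := h0
  exact h x hx hx0

theorem exists_zero_of_mul_neg {g : ℝ → ℝ} (hg : Continuous g) {l r : ℝ} (hlr : l ≤ r)
    (h : g l * g r < 0) : ∃ x ∈ Ioo l r, g x = 0 := by
  by_contra! hcon
  refine (mul_pos_of_continuous_of_ne_zero hg hlr fun x hx hx0 => ?_).not_gt h
  rcases hx.1.eq_or_lt with rfl | h1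
  · simp [hx0] at h
  rcases hx.2.eq_or_lt with rfl | h2
  · simp [hx0] at h
  exact hcon x ⟨h1, h2⟩ hx0

/-- A continuous function that changes sign at each of its finitely many zeros has an odd number of
zeros if and only if its values at the ends of the interval have opposite signs. -/
theorem odd_ncard_zeros_iff {g : ℝ → ℝ} (hg : Continuous g) {l r : ℝ} (hlr : l < r)
    (hfin : {x | x ∈ Ioo l r ∧ g x = 0}.Finite) (hl : g l ≠ 0) (hr : g r ≠ 0)
    (hpos : ∀ x ∈ Ioo l r, g x = 0 → ¬ ∀ᶠ y in 𝓝[≠] x, 0 < g y)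
    (hneg : ∀ x ∈ Ioo l r, g x = 0 → ¬ ∀ᶠ y in 𝓝[≠] x, g y < 0) :
    Odd {x | x ∈ Ioo l r ∧ g x = 0}.ncard ↔ g l * g r < 0 := by
  induction hk : {x | x ∈ Ioo l r ∧ g x = 0}.ncard generalizing l with
  | zero =>
    rw [Set.ncard_eq_zero hfin] at hk
    have := mul_pos_of_continuous_of_ne_zero hg hlr.le fun x hx hx0 => by
      have : x ∉ {x | x ∈ Ioo l r ∧ g x = 0} := by rw [hk]; exact notMem_empty x
      refine this ⟨⟨lt_of_le_of_ne hx.1 ?_, lt_of_le_of_ne hx.2 ?_⟩, hx0⟩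
      · rintro rfl; exact hl hx0
      · rintro rfl; exact hr hx0
    simp [this.not_gt]
  | succ k ih =>
    have hne : {x | x ∈ Ioo l r ∧ g x = 0}.Nonempty := by
      rw [← Set.ncard_pos hfin, hk]; exact Nat.succ_pos k
    -- The least zero `z` is removed by moving the left end to a point `l'` between `z` and the next
    -- zero; this flips the sign of `g` at the left end.
    obtain ⟨z, ⟨hz, hz0⟩, hmin⟩ := Set.exists_min_image _ id hfin hne
    have hclosed : IsClosed (({x | x ∈ Ioo l r ∧ g x = 0} \ {z}) ∪ {r}) :=
      (((hfin.subset sdiff_subset).union (finite_singleton r))).isClosed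
    have hznot : z ∈ (({x | x ∈ Ioo l r ∧ g x = 0} \ {z}) ∪ {r})ᶜ := by
      simp [hz.2.ne]
    obtain ⟨u, hu, hsub⟩ := mem_nhdsGE_iff_exists_Ico_subset.1
      (mem_nhdsWithin_of_mem_nhds (hclosed.isOpen_compl.mem_nhds hznot))
    have hu' : z < u := hu
    have hur : u ≤ r := by
      by_contra! hcon
      exact hsub ⟨hz.2.le, hcon⟩ (Or.inr rfl)
    obtain ⟨l', hl'1, hl'2⟩ := exists_between hu'
    have hfree : ∀ x, z < x → x ≤ l' → g x ≠ 0 := fun x h1 h2 h3 =>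
      hsub ⟨h1.le, h2.trans_lt hl'2⟩
        (Or.inl ⟨⟨⟨hz.1.trans h1, h2.trans_lt (hl'2.trans_le hur)⟩, h3⟩, h1.ne'⟩)
    have hfreel : ∀ x, l ≤ x → x < z → g x ≠ 0 := fun x h1 h2 h3 => by
      rcases h1.eq_or_lt with rfl | h1
      · exact hl h3
      · exact (hmin x ⟨⟨h1, h2.trans hz.2⟩, h3⟩).not_gt h2
    have hl'0 : g l' ≠ 0 := hfree l' hl'1 le_rfl
    have hsignl : ∀ x, l ≤ x → x < z → 0 < g l * g x := fun x h1 h2 =>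
      mul_pos_of_continuous_of_ne_zero hg h1 fun y hy => hfreel y hy.1 (hy.2.trans_lt h2)
    have hsignr : ∀ x, z < x → x ≤ l' → 0 < g x * g l' := fun x h1 h2 =>
      mul_pos_of_continuous_of_ne_zero hg h2 fun y hy => hfree y (h1.trans_le hy.1) hy.2
    have hnhds : Ioo l l' ∈ 𝓝 z := Ioo_mem_nhds hz.1 hl'1
    have hflip : g l * g l' < 0 := by
      by_contra hcon
      have hp : 0 < g l * g l' := lt_of_le_of_ne (not_lt.1 hcon) (mul_ne_zero hl hl'0).symm
      rcases mul_pos_iff.1 hp with ⟨h1, h2⟩ | ⟨h1, h2⟩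
      · apply hpos z hz hz0
        filter_upwards [mem_nhdsWithin_of_mem_nhds hnhds, self_mem_nhdsWithin] with y hy hyz
        rcases lt_or_gt_of_ne hyz with h | h
        · exact (mul_pos_iff_of_pos_left h1).1 (hsignl y hy.1.le h)
        · exact (mul_pos_iff_of_pos_right h2).1 (hsignr y h hy.2.le)
      · apply hneg z hz hz0
        filter_upwards [mem_nhdsWithin_of_mem_nhds hnhds, self_mem_nhdsWithin] with y hy hyz
        rcases lt_or_gt_of_ne hyz with h | h
        · exact (neg_iff_neg_of_mul_pos (hsignl y hy.1.le h)).1 h1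
        · exact (neg_iff_neg_of_mul_pos (hsignr y h hy.2.le)).2 h2
    have hins : {x | x ∈ Ioo l r ∧ g x = 0} = insert z {x | x ∈ Ioo l' r ∧ g x = 0} := by
      ext x
      simp only [mem_ofPred_eq, mem_insert_iff, mem_Ioo]
      constructor
      · rintro ⟨⟨h1, h2⟩, h3⟩
        rcases lt_trichotomy x z with h | h | h
        · exact absurd h3 (hfreel x h1.le h)
        · exact Or.inl h
        · exact Or.inr ⟨⟨lt_of_not_ge fun h4 => hfree x h h4 h3, h2⟩, h3⟩
      · rintro (rfl | ⟨⟨h1, h2⟩, h3⟩)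
        · exact ⟨hz, hz0⟩
        · exact ⟨⟨hz.1.trans (hl'1.trans h1), h2⟩, h3⟩
    have hfin' : {x | x ∈ Ioo l' r ∧ g x = 0}.Finite :=
      hfin.subset (by rw [hins]; exact subset_insert _ _)
    have hcard : {x | x ∈ Ioo l' r ∧ g x = 0}.ncard = k := by
      rw [hins, Set.ncard_insert_of_notMem _ hfin'] at hk
      · omega
      · rintro ⟨⟨h1, -⟩, -⟩
        exact (h1.trans hl'1).false
    have hl'l : ∀ x ∈ Ioo l' r, x ∈ Ioo l r := fun x hx => ⟨hz.1.trans (hl'1.trans hx.1), hx.2⟩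
    have := ih (hl'2.trans_le hur) hfin' hl'0 (fun x hx => hpos x (hl'l x hx))
      (fun x hx => hneg x (hl'l x hx)) hcard
    rw [Nat.odd_add_one, this]
    rcases hl.lt_or_gt with h1 | h1 <;> rcases hl'0.lt_or_gt with h2 | h2 <;>
      rcases hr.lt_or_gt with h3 | h3 <;>
      simp only [mul_neg_iff, h1, h2, h3, h1.not_gt, h2.not_gt, h3.not_gt] at hflip ⊢ <;>
      simp at hflip ⊢

end Crossings

/-! ### Monotone drawings as families of function graphs -/

section MonotoneModel

open Set Filter Topology

/-- A simple arc that meets every vertical line at most once is the graph of a continuous function. -/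
theorem IsSimpleArc.exists_graph {A : Set (ℝ × ℝ)} {p q : ℝ × ℝ} (hA : IsSimpleArc A p q)
    (hpq : p.1 < q.1) (hmono : ∀ z ∈ A, ∀ w ∈ A, z.1 = w.1 → z = w) :
    ∃ F : ℝ → ℝ, Continuous F ∧ A = {z | z.1 ∈ Icc p.1 q.1 ∧ z.2 = F z.1} := by
  obtain ⟨γ, hγ, rfl⟩ := hA
  have hφc : Continuous fun t => (γ t).1 := by fun_prop
  have hφi : Function.Injective fun t => (γ t).1 := fun t u h =>
    hγ (hmono _ (mem_range_self t) _ (mem_range_self u) h)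
  have hφm : StrictMono fun t => (γ t).1 :=
    hφc.strictMono_of_inj_boundedOrder
      (show (γ 0).1 ≤ (γ 1).1 by rw [γ.source, γ.target]; exact hpq.le) hφi
  have hle : p.1 ≤ q.1 := hpq.le
  have hmem : ∀ t, (γ t).1 ∈ Icc p.1 q.1 := fun t => by
    have h0 : (γ 0).1 ≤ (γ t).1 := hφm.monotone (bot_le : (0 : unitInterval) ≤ t)
    have h1 : (γ t).1 ≤ (γ 1).1 := hφm.monotone (le_top : t ≤ (1 : unitInterval))
    rw [γ.source] at h0
    rw [γ.target] at h1
    exact ⟨h0, h1⟩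
  have hsurj : ∀ x ∈ Icc p.1 q.1, ∃ t, (γ t).1 = x := fun x hx =>
    (isPreconnected_range hφc).ordConnected.out (⟨0, by simp⟩ : p.1 ∈ range fun t => (γ t).1)
      (⟨1, by simp⟩ : q.1 ∈ range fun t => (γ t).1) hx
  -- The abscissa along the arc is a continuous bijection from a compact interval, hence a
  -- homeomorphism. Following its inverse with the ordinate gives the function, and `projIcc`
  -- extends it to the whole line.
  let ψ : unitInterval → Icc p.1 q.1 := fun t => ⟨(γ t).1, hmem t⟩
  have hψ : Function.Bijective ψ :=
    ⟨fun t u h => hφi (congrArg Subtype.val h), fun x => by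
      obtain ⟨t, ht⟩ := hsurj x x.2
      exact ⟨t, Subtype.ext ht⟩⟩
  have hψc : Continuous (Equiv.ofBijective ψ hψ) := hφc.subtype_mk _
  let e := hψc.homeoOfEquivCompactToT2
  have he : ∀ t, e t = ⟨(γ t).1, hmem t⟩ := fun t => rfl
  refine ⟨fun x => (γ (e.symm (projIcc p.1 q.1 hle x))).2, by fun_prop, ?_⟩
  have hF : ∀ t, (γ (e.symm (projIcc p.1 q.1 hle (γ t).1))).2 = (γ t).2 := fun t => by
    rw [projIcc_of_mem hle (hmem t), ← he, e.symm_apply_apply]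
  ext z
  constructor
  · rintro ⟨t, rfl⟩
    exact ⟨hmem t, (hF t).symm⟩
  · rintro ⟨h1, h2⟩
    obtain ⟨t, ht⟩ := hsurj z.1 h1
    refine ⟨t, Prod.ext ht ?_⟩
    rw [h2, ← ht]
    exact (hF t).symm

variable {n : ℕ}

/-- The edges of a monotone drawing of a complete graph as graphs of functions, with the vertices
numbered from left to right. -/
structure MonotoneModel (D : Drawing (⊤ : SimpleGraph (Fin n))) where
  vertex : ℕ → Fin n
  edge : ℕ → ℕ → (⊤ : SimpleGraph (Fin n)).edgeSet
  F : ℕ → ℕ → ℝ → ℝ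
  lt : ∀ a b, a < b → b < n → (D.point (vertex a)).1 < (D.point (vertex b)).1
  edge_eq : ∀ a b, a < b → b < n → (edge a b : Sym2 (Fin n)) = s(vertex a, vertex b)
  cont : ∀ a b, a < b → b < n → Continuous (F a b)
  arc_eq : ∀ a b, a < b → b < n → D.arc (edge a b) =
    {z | z.1 ∈ Icc (D.point (vertex a)).1 (D.point (vertex b)).1 ∧ z.2 = F a b z.1}

theorem Drawing.IsMonotone.nonempty_model {D : Drawing (⊤ : SimpleGraph (Fin n))}
    (hD : D.IsMonotone) (hn : 2 ≤ n) : Nonempty (MonotoneModel D) := by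
  let f : Fin n → ℝ := fun i => (D.point i).1
  have hinj : Function.Injective f := fun i j h => hD.1 i j h
  have hmono : StrictMono (f ∘ Tuple.sort f) :=
    (Tuple.monotone_sort f).strictMono_of_injective (hinj.comp (Tuple.sort f).injective)
  let v : ℕ → Fin n := fun a => if h : a < n then Tuple.sort f ⟨a, h⟩ else Tuple.sort f ⟨0, by omega⟩
  have hv : ∀ a (h : a < n), v a = Tuple.sort f ⟨a, h⟩ := fun a h => dif_pos h
  have hlt : ∀ a b, a < b → b < n → (D.point (v a)).1 < (D.point (v b)).1 := fun a b hab hb => by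
    rw [hv a (hab.trans hb), hv b hb]
    exact hmono (show (⟨a, hab.trans hb⟩ : Fin n) < ⟨b, hb⟩ from hab)
  have hne : ∀ a b, a < b → b < n → v a ≠ v b := fun a b hab hb h =>
    (hlt a b hab hb).ne (by rw [h])
  have hedge : ∀ a b, ∃ e : (⊤ : SimpleGraph (Fin n)).edgeSet, a < b → b < n →
      (e : Sym2 (Fin n)) = s(v a, v b) := fun a b => by
    by_cases h : a < b ∧ b < n
    · exact ⟨⟨s(v a, v b), hne a b h.1 h.2⟩, fun _ _ => rfl⟩
    -- A default edge for indices out of range; its existence needs `2 ≤ n`.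
    · exact ⟨⟨s(v 0, v 1), hne 0 1 zero_lt_one (by omega)⟩, fun h1 h2 => absurd ⟨h1, h2⟩ h⟩
  choose E hE using hedge
  have hF : ∀ a b, ∃ F : ℝ → ℝ, a < b → b < n → Continuous F ∧ D.arc (E a b) =
      {z | z.1 ∈ Icc (D.point (v a)).1 (D.point (v b)).1 ∧ z.2 = F z.1} := fun a b => by
    by_cases h : a < b ∧ b < n
    · have h1 : E a b = ⟨s(v a, v b), hne a b h.1 h.2⟩ := Subtype.ext (hE a b h.1 h.2)
      obtain ⟨F, hF⟩ := (D.isSimpleArc (v a) (v b) (hne a b h.1 h.2)).exists_graph (hlt a b h.1 h.2)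
        (hD.2 _)
      exact ⟨F, fun _ _ => by rw [h1]; exact hF⟩
    · exact ⟨fun _ => 0, fun h1 h2 => absurd ⟨h1, h2⟩ h⟩
  choose F hF using hF
  exact ⟨⟨v, E, F, hlt, hE, fun a b h1 h2 => (hF a b h1 h2).1, fun a b h1 h2 => (hF a b h1 h2).2⟩⟩

namespace MonotoneModel

variable {D : Drawing (⊤ : SimpleGraph (Fin n))} (m : MonotoneModel D)

/-- The `x`-coordinate of a vertex. -/
def X (a : ℕ) : ℝ := (D.point (m.vertex a)).1

/-- The `y`-coordinate of a vertex. -/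
def Y (a : ℕ) : ℝ := (D.point (m.vertex a)).2

theorem X_lt {a b : ℕ} (hab : a < b) (hb : b < n) : m.X a < m.X b := m.lt a b hab hb

theorem vertex_ne {a b : ℕ} (hab : a < b) (hb : b < n) : m.vertex a ≠ m.vertex b := fun h =>
  (m.X_lt hab hb).ne (by rw [X, X, h])

theorem vertex_inj {a b : ℕ} (ha : a < n) (hb : b < n) (h : m.vertex a = m.vertex b) : a = b := by
  rcases lt_trichotomy a b with h1 | h1 | h1
  · exact absurd h (m.vertex_ne h1 hb)
  · exact h1
  · exact absurd h.symm (m.vertex_ne h1 ha)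

theorem mem_arc {a b : ℕ} (hab : a < b) (hb : b < n) {z : ℝ × ℝ} :
    z ∈ D.arc (m.edge a b) ↔ z.1 ∈ Icc (m.X a) (m.X b) ∧ z.2 = m.F a b z.1 := by
  rw [m.arc_eq a b hab hb]; rfl

theorem point_mem_arc {a b : ℕ} (hab : a < b) (hb : b < n) :
    D.point (m.vertex a) ∈ D.arc (m.edge a b) ∧ D.point (m.vertex b) ∈ D.arc (m.edge a b) := by
  have h : m.edge a b = ⟨s(m.vertex a, m.vertex b), m.vertex_ne hab hb⟩ :=
    Subtype.ext (m.edge_eq a b hab hb)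
  obtain ⟨γ, -, hγ⟩ := D.isSimpleArc _ _ (show (⊤ : SimpleGraph (Fin n)).Adj (m.vertex a) (m.vertex b)
    from m.vertex_ne hab hb)
  rw [h, ← hγ]
  exact ⟨⟨0, γ.source⟩, ⟨1, γ.target⟩⟩

theorem F_left {a b : ℕ} (hab : a < b) (hb : b < n) : m.F a b (m.X a) = m.Y a :=
  ((m.mem_arc hab hb).1 (m.point_mem_arc hab hb).1).2.symm

theorem F_right {a b : ℕ} (hab : a < b) (hb : b < n) : m.F a b (m.X b) = m.Y b :=
  ((m.mem_arc hab hb).1 (m.point_mem_arc hab hb).2).2.symm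

theorem F_ne {a b c : ℕ} (hac : a < c) (hcb : c < b) (hb : b < n) : m.F a b (m.X c) ≠ m.Y c := by
  intro h
  have h1 : D.point (m.vertex c) ∈ D.arc (m.edge a b) :=
    (m.mem_arc (hac.trans hcb) hb).2 ⟨⟨(m.X_lt hac (hcb.trans hb)).le, (m.X_lt hcb hb).le⟩, h.symm⟩
  have h2 := D.mem_of_point_mem _ _ h1
  rw [m.edge_eq a b (hac.trans hcb) hb, Sym2.mem_iff] at h2
  rcases h2 with h2 | h2
  · exact m.vertex_ne hac (hcb.trans hb) h2.symm
  · exact m.vertex_ne hcb hb h2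

theorem edge_inj {a b c d : ℕ} (hab : a < b) (hb : b < n) (hcd : c < d) (hd : d < n)
    (h : m.edge a b = m.edge c d) : a = c ∧ b = d := by
  have h1 := congrArg Subtype.val h
  rw [m.edge_eq a b hab hb, m.edge_eq c d hcd hd, Sym2.eq_iff] at h1
  rcases h1 with ⟨h1, h2⟩ | ⟨h1, h2⟩
  · exact ⟨m.vertex_inj (hab.trans hb) (hcd.trans hd) h1, m.vertex_inj hb hd h2⟩
  · have e1 := m.vertex_inj (hab.trans hb) hd h1
    have e2 := m.vertex_inj hb (hcd.trans hd) h2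
    omega

theorem mem_edgeInterior {a b : ℕ} (hab : a < b) (hb : b < n) {z : ℝ × ℝ} :
    z ∈ D.edgeInterior (m.edge a b) ↔ z.1 ∈ Ioo (m.X a) (m.X b) ∧ z.2 = m.F a b z.1 := by
  have hP : D.point '' {v | v ∈ (m.edge a b : Sym2 (Fin n))} =
      {(m.X a, m.Y a), (m.X b, m.Y b)} := by
    have : {v | v ∈ (m.edge a b : Sym2 (Fin n))} = {m.vertex a, m.vertex b} := by
      ext v; simp [m.edge_eq a b hab hb]
    rw [this, image_pair]; rfl
  rw [Drawing.edgeInterior, Set.mem_sdiff, m.mem_arc hab hb, hP]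
  simp only [mem_insert_iff, mem_singleton_iff, not_or, mem_Icc, mem_Ioo]
  constructor
  · rintro ⟨⟨⟨h1, h2⟩, h3⟩, h4, h5⟩
    refine ⟨⟨lt_of_le_of_ne h1 fun h => h4 ?_, lt_of_le_of_ne h2 fun h => h5 ?_⟩, h3⟩
    · exact Prod.ext h.symm (by rw [h3, ← h, m.F_left hab hb])
    · exact Prod.ext h (by rw [h3, h, m.F_right hab hb])
  · rintro ⟨⟨h1, h2⟩, h3⟩
    refine ⟨⟨⟨h1.le, h2.le⟩, h3⟩, fun h => ?_, fun h => ?_⟩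
    · rw [h] at h1; exact h1.false
    · rw [h] at h2; exact h2.false

/-- The abscissas of the common interior points of two edges. -/
def zeros (a b c d : ℕ) : Set ℝ :=
  {x | x ∈ Ioo (m.X a) (m.X b) ∧ x ∈ Ioo (m.X c) (m.X d) ∧ m.F a b x = m.F c d x}

/-- By `Drawing.not_touch` every common interior point is a proper crossing, so crossings are just
coincidences of the two functions. -/
theorem crossings_eq {a b c d : ℕ} (hab : a < b) (hb : b < n) (hcd : c < d) (hd : d < n)
    (hne : (a, b) ≠ (c, d)) :
    D.crossings (m.edge a b) (m.edge c d) = (fun x => (x, m.F a b x)) '' m.zeros a b c d := by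
  have hne' : m.edge a b ≠ m.edge c d := fun h => by
    obtain ⟨rfl, rfl⟩ := m.edge_inj hab hb hcd hd h
    exact hne rfl
  ext z
  constructor
  · rintro ⟨⟨h1, h2⟩, -⟩
    rw [m.mem_edgeInterior hab hb] at h1
    rw [m.mem_edgeInterior hcd hd] at h2
    exact ⟨z.1, ⟨h1.1, h2.1, h1.2.symm.trans h2.2⟩, Prod.ext rfl h1.2.symm⟩
  · rintro ⟨x, ⟨h1, h2, h3⟩, rfl⟩
    have h4 : (x, m.F a b x) ∈ D.edgeInterior (m.edge a b) := (m.mem_edgeInterior hab hb).2 ⟨h1, rfl⟩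
    have h5 : (x, m.F a b x) ∈ D.edgeInterior (m.edge c d) := (m.mem_edgeInterior hcd hd).2 ⟨h2, h3⟩
    exact ⟨⟨h4, h5⟩, D.not_touch _ _ hne' _ ⟨h4, h5⟩⟩

theorem ncard_crossings {a b c d : ℕ} (hab : a < b) (hb : b < n) (hcd : c < d) (hd : d < n)
    (hne : (a, b) ≠ (c, d)) :
    (D.crossings (m.edge a b) (m.edge c d)).ncard = (m.zeros a b c d).ncard := by
  rw [m.crossings_eq hab hb hcd hd hne]
  exact ncard_image_of_injective _ fun x y h => congrArg Prod.fst h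

theorem finite_zeros {a b c d : ℕ} (hab : a < b) (hb : b < n) (hcd : c < d) (hd : d < n)
    (hne : (a, b) ≠ (c, d)) :
    {x | x ∈ Icc (m.X a) (m.X b) ∧ x ∈ Icc (m.X c) (m.X d) ∧ m.F a b x = m.F c d x}.Finite := by
  have hne' : m.edge a b ≠ m.edge c d := fun h => by
    obtain ⟨rfl, rfl⟩ := m.edge_inj hab hb hcd hd h
    exact hne rfl
  refine ((D.finite_inter _ _ hne').image Prod.fst).subset ?_
  rintro x ⟨h1, h2, h3⟩
  exact ⟨(x, m.F a b x), ⟨(m.mem_arc hab hb).2 ⟨h1, rfl⟩, (m.mem_arc hcd hd).2 ⟨h2, h3⟩⟩, rfl⟩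

theorem eventually_mem_arc {a b : ℕ} (hab : a < b) (hb : b < n) {z : ℝ × ℝ}
    (hz : z.1 ∈ Ioo (m.X a) (m.X b)) :
    ∀ᶠ q in 𝓝 z, q ∈ D.arc (m.edge a b) ↔ q.2 = m.F a b q.1 := by
  filter_upwards [continuous_fst.continuousAt.eventually (Ioo_mem_nhds hz.1 hz.2)] with q hq
  rw [m.mem_arc hab hb]
  exact ⟨fun h => h.2, fun h => ⟨⟨hq.1.le, hq.2.le⟩, h⟩⟩

theorem not_eventually_lt {a b c d : ℕ} (hab : a < b) (hb : b < n) (hcd : c < d) (hd : d < n)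
    (hne : (a, b) ≠ (c, d)) {x : ℝ} (hx : x ∈ m.zeros a b c d) :
    ¬ ∀ᶠ y in 𝓝[≠] x, m.F c d y < m.F a b y := by
  have h : (x, m.F a b x) ∈ D.crossings (m.edge a b) (m.edge c d) := by
    rw [m.crossings_eq hab hb hcd hd hne]; exact mem_image_of_mem _ hx
  exact h.2.not_eventually_lt (m.cont a b hab hb) (m.eventually_mem_arc hab hb hx.1)
    (m.eventually_mem_arc hcd hd hx.2.1)

/-- Two edges cross oddly if and only if their vertical order at the ends of the interval in which
they cross is different. -/
theorem odd_crossings_iff {a b c d : ℕ} (hab : a < b) (hb : b < n) (hcd : c < d) (hd : d < n)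
    (hne : (a, b) ≠ (c, d)) {l r : ℝ} (hlr : l < r) (hla : m.X a ≤ l) (hlc : m.X c ≤ l)
    (hrb : r ≤ m.X b) (hrd : r ≤ m.X d) (hz : m.zeros a b c d ⊆ Ioo l r)
    (hl : m.F a b l ≠ m.F c d l) (hr : m.F a b r ≠ m.F c d r) :
    Odd (D.crossings (m.edge a b) (m.edge c d)).ncard ↔
      ¬ (m.F a b l < m.F c d l ↔ m.F a b r < m.F c d r) := by
  have hset : m.zeros a b c d = {x | x ∈ Ioo l r ∧ m.F a b x - m.F c d x = 0} := by
    ext x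
    constructor
    · intro hx
      exact ⟨hz hx, sub_eq_zero.2 hx.2.2⟩
    · rintro ⟨⟨h1, h2⟩, h3⟩
      exact ⟨⟨hla.trans_lt h1, h2.trans_le hrb⟩, ⟨hlc.trans_lt h1, h2.trans_le hrd⟩,
        sub_eq_zero.1 h3⟩
  have hfin : (m.zeros a b c d).Finite := (m.finite_zeros hab hb hcd hd hne).subset
    fun x hx => ⟨Ioo_subset_Icc_self hx.1, Ioo_subset_Icc_self hx.2.1, hx.2.2⟩
  rw [m.ncard_crossings hab hb hcd hd hne, hset, odd_ncard_zeros_iff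
    (g := fun x => m.F a b x - m.F c d x) ((m.cont a b hab hb).sub (m.cont c d hcd hd)) hlr (hset ▸ hfin) (sub_ne_zero.2 hl)
    (sub_ne_zero.2 hr)]
  · rcases hl.lt_or_gt with h1 | h1 <;> rcases hr.lt_or_gt with h2 | h2 <;>
      simp [mul_neg_iff, h1, h2, h1.not_gt, h2.not_gt]
  · intro x hx h0
    have : x ∈ m.zeros a b c d := by rw [hset]; exact ⟨hx, h0⟩
    simpa using m.not_eventually_lt hab hb hcd hd hne this
  · intro x hx h0
    have : x ∈ m.zeros c d a b := by
      have : x ∈ m.zeros a b c d := by rw [hset]; exact ⟨hx, h0⟩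
      exact ⟨this.2.1, this.1, this.2.2.symm⟩
    simpa using m.not_eventually_lt hcd hd hab hb hne.symm this

end MonotoneModel

end MonotoneModel

/-! ### The lower bound for weakly semisimple monotone drawings -/

section OddCrossingBound

open Set Filter Topology

namespace MonotoneModel

variable {n : ℕ} {D : Drawing (⊤ : SimpleGraph (Fin n))} (m : MonotoneModel D)

/-- The signature of a monotone drawing. -/
noncomputable def signature (a b c : ℕ) : Bool := decide (m.F a c (m.X b) < m.Y b)

theorem signature_eq_true {a b c : ℕ} : m.signature a b c = true ↔ m.F a c (m.X b) < m.Y b :=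
  decide_eq_true_iff

theorem pair_ne_left {a b c : ℕ} (h : b < c) : ((a, b) : ℕ × ℕ) ≠ (a, c) := by
  simp [h.ne]

theorem pair_ne_right {a b c : ℕ} (h : a < b) : ((a, c) : ℕ × ℕ) ≠ (b, c) := by
  simp [h.ne]

theorem not_odd_of_adjacent (hD : D.IsWeaklySemisimple) {a b c d : ℕ} (hab : a < b) (hb : b < n)
    (hcd : c < d) (hd : d < n) (hne : (a, b) ≠ (c, d)) {v : ℕ} (h1 : v = a ∨ v = b)
    (h2 : v = c ∨ v = d) : ¬ Odd (D.crossings (m.edge a b) (m.edge c d)).ncard := by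
  rw [Nat.not_odd_iff_even]
  refine hD _ _ (fun h => ?_) ⟨m.vertex v, ?_, ?_⟩
  · obtain ⟨rfl, rfl⟩ := m.edge_inj hab hb hcd hd h
    exact hne rfl
  · rw [m.edge_eq a b hab hb, Sym2.mem_iff]
    exact h1.imp (congrArg _) (congrArg _)
  · rw [m.edge_eq c d hcd hd, Sym2.mem_iff]
    exact h2.imp (congrArg _) (congrArg _)

/-- Since `ab` and `ac` cross evenly, their order just to the right of `a` is their order at `b`,
which the signature records. -/
theorem eventually_right_order (hD : D.IsWeaklySemisimple) {a b c : ℕ} (hab : a < b) (hbc : b < c)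
    (hc : c < n) :
    ∀ᶠ x in 𝓝[>] m.X a, (m.F a c x < m.F a b x ↔ m.signature a b c = true) := by
  have hb := hbc.trans hc
  have hac := hab.trans hbc
  have hfin := m.finite_zeros hab hb hac hc (pair_ne_left hbc)
  have hcl := (hfin.subset (sdiff_subset (t := {m.X a}))).isClosed
  obtain ⟨u, hu, hsub⟩ := mem_nhdsGE_iff_exists_Ico_subset.1
    (mem_nhdsWithin_of_mem_nhds (hcl.isOpen_compl.mem_nhds
      (show m.X a ∈ _ from fun h => h.2 rfl)))
  filter_upwards [Ioo_mem_nhdsGT (lt_min hu (m.X_lt hab hb))] with x hx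
  rw [mem_Ioo, lt_min_iff] at hx
  obtain ⟨hx1, hx2, hx3⟩ := hx
  have hfree : ∀ y, m.X a < y → y ≤ x → m.F a b y ≠ m.F a c y := fun y h1 h2 h3 =>
    hsub ⟨h1.le, h2.trans_lt hx2⟩ ⟨⟨⟨h1.le, (h2.trans_lt hx3).le⟩,
      ⟨h1.le, ((h2.trans_lt hx3).trans (m.X_lt hbc hc)).le⟩, h3⟩, h1.ne'⟩
  have hr : m.F a b (m.X b) ≠ m.F a c (m.X b) := by
    rw [m.F_right hab hb]; exact (m.F_ne hab hbc hc).symm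
  have h := m.odd_crossings_iff hab hb hac hc (pair_ne_left hbc) hx3 hx1.le hx1.le le_rfl
    (m.X_lt hbc hc).le
    (fun y hy => ⟨lt_of_not_ge fun h => hfree y hy.1.1 h hy.2.2, hy.1.2⟩) (hfree x hx1 le_rfl) hr
  have h2 := m.not_odd_of_adjacent hD hab hb hac hc (pair_ne_left hbc) (v := a) (.inl rfl)
    (.inl rfl)
  rw [h, not_not, m.F_right hab hb] at h2
  rw [m.F_right hab hb] at hr
  rw [signature_eq_true, ← not_iff_not, not_lt, not_lt, le_iff_lt_or_eq, le_iff_lt_or_eq, h2]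
  simp [hr, hfree x hx1 le_rfl]

theorem eventually_left_order (hD : D.IsWeaklySemisimple) {a b c : ℕ} (hab : a < b) (hbc : b < c)
    (hc : c < n) :
    ∀ᶠ x in 𝓝[<] m.X c, (m.F a c x < m.F b c x ↔ m.signature a b c = true) := by
  have hb := hbc.trans hc
  have hac := hab.trans hbc
  have hfin := m.finite_zeros hac hc hbc hc (pair_ne_right hab)
  have hcl := (hfin.subset (sdiff_subset (t := {m.X c}))).isClosed
  obtain ⟨u, hu, hsub⟩ := mem_nhdsLE_iff_exists_Ioc_subset.1
    (mem_nhdsWithin_of_mem_nhds (hcl.isOpen_compl.mem_nhds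
      (show m.X c ∈ _ from fun h => h.2 rfl)))
  filter_upwards [Ioo_mem_nhdsLT (max_lt hu (m.X_lt hbc hc))] with x hx
  rw [mem_Ioo, max_lt_iff] at hx
  obtain ⟨⟨hx2, hx3⟩, hx1⟩ := hx
  have hfree : ∀ y, y < m.X c → x ≤ y → m.F a c y ≠ m.F b c y := fun y h1 h2 h3 =>
    hsub ⟨hx2.trans_le h2, h1.le⟩ ⟨⟨⟨((m.X_lt hab hb).trans (hx3.trans_le h2)).le, h1.le⟩,
      ⟨(hx3.trans_le h2).le, h1.le⟩, h3⟩, h1.ne⟩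
  have hl : m.F a c (m.X b) ≠ m.F b c (m.X b) := by
    rw [m.F_left hbc hc]; exact m.F_ne hab hbc hc
  have h := m.odd_crossings_iff hac hc hbc hc (pair_ne_right hab) hx3 (m.X_lt hab hb).le le_rfl
    hx1.le hx1.le
    (fun y hy => ⟨hy.2.1.1, lt_of_not_ge fun h => hfree y hy.1.2 h hy.2.2⟩) hl (hfree x hx1 le_rfl)
  have h2 := m.not_odd_of_adjacent hD hac hc hbc hc (pair_ne_right hab) (v := c) (.inr rfl)
    (.inr rfl)
  rw [h, not_not, m.F_left hbc hc] at h2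
  rw [signature_eq_true, h2]

/-- Near a common end all three orders can be read at a single abscissa, where consistency is
transitivity of the order on `ℝ`. -/
theorem consistent_signature (hD : D.IsWeaklySemisimple) : Consistent m.signature n := by
  constructor
  · intro a b c d hab hbc hcd hd
    obtain ⟨x, h1, h2, h3⟩ := ((m.eventually_right_order hD hab hbc (hcd.trans hd)).and
      ((m.eventually_right_order hD hab (hbc.trans hcd) hd).and
        (m.eventually_right_order hD (hab.trans hbc) hcd hd))).exists
    intro h
    rw [← h] at h3
    rw [Bool.eq_iff_iff, ← h1, ← h2]
    rw [← h1] at h3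
    constructor
    · intro h4
      by_contra h5
      exact h5 (h3.1 (lt_of_lt_of_le h4 (not_lt.1 h5)) )
    · intro h4
      exact (h3.2 h4).trans h4
  · intro a b c d hab hbc hcd hd
    obtain ⟨x, h1, h2, h3⟩ := ((m.eventually_left_order hD hab (hbc.trans hcd) hd).and
      ((m.eventually_left_order hD (hab.trans hbc) hcd hd).and
        (m.eventually_left_order hD hbc hcd hd))).exists
    intro h
    rw [← h] at h3
    rw [Bool.eq_iff_iff, ← h1, ← h2]
    rw [← h1] at h3
    constructor
    · intro h4
      by_contra h5
      exact h5 (h3.1 (lt_of_le_of_lt (not_lt.1 h5) h4))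
    · intro h4
      exact h4.trans (h3.2 h4)

/-- Over the interval from `b` to `c`, equal signs mean that `bd` starts on one side of `ac` and
ends on the other. -/
theorem odd_crossings_alternating {a b c d : ℕ} (hab : a < b) (hbc : b < c) (hcd : c < d)
    (hd : d < n) (h : m.signature a b c = m.signature b c d) :
    Odd (D.crossings (m.edge a c) (m.edge b d)).ncard := by
  have hc := hcd.trans hd
  have hb := hbc.trans hc
  have h1 := m.F_ne hab hbc hc
  have h2 := m.F_ne hbc hcd hd
  rw [m.odd_crossings_iff (hab.trans hbc) hc (hbc.trans hcd) hd (by simp [hab.ne]) (m.X_lt hbc hc)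
    (m.X_lt hab hb).le le_rfl le_rfl (m.X_lt hcd hd).le (fun y hy => ⟨hy.2.1.1, hy.1.2⟩)
    (by rw [m.F_left (hbc.trans hcd) hd]; exact h1)
    (by rw [m.F_right (hab.trans hbc) hc]; exact h2.symm),
    m.F_left (hbc.trans hcd) hd, m.F_right (hab.trans hbc) hc, ← signature_eq_true, h,
    signature_eq_true]
  rcases h2.lt_or_gt with h3 | h3 <;> simp [h3, h3.not_gt]

theorem odd_crossings_nested {a b c d : ℕ} (hab : a < b) (hbc : b < c) (hcd : c < d)
    (hd : d < n) (h : m.signature a b d ≠ m.signature a c d) :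
    Odd (D.crossings (m.edge a d) (m.edge b c)).ncard := by
  have hc := hcd.trans hd
  have hb := hbc.trans hc
  rw [m.odd_crossings_iff ((hab.trans hbc).trans hcd) hd hbc hc (by simp [hab.ne]) (m.X_lt hbc hc)
    (m.X_lt hab hb).le le_rfl (m.X_lt hcd hd).le le_rfl (fun y hy => hy.2.1)
    (by rw [m.F_left hbc hc]; exact m.F_ne hab (hbc.trans hcd) hd)
    (by rw [m.F_right hbc hc]; exact m.F_ne (hab.trans hbc) hcd hd),
    m.F_left hbc hc, m.F_right hbc hc, ← signature_eq_true, ← signature_eq_true, ← Bool.eq_iff_iff]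
  exact h

/-- Each crossing quadruple is sent to one oddly crossing pair of edges. The four ends of the pair
determine the quadruple, so this is injective. -/
theorem crossCount_le_ocr : (crossCount m.signature n : ℕ∞) ≤ D.ocr := by
  rw [crossCount, ← Set.encard_coe_eq_coe_finsetCard, Drawing.ocr]
  have hne : ∀ {a b c d : ℕ}, a < b → b < n → c < d → d < n → (a ≠ c ∨ b ≠ d) →
      m.edge a b ≠ m.edge c d := fun h1 h2 h3 h4 h5 h => by
    obtain ⟨rfl, rfl⟩ := m.edge_inj h1 h2 h3 h4 h
    simp at h5
  refine Set.encard_le_encard_of_injOn (f := fun q =>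
    if m.signature q.1 q.2.1 q.2.2.1 = m.signature q.2.1 q.2.2.1 q.2.2.2 then
      s(m.edge q.1 q.2.2.1, m.edge q.2.1 q.2.2.2)
    else s(m.edge q.1 q.2.2.2, m.edge q.2.1 q.2.2.1)) ?_ ?_
  · rintro ⟨a, b, c, d⟩ hq
    rw [Finset.mem_coe, Finset.mem_filter, mem_quads] at hq
    obtain ⟨⟨hab, hbc, hcd, hd⟩, hq⟩ := hq
    dsimp only
    split_ifs with h
    · exact ⟨_, _, rfl, hne (by omega) (by omega) (by omega) (by omega) (by omega),
        m.odd_crossings_alternating hab hbc hcd hd h⟩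
    · exact ⟨_, _, rfl, hne (by omega) (by omega) (by omega) (by omega) (by omega),
        m.odd_crossings_nested hab hbc hcd hd (hq.resolve_left h)⟩
  · rintro ⟨a, b, c, d⟩ hq ⟨a', b', c', d'⟩ hq' heq
    rw [Finset.mem_coe, Finset.mem_filter, mem_quads] at hq hq'
    obtain ⟨⟨hab, hbc, hcd, hd⟩, -⟩ := hq
    obtain ⟨⟨hab', hbc', hcd', hd'⟩, -⟩ := hq'
    have key : ∀ {i j k l i' j' k' l' : ℕ}, i < j → j < n → k < l → l < n → i' < j' → j' < n →
        k' < l' → l' < n → s(m.edge i j, m.edge k l) = s(m.edge i' j', m.edge k' l') →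
        (i = i' ∧ j = j') ∧ (k = k' ∧ l = l') ∨ (i = k' ∧ j = l') ∧ (k = i' ∧ l = j') := by
      intro i j k l i' j' k' l' h1 h2 h3 h4 h5 h6 h7 h8 h
      rw [Sym2.eq_iff] at h
      exact h.imp (fun h => ⟨m.edge_inj h1 h2 h5 h6 h.1, m.edge_inj h3 h4 h7 h8 h.2⟩)
        (fun h => ⟨m.edge_inj h1 h2 h7 h8 h.1, m.edge_inj h3 h4 h5 h6 h.2⟩)
    dsimp only at heq
    simp only [Prod.mk.injEq]
    split_ifs at heq <;>
    · have := key (by omega) (by omega) (by omega) (by omega) (by omega) (by omega) (by omega)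
        (by omega) heq
      omega

end MonotoneModel

theorem hillZ_eq_zero_of_lt {n : ℕ} (h : n < 4) : hillZ n = 0 := by
  interval_cases n <;> rfl

theorem hillZ_le_ocr {n : ℕ} (D : Drawing (⊤ : SimpleGraph (Fin n))) (hm : D.IsMonotone)
    (hD : D.IsWeaklySemisimple) : (hillZ n : ℕ∞) ≤ D.ocr := by
  rcases lt_or_ge n 4 with hn | hn
  · simp [hillZ_eq_zero_of_lt hn]
  obtain ⟨m⟩ := hm.nonempty_model (by omega)
  exact (Nat.cast_le.2 (m.consistent_signature hD).hillZ_le).trans m.crossCount_le_ocr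

end OddCrossingBound

/-! ### Systems of heights, inversions and exchanges -/

section HeightSystem

open Finset

/-- The edges of the complete graph on the vertices below `n`. -/
def edgesBelow (n : ℕ) : Finset (ℕ × ℕ) := {p ∈ range n ×ˢ range n | p.1 < p.2}

theorem mem_edgesBelow {n : ℕ} {p : ℕ × ℕ} : p ∈ edgesBelow n ↔ p.1 < p.2 ∧ p.2 < n := by
  simp only [edgesBelow, mem_filter, mem_product, mem_range]; omega

/-- The heights of the edges of a monotone drawing above the vertices: `h p t` is the height of the
edge `p` at the abscissa of the vertex `t`. -/
structure HeightSystem (n : ℕ) (Y : ℕ → ℝ) (h : ℕ × ℕ → ℕ → ℝ) : Prop where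
  endpoint : ∀ p ∈ edgesBelow n, ∀ t, t = p.1 ∨ t = p.2 → h p t = Y t
  separated : ∀ p ∈ edgesBelow n, ∀ q ∈ edgesBelow n, p ≠ q → ∀ t, (p.1 ≤ t ∧ t ≤ p.2) →
    (q.1 ≤ t ∧ t ≤ q.2) → h p t = h q t → (t = p.1 ∨ t = p.2) ∧ (t = q.1 ∨ t = q.2)

/-- Two elements are in opposite orders under `u` and `v`. -/
def Inverted {α : Type*} (A : α → Prop) (u v : α → ℝ) (p q : α) : Prop :=
  A p ∧ A q ∧ (u p - u q) * (v p - v q) < 0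

open Classical in
/-- The number of ordered inverted pairs. -/
noncomputable def invCount {α : Type*} (E : Finset α) (A : α → Prop) (u v : α → ℝ) : ℕ :=
  ∑ p ∈ E, ∑ q ∈ E, if Inverted A u v p q then 1 else 0

theorem invCount_comm {α : Type*} (E : Finset α) (A : α → Prop) (u v : α → ℝ) :
    invCount E A u v = invCount E A v u := by
  have h : Inverted A u v = Inverted A v u := by
    funext p q
    simp only [Inverted, mul_comm (u p - u q)]
  rw [invCount, h, invCount]

/-- When two inverted elements trade their first values, the number of inversions with any third
element does not increase. -/
theorem swap_inversions_le {a b c x y z : ℝ} (h : (a - b) * (x - y) < 0) :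
    (if (b - c) * (x - z) < 0 then 1 else 0) + (if (a - c) * (y - z) < 0 then 1 else 0) ≤
    (if (a - c) * (x - z) < 0 then 1 else 0) + (if (b - c) * (y - z) < 0 then 1 else (0 : ℕ)) := by
  simp only [mul_neg_iff, sub_pos, sub_neg] at h ⊢
  split_ifs <;> first | omega | grind

section
variable {α : Type*} [DecidableEq α] {E : Finset α} {A : α → Prop} {e f : α}

theorem swap_mem (he : e ∈ E) (hf : f ∈ E) {p : α} (hp : p ∈ E) : Equiv.swap e f p ∈ E := by
  by_cases h1 : p = e
  · rw [h1, Equiv.swap_apply_left]; exact hf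
  by_cases h2 : p = f
  · rw [h2, Equiv.swap_apply_right]; exact he
  rwa [Equiv.swap_apply_of_ne_of_ne h1 h2]

theorem swap_pred_iff (h : A e ↔ A f) (p : α) : A (Equiv.swap e f p) ↔ A p := by
  by_cases h1 : p = e
  · rw [h1, Equiv.swap_apply_left, h]
  by_cases h2 : p = f
  · rw [h2, Equiv.swap_apply_right, h]
  rw [Equiv.swap_apply_of_ne_of_ne h1 h2]

theorem sum_swap (he : e ∈ E) (hf : f ∈ E) (g : α → ℕ) :
    ∑ p ∈ E, g (Equiv.swap e f p) = ∑ p ∈ E, g p :=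
  sum_nbij' (Equiv.swap e f) (Equiv.swap e f) (fun _ => swap_mem he hf) (fun _ => swap_mem he hf)
    (fun _ _ => Equiv.swap_apply_self _ _ _) (fun _ _ => Equiv.swap_apply_self _ _ _)
    (fun _ _ => rfl)

theorem sum_sum_swap (he : e ∈ E) (hf : f ∈ E) (g : α → α → ℕ) :
    ∑ p ∈ E, ∑ q ∈ E, g (Equiv.swap e f p) (Equiv.swap e f q) = ∑ p ∈ E, ∑ q ∈ E, g p q := by
  rw [← sum_swap he hf fun p => ∑ q ∈ E, g p q]
  exact sum_congr rfl fun p _ => sum_swap he hf _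

theorem invCount_swap_swap (he : e ∈ E) (hf : f ∈ E) (hA : A e ↔ A f) (u v : α → ℝ) :
    invCount E A (fun p => u (Equiv.swap e f p)) (fun p => v (Equiv.swap e f p)) =
      invCount E A u v := by
  classical
  unfold invCount
  rw [← sum_sum_swap he hf]
  refine sum_congr rfl fun p _ => sum_congr rfl fun q _ => ?_
  have : Inverted A (fun p => u (Equiv.swap e f p)) (fun p => v (Equiv.swap e f p))
      (Equiv.swap e f p) (Equiv.swap e f q) ↔ Inverted A u v p q := by
    simp only [Inverted, swap_pred_iff hA, Equiv.swap_apply_self]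
  simp only [this]

/-- Undoing an inversion decreases the number of inversions. -/
theorem invCount_swap_lt (he : e ∈ E) (hf : f ∈ E) {u v : α → ℝ} (h : Inverted A u v e f) :
    invCount E A (fun p => u (Equiv.swap e f p)) v < invCount E A u v := by
  classical
  obtain ⟨hAe, hAf, hlt⟩ := h
  have hA : ∀ p, A (Equiv.swap e f p) ↔ A p := swap_pred_iff (by simp [hAe, hAf])
  -- Each pair is counted together with its image under the swap, which doubles both sums. The
  -- grouped terms compare one by one, strictly at `(e, f)`.
  suffices h2 : ∑ p ∈ E, ∑ q ∈ E,
      ((if Inverted A (fun p => u (Equiv.swap e f p)) v p q then 1 else 0) +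
        (if Inverted A (fun p => u (Equiv.swap e f p)) v (Equiv.swap e f p) (Equiv.swap e f q)
          then 1 else 0)) <
      ∑ p ∈ E, ∑ q ∈ E, ((if Inverted A u v p q then 1 else 0) +
        (if Inverted A u v (Equiv.swap e f p) (Equiv.swap e f q) then 1 else 0)) by
    simp only [sum_add_distrib] at h2
    rw [sum_sum_swap he hf fun p q => if Inverted A u v p q then 1 else 0,
      sum_sum_swap he hf fun p q =>
        if Inverted A (fun p => u (Equiv.swap e f p)) v p q then 1 else 0] at h2
    unfold invCount
    omega
  have hle : ∀ p q, ((if Inverted A (fun p => u (Equiv.swap e f p)) v p q then 1 else 0) +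
        (if Inverted A (fun p => u (Equiv.swap e f p)) v (Equiv.swap e f p) (Equiv.swap e f q)
          then 1 else 0)) ≤ ((if Inverted A u v p q then 1 else 0) +
        (if Inverted A u v (Equiv.swap e f p) (Equiv.swap e f q) then 1 else 0)) := by
    intro p q
    simp only [Inverted, hA, Equiv.swap_apply_self]
    by_cases hp : A p
    swap
    · simp [hp]
    by_cases hq : A q
    swap
    · simp [hq]
    simp only [hp, hq, true_and]
    have hlt' : (u f - u e) * (v f - v e) < 0 := by linarith
    by_cases h1 : p = e
    · subst h1
      rw [Equiv.swap_apply_left]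
      by_cases h3 : q = p
      · subst h3; simp
      by_cases h4 : q = f
      · subst h4
        rw [Equiv.swap_apply_right, if_neg (by linarith), if_neg (by linarith)]
        omega
      · rw [Equiv.swap_apply_of_ne_of_ne h3 h4]
        exact swap_inversions_le hlt
    by_cases h2 : p = f
    · subst h2
      rw [Equiv.swap_apply_right]
      by_cases h3 : q = p
      · subst h3; simp
      by_cases h4 : q = e
      · subst h4
        rw [Equiv.swap_apply_left, if_neg (by linarith), if_neg (by linarith)]
        omega
      · rw [Equiv.swap_apply_of_ne_of_ne h4 h3]
        exact swap_inversions_le hlt'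
    rw [Equiv.swap_apply_of_ne_of_ne h1 h2]
    by_cases h3 : q = e
    · subst h3
      rw [Equiv.swap_apply_left]
      have := swap_inversions_le (c := u p) (z := v p) hlt
      convert this using 3 <;> constructor <;> intro h <;> linarith
    by_cases h4 : q = f
    · subst h4
      rw [Equiv.swap_apply_right]
      have := swap_inversions_le (c := u p) (z := v p) hlt'
      convert this using 3 <;> constructor <;> intro h <;> linarith
    rw [Equiv.swap_apply_of_ne_of_ne h3 h4]
  refine sum_lt_sum (fun p _ => sum_le_sum fun q _ => hle p q) ⟨e, he, ?_⟩
  refine sum_lt_sum (fun q _ => hle e q) ⟨f, hf, ?_⟩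
  simp only [Inverted, hAe, hAf, Equiv.swap_apply_left, Equiv.swap_apply_right, true_and]
  rw [if_neg (by linarith), if_neg (by linarith), if_pos hlt]
  omega

end

/-- The edge `p` extends over the gap between the vertices `t` and `t + 1`. -/
def Spans (t : ℕ) (p : ℕ × ℕ) : Prop := p.1 ≤ t ∧ t + 1 ≤ p.2

/-- The number of ordered inversions in the gaps between consecutive vertices. -/
noncomputable def totalInversions (n : ℕ) (h : ℕ × ℕ → ℕ → ℝ) : ℕ :=
  ∑ t ∈ range n, invCount (edgesBelow n) (Spans t) (fun p => h p t) (fun p => h p (t + 1))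

open Classical in
/-- Interchange of two edges on a set of times. -/
noncomputable def exchange (h : ℕ × ℕ → ℕ → ℝ) (C : ℕ → Prop) (p q r : ℕ × ℕ) (t : ℕ) : ℝ :=
  if C t then h (Equiv.swap p q r) t else h r t

section
variable {n : ℕ} {Y : ℕ → ℝ} {h : ℕ × ℕ → ℕ → ℝ} {C : ℕ → Prop} {p q : ℕ × ℕ}

/-- At each time in `C` the two edges are both present or both absent, and both or neither end
there, so the exchange merely permutes edges in the same situation. -/
theorem HeightSystem.exchange (H : HeightSystem n Y h) (hp : p ∈ edgesBelow n)
    (hq : q ∈ edgesBelow n)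
    (hr : ∀ s, C s → ((p.1 ≤ s ∧ s ≤ p.2) ↔ (q.1 ≤ s ∧ s ≤ q.2)))
    (he : ∀ s, C s → ((s = p.1 ∨ s = p.2) ↔ (s = q.1 ∨ s = q.2))) :
    HeightSystem n Y (exchange h C p q) := by
  have hr' : ∀ s, C s → ∀ r, ((Equiv.swap p q r).1 ≤ s ∧ s ≤ (Equiv.swap p q r).2) ↔
      (r.1 ≤ s ∧ s ≤ r.2) := fun s hs r =>
    swap_pred_iff (A := fun r : ℕ × ℕ => r.1 ≤ s ∧ s ≤ r.2) (hr s hs) r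
  have he' : ∀ s, C s → ∀ r, (s = (Equiv.swap p q r).1 ∨ s = (Equiv.swap p q r).2) ↔
      (s = r.1 ∨ s = r.2) := fun s hs r =>
    swap_pred_iff (A := fun r : ℕ × ℕ => s = r.1 ∨ s = r.2) (he s hs) r
  constructor
  · intro r hrE t ht
    unfold _root_.exchange
    split_ifs with hC
    · exact H.endpoint _ (swap_mem hp hq hrE) t ((he' t hC r).2 ht)
    · exact H.endpoint _ hrE t ht
  · intro r hrE r' hrE' hne t h1 h2 h3
    unfold _root_.exchange at h3
    split_ifs at h3 with hC
    · have := H.separated _ (swap_mem hp hq hrE) _ (swap_mem hp hq hrE')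
        ((Equiv.swap p q).injective.ne hne) t ((hr' t hC r).2 h1) ((hr' t hC r').2 h2) h3
      exact ⟨(he' t hC r).1 this.1, (he' t hC r').1 this.2⟩
    · exact H.separated _ hrE _ hrE' hne t h1 h2 h3

/-- The set `C` changes only across the gap `t`. There one end of the gap is exchanged, which undoes
an inversion; in every other gap both ends are exchanged or neither is, and the count is unchanged.
-/
theorem totalInversions_exchange_lt (hp : p ∈ edgesBelow n) (hq : q ∈ edgesBelow n) {t : ℕ}
    (ht : t < n) (hinv : Inverted (Spans t) (fun r => h r t) (fun r => h r (t + 1)) p q)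
    (hstep : ∀ s, s ≠ t → (C s ↔ C (s + 1))) (hflip : ¬ (C t ↔ C (t + 1)))
    (hact : ∀ s, s ≠ t → C s → (Spans s p ↔ Spans s q)) :
    totalInversions n (exchange h C p q) < totalInversions n h := by
  unfold totalInversions
  have hlt : invCount (edgesBelow n) (Spans t) (fun r => exchange h C p q r t)
      (fun r => exchange h C p q r (t + 1)) <
      invCount (edgesBelow n) (Spans t) (fun r => h r t) (fun r => h r (t + 1)) := by
    by_cases hC : C t
    · have hC' : ¬ C (t + 1) := fun h' => hflip (by simp [hC, h'])
      simp only [exchange, hC, hC', if_true, if_false]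
      exact invCount_swap_lt hp hq (u := fun r => h r t) (v := fun r => h r (t + 1)) hinv
    · have hC' : C (t + 1) := by by_contra h'; exact hflip (by simp [hC, h'])
      simp only [exchange, hC, hC', if_true, if_false]
      rw [invCount_comm, invCount_comm (u := fun r => h r t)]
      refine invCount_swap_lt hp hq (v := fun r => h r t) (u := fun r => h r (t + 1)) ?_
      obtain ⟨h1, h2, h3⟩ := hinv
      exact ⟨h1, h2, by rw [mul_comm]; exact h3⟩
  refine sum_lt_sum (fun s _ => ?_) ⟨t, mem_range.2 ht, hlt⟩
  by_cases hst : s = t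
  · subst hst; exact hlt.le
  by_cases hC : C s
  · have hC' := (hstep s hst).1 hC
    simp only [exchange, hC, hC', if_true]
    exact (invCount_swap_swap hp hq (hact s hst hC) (fun r => h r s) fun r => h r (s + 1)).le
  · have hC' := (hstep s hst).not.1 hC
    simp only [exchange, hC, hC', if_false]
    exact le_rfl

/-- A change of order of two edges occurs in some gap. -/
theorem exists_inverted {t t' : ℕ} (htt : t ≤ t') (hp1 : p.1 ≤ t) (hp2 : t' ≤ p.2) (hq1 : q.1 ≤ t)
    (hq2 : t' ≤ q.2) (hne : ∀ s, t ≤ s → s ≤ t' → h p s ≠ h q s)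
    (hord : ¬ (h p t < h q t ↔ h p t' < h q t')) :
    ∃ s, t ≤ s ∧ s < t' ∧ Inverted (Spans s) (fun r => h r s) (fun r => h r (s + 1)) p q := by
  induction t', htt using Nat.le_induction with
  | base => exact absurd Iff.rfl hord
  | succ k hk ih =>
    by_cases hk' : h p t < h q t ↔ h p k < h q k
    · refine ⟨k, hk, Nat.lt_succ_self k, ⟨by omega, hp2⟩, ⟨by omega, hq2⟩, ?_⟩
      have h1 := hne k hk (Nat.le_succ k)
      have h2 := hne (k + 1) (by omega) le_rfl
      rw [hk'] at hord
      simp only [mul_neg_iff, sub_pos, sub_neg]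
      rcases h1.lt_or_gt with h3 | h3 <;> rcases h2.lt_or_gt with h4 | h4 <;>
        simp [h3, h4, h3.not_gt, h4.not_gt] at hord ⊢
    · obtain ⟨s, h1, h2, h3⟩ := ih (by omega) (by omega) (fun s h1 h2 => hne s h1 (by omega)) hk'
      exact ⟨s, h1, by omega, h3⟩

open Classical in
/-- The inversions, with the pair of edges ordered lexicographically. -/
noncomputable def inversions (n : ℕ) (h : ℕ × ℕ → ℕ → ℝ) : Finset (ℕ × (ℕ × ℕ) × (ℕ × ℕ)) :=
  {w ∈ range n ×ˢ edgesBelow n ×ˢ edgesBelow n |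
    Inverted (Spans w.1) (fun r => h r w.1) (fun r => h r (w.1 + 1)) w.2.1 w.2.2 ∧
    (w.2.1.1 < w.2.2.1 ∨ w.2.1.1 = w.2.2.1 ∧ w.2.1.2 < w.2.2.2)}

theorem totalInversions_eq : totalInversions n h = 2 * #(inversions n h) := by
  classical
  have h1 : totalInversions n h = #{w ∈ range n ×ˢ edgesBelow n ×ˢ edgesBelow n |
      Inverted (Spans w.1) (fun r => h r w.1) (fun r => h r (w.1 + 1)) w.2.1 w.2.2} := by
    rw [card_filter, sum_product]
    unfold totalInversions invCount
    refine sum_congr rfl fun t _ => ?_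
    rw [sum_product]
  rw [h1, ← card_filter_add_card_filter_not (p := fun w : ℕ × (ℕ × ℕ) × (ℕ × ℕ) =>
    w.2.1.1 < w.2.2.1 ∨ w.2.1.1 = w.2.2.1 ∧ w.2.1.2 < w.2.2.2), filter_filter, two_mul]
  congr 1
  unfold inversions
  refine card_nbij' (fun w => (w.1, w.2.2, w.2.1)) (fun w => (w.1, w.2.2, w.2.1)) ?_ ?_ ?_ ?_
  · rintro ⟨t, p, q⟩ hw
    simp only [coe_filter, mem_filter, mem_product, Set.mem_ofPred_eq] at hw ⊢
    obtain ⟨⟨⟨h1, h2, h3⟩, h4, h5, h6⟩, h7⟩ := hw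
    refine ⟨⟨h1, h3, h2⟩, ⟨h5, h4, by linarith⟩, ?_⟩
    have hpq : p ≠ q := by rintro rfl; simp at h6
    have : p.1 ≠ q.1 ∨ p.2 ≠ q.2 := by
      by_contra! hcon; exact hpq (Prod.ext hcon.1 hcon.2)
    omega
  · rintro ⟨t, p, q⟩ hw
    simp only [coe_filter, mem_filter, mem_product, Set.mem_ofPred_eq] at hw ⊢
    obtain ⟨⟨h1, h2, h3⟩, ⟨h4, h5, h6⟩, h7⟩ := hw
    exact ⟨⟨⟨h1, h3, h2⟩, h5, h4, by linarith⟩, by omega⟩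
  · intro w _; rfl
  · intro w _; rfl

end

end HeightSystem

/-! ### At least `hillZ n` inversions in every system of heights -/

section Inversions

open Finset

/-- The signature of a system of heights. -/
noncomputable def heightSignature (Y : ℕ → ℝ) (h : ℕ × ℕ → ℕ → ℝ) (a b c : ℕ) : Bool :=
  decide (h (a, c) b < Y b)

theorem heightSignature_eq_true {Y : ℕ → ℝ} {h : ℕ × ℕ → ℕ → ℝ} {a b c : ℕ} :
    heightSignature Y h a b c = true ↔ h (a, c) b < Y b := decide_eq_true_iff

/-- No two adjacent edges are inverted. -/
def AdjacentFree (n : ℕ) (h : ℕ × ℕ → ℕ → ℝ) : Prop :=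
  ∀ p ∈ edgesBelow n, ∀ q ∈ edgesBelow n, p.1 = q.1 ∨ p.2 = q.2 → ∀ t,
    ¬ Inverted (Spans t) (fun r => h r t) (fun r => h r (t + 1)) p q

namespace HeightSystem
variable {n : ℕ} {Y : ℕ → ℝ} {h : ℕ × ℕ → ℕ → ℝ}

/-- Without adjacent inversions, `ab` and `ac` keep their order from the first vertex after `a` up
to `b`, where it is the signature. -/
theorem right_order (H : HeightSystem n Y h) (hfree : AdjacentFree n h) {a b c : ℕ} (hab : a < b)
    (hbc : b < c) (hc : c < n) :
    h (a, c) (a + 1) < h (a, b) (a + 1) ↔ heightSignature Y h a b c = true := by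
  have h1 : (a, b) ∈ edgesBelow n := mem_edgesBelow.2 ⟨hab, hbc.trans hc⟩
  have h2 : (a, c) ∈ edgesBelow n := mem_edgesBelow.2 ⟨hab.trans hbc, hc⟩
  rw [heightSignature_eq_true, ← H.endpoint _ h1 b (.inr rfl)]
  by_contra hcon
  obtain ⟨s, -, -, hs⟩ := exists_inverted (p := (a, c)) (q := (a, b)) (t := a + 1) (t' := b)
    (by omega) (by simp) (by simp; omega) (by simp) (by simp) (fun s hs1 hs2 heq => by
      have := (H.separated _ h2 _ h1 (by simp [hbc.ne']) s ⟨by simp; omega, by simp; omega⟩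
        ⟨by simp; omega, by simp; omega⟩ heq).1
      simp only at this
      omega) hcon
  exact hfree _ h2 _ h1 (.inl rfl) s hs

theorem left_order (H : HeightSystem n Y h) (hfree : AdjacentFree n h) {a b c : ℕ} (hab : a < b)
    (hbc : b < c) (hc : c < n) :
    h (a, c) (c - 1) < h (b, c) (c - 1) ↔ heightSignature Y h a b c = true := by
  have h1 : (b, c) ∈ edgesBelow n := mem_edgesBelow.2 ⟨hbc, hc⟩
  have h2 : (a, c) ∈ edgesBelow n := mem_edgesBelow.2 ⟨hab.trans hbc, hc⟩
  rw [heightSignature_eq_true, ← H.endpoint _ h1 b (.inl rfl), iff_comm]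
  by_contra hcon
  obtain ⟨s, -, -, hs⟩ := exists_inverted (p := (a, c)) (q := (b, c)) (t := b) (t' := c - 1)
    (by omega) (by simp; omega) (by simp) (by simp) (by simp) (fun s hs1 hs2 heq => by
      have := (H.separated _ h2 _ h1 (by simp [hab.ne]) s ⟨by simp; omega, by simp; omega⟩
        ⟨by simp; omega, by simp; omega⟩ heq).1
      simp only at this
      omega) hcon
  exact hfree _ h2 _ h1 (.inr rfl) s hs

theorem consistent (H : HeightSystem n Y h) (hfree : AdjacentFree n h) :
    Consistent (heightSignature Y h) n := by
  constructor
  · intro a b c d hab hbc hcd hd heq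
    have h1 := H.right_order hfree hab hbc (hcd.trans hd)
    have h2 := H.right_order hfree hab (hbc.trans hcd) hd
    have h3 := H.right_order hfree (hab.trans hbc) hcd hd
    rw [← heq, ← h1] at h3
    rw [Bool.eq_iff_iff, ← h1, ← h2]
    constructor
    · intro h4
      by_contra h5
      exact h5 (h3.1 (lt_of_lt_of_le h4 (not_lt.1 h5)))
    · intro h4
      exact (h3.2 h4).trans h4
  · intro a b c d hab hbc hcd hd heq
    have h1 := H.left_order hfree hab (hbc.trans hcd) hd
    have h2 := H.left_order hfree (hab.trans hbc) hcd hd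
    have h3 := H.left_order hfree hbc hcd hd
    rw [← heq, ← h1] at h3
    rw [Bool.eq_iff_iff, ← h1, ← h2]
    constructor
    · intro h4
      by_contra h5
      exact h5 (h3.1 (lt_of_le_of_lt (not_lt.1 h5) h4))
    · intro h4
      exact h4.trans (h3.2 h4)

theorem exists_inverted_alternating (H : HeightSystem n Y h) {a b c d : ℕ} (hab : a < b)
    (hbc : b < c) (hcd : c < d) (hd : d < n)
    (heq : heightSignature Y h a b c = heightSignature Y h b c d) :
    ∃ t, t < n ∧
      Inverted (Spans t) (fun r => h r t) (fun r => h r (t + 1)) (a, c) (b, d) := by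
  have h1 : (a, c) ∈ edgesBelow n := mem_edgesBelow.2 ⟨hab.trans hbc, hcd.trans hd⟩
  have h2 : (b, d) ∈ edgesBelow n := mem_edgesBelow.2 ⟨hbc.trans hcd, hd⟩
  have hne : ∀ s, b ≤ s → s ≤ c → h (a, c) s ≠ h (b, d) s := fun s hs1 hs2 heq => by
    have := H.separated _ h1 _ h2 (by simp [hab.ne]) s ⟨by simp; omega, by simp; omega⟩
        ⟨by simp; omega, by simp; omega⟩ heq
    simp only at this
    omega
  have e1 := H.endpoint _ h1 c (.inr rfl)
  have e2 := H.endpoint _ h2 b (.inl rfl)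
  obtain ⟨t, -, ht, hinv⟩ := exists_inverted (p := (a, c)) (q := (b, d)) (t := b) (t' := c) hbc.le
    (by simp; omega) (by simp) (by simp) (by simp; omega) hne (by
      rw [e1, e2, ← heightSignature_eq_true, heq, heightSignature_eq_true]
      have := hne c hbc.le le_rfl
      rw [e1] at this
      rcases this.lt_or_gt with h3 | h3 <;> simp [h3, h3.not_gt])
  exact ⟨t, by omega, hinv⟩

theorem exists_inverted_nested (H : HeightSystem n Y h) {a b c d : ℕ} (hab : a < b)
    (hbc : b < c) (hcd : c < d) (hd : d < n)
    (hneq : heightSignature Y h a b d ≠ heightSignature Y h a c d) :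
    ∃ t, t < n ∧
      Inverted (Spans t) (fun r => h r t) (fun r => h r (t + 1)) (a, d) (b, c) := by
  have h1 : (a, d) ∈ edgesBelow n := mem_edgesBelow.2 ⟨(hab.trans hbc).trans hcd, hd⟩
  have h2 : (b, c) ∈ edgesBelow n := mem_edgesBelow.2 ⟨hbc, hcd.trans hd⟩
  have hne : ∀ s, b ≤ s → s ≤ c → h (a, d) s ≠ h (b, c) s := fun s hs1 hs2 heq => by
    have := H.separated _ h1 _ h2 (by simp [hab.ne]) s ⟨by simp; omega, by simp; omega⟩
        ⟨by simp; omega, by simp; omega⟩ heq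
    simp only at this
    omega
  have e1 := H.endpoint _ h2 c (.inr rfl)
  have e2 := H.endpoint _ h2 b (.inl rfl)
  obtain ⟨t, -, ht, hinv⟩ := exists_inverted (p := (a, d)) (q := (b, c)) (t := b) (t' := c) hbc.le
    (by simp; omega) (by simp; omega) (by simp) (by simp) hne (by
      rw [e1, e2, ← heightSignature_eq_true, ← heightSignature_eq_true, ← Bool.eq_iff_iff]
      exact hneq)
  exact ⟨t, by omega, hinv⟩

/-- A crossing quadruple makes two disjoint edges change their order, hence invert in some gap. This
needs no condition on adjacent edges, and the edges determine the quadruple. -/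
theorem crossCount_le (H : HeightSystem n Y h) :
    crossCount (heightSignature Y h) n ≤ #(inversions n h) := by
  have hw : ∀ q : ℕ × ℕ × ℕ × ℕ, ∃ t, q ∈ {q ∈ quads n | IsCrossing (heightSignature Y h) q} →
      (t, if heightSignature Y h q.1 q.2.1 q.2.2.1 = heightSignature Y h q.2.1 q.2.2.1 q.2.2.2 then
        ((q.1, q.2.2.1), (q.2.1, q.2.2.2)) else ((q.1, q.2.2.2), (q.2.1, q.2.2.1))) ∈
        inversions n h := by
    rintro ⟨a, b, c, d⟩
    by_cases hq : (a, b, c, d) ∈ {q ∈ quads n | IsCrossing (heightSignature Y h) q}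
    swap
    · exact ⟨0, fun hq' => absurd hq' hq⟩
    rw [mem_filter, mem_quads] at hq
    obtain ⟨⟨hab, hbc, hcd, hd⟩, hq⟩ := hq
    dsimp only
    split_ifs with heq
    · obtain ⟨t, ht, hinv⟩ := H.exists_inverted_alternating hab hbc hcd hd heq
      refine ⟨t, fun _ => ?_⟩
      simp only [inversions, mem_filter, mem_product, mem_range, mem_edgesBelow]
      exact ⟨⟨ht, by omega, by omega⟩, hinv, by omega⟩
    · obtain ⟨t, ht, hinv⟩ := H.exists_inverted_nested hab hbc hcd hd (hq.resolve_left heq)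
      refine ⟨t, fun _ => ?_⟩
      simp only [inversions, mem_filter, mem_product, mem_range, mem_edgesBelow]
      exact ⟨⟨ht, by omega, by omega⟩, hinv, by omega⟩
  choose T hT using hw
  refine card_le_card_of_injOn _ (fun q hq => hT q hq) ?_
  rintro ⟨a, b, c, d⟩ hq ⟨a', b', c', d'⟩ hq' heq
  rw [mem_coe, mem_filter, mem_quads] at hq hq'
  obtain ⟨⟨hab, hbc, hcd, hd⟩, -⟩ := hq
  obtain ⟨⟨hab', hbc', hcd', hd'⟩, -⟩ := hq'
  have := congrArg Prod.snd heq
  dsimp only at this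
  simp only [Prod.mk.injEq]
  split_ifs at this <;> simp only [Prod.mk.injEq] at this <;> omega

/-- Descent on the number of inversions: a system without adjacent inversions has a consistent
signature, and from any other an exchange yields a system with fewer inversions. -/
theorem two_mul_hillZ_le (H : HeightSystem n Y h) : 2 * hillZ n ≤ totalInversions n h := by
  induction hN : totalInversions n h using Nat.strong_induction_on generalizing h with
  | _ N ih =>
  subst hN
  by_cases hfree : AdjacentFree n h
  · rw [totalInversions_eq]
    exact Nat.mul_le_mul_left 2 ((H.consistent hfree).hillZ_le.trans H.crossCount_le)
  unfold AdjacentFree at hfree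
  push Not at hfree
  obtain ⟨p, hp, q, hq, hadj, t, hinv⟩ := hfree
  have hp' := mem_edgesBelow.1 hp
  have hq' := mem_edgesBelow.1 hq
  have hs1 := hinv.1
  have hs2 := hinv.2.1
  unfold Spans at hs1 hs2
  rcases hadj with hadj | hadj
  -- Common left end: the parts up to the gap are exchanged, and both edges extend beyond it. For a
  -- common right end the parts after the gap are used.
  · have H' := H.exchange (C := fun s => s ≤ t) hp hq (fun s hs => by omega) (fun s hs => by omega)
    have hlt := totalInversions_exchange_lt (C := fun s => s ≤ t) hp hq (by omega) hinv
      (fun s hs => by omega) (by omega) (fun s hs hs' => by unfold Spans; omega)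
    exact (ih _ hlt H' rfl).trans hlt.le
  · have H' := H.exchange (C := fun s => t < s) hp hq (fun s hs => by omega) (fun s hs => by omega)
    have hlt := totalInversions_exchange_lt (C := fun s => t < s) hp hq (by omega) hinv
      (fun s hs => by omega) (by omega) (fun s hs hs' => by unfold Spans; omega)
    exact (ih _ hlt H' rfl).trans hlt.le

/-- A system of heights has at least `hillZ n` inversions, also if adjacent edges are inverted. -/
theorem hillZ_le_card_inversions (H : HeightSystem n Y h) : hillZ n ≤ #(inversions n h) := by
  have := H.two_mul_hillZ_le
  rw [totalInversions_eq] at this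
  omega

end HeightSystem

end Inversions

/-! ### The lower bound for all monotone drawings -/

section CrossingBound

open Set Filter Topology

namespace MonotoneModel

variable {n : ℕ} {D : Drawing (⊤ : SimpleGraph (Fin n))} (m : MonotoneModel D)

/-- The point `x` lies to the left of the vertex `t`, and is so close to it that the edges passing
the vertex are on the same side of it at `x`. -/
structure IsJustBefore (t : ℕ) (x : ℝ) : Prop where
  lt : x < m.X t
  gt : ∀ s < t, m.X s < x
  order : ∀ p ∈ edgesBelow n, p.1 < t → t < p.2 →
    (m.F p.1 p.2 x < m.Y t ↔ m.F p.1 p.2 (m.X t) < m.Y t) ∧ m.F p.1 p.2 x ≠ m.Y t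
  distinct : ∀ p ∈ edgesBelow n, ∀ q ∈ edgesBelow n, p ≠ q → p.1 < t → t < p.2 → q.1 < t →
    t < q.2 → m.F p.1 p.2 x ≠ m.F q.1 q.2 x

/-- Every requirement holds at all points close enough to the left of the vertex, by continuity and
because two edges meet finitely often. -/
theorem exists_isJustBefore {t : ℕ} (ht : t < n) : ∃ x, m.IsJustBefore t x := by
  have h1 : ∀ᶠ x in 𝓝[<] m.X t, x < m.X t := self_mem_nhdsWithin
  have h2 : ∀ᶠ x in 𝓝[<] m.X t, ∀ s ∈ Finset.range t, m.X s < x := by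
    rw [eventually_all_finset]
    intro s hs
    exact eventually_nhdsWithin_of_eventually_nhds
      (lt_mem_nhds (m.X_lt (Finset.mem_range.1 hs) ht))
  have h3 : ∀ᶠ x in 𝓝[<] m.X t, ∀ p ∈ edgesBelow n, p.1 < t → t < p.2 →
      (m.F p.1 p.2 x < m.Y t ↔ m.F p.1 p.2 (m.X t) < m.Y t) ∧ m.F p.1 p.2 x ≠ m.Y t := by
    rw [eventually_all_finset]
    intro p hp
    rw [mem_edgesBelow] at hp
    by_cases hpt : p.1 < t ∧ t < p.2
    swap
    · exact Eventually.of_forall fun x h3 h4 => absurd ⟨h3, h4⟩ hpt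
    have hc := (m.cont p.1 p.2 hp.1 hp.2).continuousAt (x := m.X t)
    apply eventually_nhdsWithin_of_eventually_nhds
    rcases (m.F_ne hpt.1 hpt.2 hp.2).lt_or_gt with h | h
    · filter_upwards [hc.eventually_lt_const h] with x hx _ _
      exact ⟨by simp [hx, h], hx.ne⟩
    · filter_upwards [hc.eventually_const_lt h] with x hx _ _
      exact ⟨by simp [hx.not_gt, h.not_gt], hx.ne'⟩
  have h4 : ∀ᶠ x in 𝓝[<] m.X t, ∀ p ∈ edgesBelow n, ∀ q ∈ edgesBelow n, p ≠ q → x ∉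
      {x | x ∈ Icc (m.X p.1) (m.X p.2) ∧ x ∈ Icc (m.X q.1) (m.X q.2) ∧
        m.F p.1 p.2 x = m.F q.1 q.2 x} := by
    rw [eventually_all_finset]
    intro p hp
    rw [eventually_all_finset]
    intro q hq
    rw [mem_edgesBelow] at hp hq
    by_cases hpq : p = q
    · exact Eventually.of_forall fun x h => absurd hpq h
    have hcl := ((m.finite_zeros hp.1 hp.2 hq.1 hq.2 hpq).subset
      (sdiff_subset (t := {m.X t}))).isClosed
    filter_upwards [mem_nhdsWithin_of_mem_nhds (hcl.isOpen_compl.mem_nhds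
      (show m.X t ∈ _ from fun h => h.2 rfl)), self_mem_nhdsWithin] with x hx hxt _ hx'
    exact hx ⟨hx', (show x < m.X t from hxt).ne⟩
  obtain ⟨x, g1, g2, g3, g4⟩ := (h1.and (h2.and (h3.and h4))).exists
  refine ⟨x, g1, fun s hs => g2 s (Finset.mem_range.2 hs), g3, fun p hp q hq hpq p1 p2 q1 q2 h => ?_⟩
  have hp' := (mem_edgesBelow.1 hp).2
  have hq' := (mem_edgesBelow.1 hq).2
  exact g4 p hp q hq hpq ⟨⟨(g2 _ (Finset.mem_range.2 p1)).le, (g1.trans (m.X_lt p2 hp')).le⟩,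
    ⟨(g2 _ (Finset.mem_range.2 q1)).le, (g1.trans (m.X_lt q2 hq')).le⟩, h⟩

open Classical in
/-- A choice of points just before the vertices. -/
noncomputable def before (t : ℕ) : ℝ := if h : t < n then (m.exists_isJustBefore h).choose else 0

theorem before_spec {t : ℕ} (ht : t < n) : m.IsJustBefore t (m.before t) := by
  rw [before, dif_pos ht]
  exact (m.exists_isJustBefore ht).choose_spec

/-- The heights of the edges just before the vertices. -/
noncomputable def height (p : ℕ × ℕ) (t : ℕ) : ℝ :=
  if t = p.1 ∨ t = p.2 then m.Y t else m.F p.1 p.2 (m.before t)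

/-- Passing edges are measured just before the vertex because two of them may cross exactly above or
below it; at the chosen point their heights differ. -/
theorem heightSystem : HeightSystem n m.Y m.height := by
  constructor
  · intro p _ t ht
    exact if_pos ht
  · intro p hp q hq hpq t h1 h2 h3
    have hp' := mem_edgesBelow.1 hp
    have hq' := mem_edgesBelow.1 hq
    have hb := m.before_spec (t := t) (by omega)
    unfold height at h3
    split_ifs at h3 with e1 e2 e2
    · exact ⟨e1, e2⟩
    · exact absurd h3.symm (hb.order q hq (by omega) (by omega)).2
    · exact absurd h3 (hb.order p hp (by omega) (by omega)).2
    · exact absurd h3 (hb.distinct p hp q hq hpq (by omega) (by omega) (by omega) (by omega))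

/-- The abscissa at which the edges `p` and `q` are compared. -/
noncomputable def sample (p q : ℕ × ℕ) (t : ℕ) : ℝ :=
  if (t = p.1 ∨ t = p.2) ∨ (t = q.1 ∨ t = q.2) then m.X t else m.before t

theorem sample_le (p q : ℕ × ℕ) {t : ℕ} (ht : t < n) : m.sample p q t ≤ m.X t := by
  unfold sample
  split_ifs
  · exact le_rfl
  · exact (m.before_spec ht).lt.le

theorem lt_sample (p q : ℕ × ℕ) {s t : ℕ} (hst : s < t) (ht : t < n) :
    m.X s < m.sample p q t := by
  unfold sample
  split_ifs
  · exact m.X_lt hst ht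
  · exact (m.before_spec ht).gt s hst

theorem sample_mono (p q : ℕ × ℕ) {s t : ℕ} (hst : s ≤ t) (ht : t < n) :
    m.sample p q s ≤ m.sample p q t := by
  rcases hst.eq_or_lt with rfl | h
  · exact le_rfl
  · exact (m.sample_le p q (h.trans ht)).trans (m.lt_sample p q h ht).le

/-- The two heights may belong to different abscissas, namely when exactly one of the edges ends at
`t`. `IsJustBefore.order` then moves the comparison to the vertex itself. -/
theorem height_order {p q : ℕ × ℕ} (hp : p ∈ edgesBelow n) (hq : q ∈ edgesBelow n)
    {t : ℕ} (hpt : p.1 ≤ t ∧ t ≤ p.2) (hqt : q.1 ≤ t ∧ t ≤ q.2)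
    (hne : m.height p t ≠ m.height q t) :
    (m.height p t < m.height q t ↔
      m.F p.1 p.2 (m.sample p q t) < m.F q.1 q.2 (m.sample p q t)) ∧
    m.F p.1 p.2 (m.sample p q t) ≠ m.F q.1 q.2 (m.sample p q t) := by
  have hp' := mem_edgesBelow.1 hp
  have hq' := mem_edgesBelow.1 hq
  have hb := m.before_spec (t := t) (by omega)
  have hF : ∀ r ∈ edgesBelow n, t = r.1 ∨ t = r.2 → m.F r.1 r.2 (m.X t) = m.Y t := by
    rintro r hr (rfl | rfl)
    · exact m.F_left (mem_edgesBelow.1 hr).1 (mem_edgesBelow.1 hr).2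
    · exact m.F_right (mem_edgesBelow.1 hr).1 (mem_edgesBelow.1 hr).2
  unfold height at hne ⊢
  unfold sample
  by_cases e1 : t = p.1 ∨ t = p.2 <;> by_cases e2 : t = q.1 ∨ t = q.2
  · simp [e1, e2] at hne
  · have h1 := hb.order q hq (by omega) (by omega)
    have h2 := m.F_ne (a := q.1) (b := q.2) (c := t) (by omega) (by omega) hq'.2
    simp only [e1, e2, if_true, if_false, true_or, hF p hp e1]
    refine ⟨?_, h2.symm⟩
    rw [← not_iff_not, not_lt, not_lt, le_iff_lt_or_eq, le_iff_lt_or_eq, h1.1]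
    simp [h1.2, h2]
  · have h1 := hb.order p hp (by omega) (by omega)
    have h2 := m.F_ne (a := p.1) (b := p.2) (c := t) (by omega) (by omega) hp'.2
    simp only [e1, e2, if_true, if_false, or_true, hF q hq e2]
    exact ⟨h1.1, h2⟩
  · simp only [e1, e2, if_false, or_self] at hne ⊢
    exact ⟨trivial, hne⟩

theorem exists_zero_of_inverted {p q : ℕ × ℕ} (hp : p ∈ edgesBelow n) (hq : q ∈ edgesBelow n)
    (hpq : p ≠ q) {t : ℕ}
    (h : Inverted (Spans t) (fun r => m.height r t) (fun r => m.height r (t + 1)) p q) :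
    ∃ x ∈ Ioo (m.sample p q t) (m.sample p q (t + 1)), x ∈ m.zeros p.1 p.2 q.1 q.2 := by
  obtain ⟨hsp, hsq, hlt⟩ := h
  unfold Spans at hsp hsq
  have hp' := mem_edgesBelow.1 hp
  have hq' := mem_edgesBelow.1 hq
  have hne1 : m.height p t ≠ m.height q t := fun h => by simp [h] at hlt
  have hne2 : m.height p (t + 1) ≠ m.height q (t + 1) := fun h => by simp [h] at hlt
  obtain ⟨o1, o2⟩ := m.height_order hp hq ⟨hsp.1, by omega⟩ ⟨hsq.1, by omega⟩ hne1
  obtain ⟨o3, o4⟩ := m.height_order hp hq ⟨by omega, hsp.2⟩ ⟨by omega, hsq.2⟩ hne2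
  have hg : (fun x => m.F p.1 p.2 x - m.F q.1 q.2 x) (m.sample p q t) *
      (fun x => m.F p.1 p.2 x - m.F q.1 q.2 x) (m.sample p q (t + 1)) < 0 := by
    simp only [mul_neg_iff, sub_pos, sub_neg] at hlt ⊢
    rcases hlt with ⟨h1, h2⟩ | ⟨h1, h2⟩
    · exact Or.inl ⟨o2.lt_or_gt.resolve_left fun h => h1.not_gt (o1.2 h), o3.1 h2⟩
    · exact Or.inr ⟨o1.1 h1, o4.lt_or_gt.resolve_left fun h => h2.not_gt (o3.2 h)⟩
  obtain ⟨x, hx, hx0⟩ := exists_zero_of_mul_neg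
    ((m.cont p.1 p.2 hp'.1 hp'.2).sub (m.cont q.1 q.2 hq'.1 hq'.2))
    (m.sample_mono p q (Nat.le_succ t) (by omega)) hg
  have hlo : ∀ r ∈ edgesBelow n, r = p ∨ r = q → r.1 ≤ t → m.X r.1 < x := by
    intro r hr hrpq hrt
    refine lt_of_le_of_lt ?_ hx.1
    rcases hrt.eq_or_lt with h | h
    · rw [sample, if_pos (by rcases hrpq with rfl | rfl <;> simp [h]), h]
    · exact (m.lt_sample p q h (by omega)).le
  have hhi : ∀ r ∈ edgesBelow n, t + 1 ≤ r.2 → x < m.X r.2 := by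
    intro r hr hrt
    have hr' := mem_edgesBelow.1 hr
    refine (hx.2.trans_le (m.sample_le p q (by omega))).trans_le ?_
    rcases hrt.eq_or_lt with h | h
    · exact (congrArg m.X h).le
    · exact (m.X_lt h hr'.2).le
  exact ⟨x, hx, ⟨hlo p hp (.inl rfl) hsp.1, hhi p hp hsp.2⟩,
    ⟨hlo q hq (.inr rfl) hsq.1, hhi q hq hsq.2⟩, sub_eq_zero.1 hx0⟩

/-- Each inversion yields a crossing between two consecutive samples. A crossing determines its two
edges because no third edge passes through it, and its gap because the samples of this pair increase
with `t`. -/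
theorem card_inversions_le_cr : ((inversions n m.height).card : ℕ∞) ≤ D.cr := by
  have hw : ∀ w : ℕ × (ℕ × ℕ) × (ℕ × ℕ), ∃ x, w ∈ inversions n m.height →
      x ∈ Ioo (m.sample w.2.1 w.2.2 w.1) (m.sample w.2.1 w.2.2 (w.1 + 1)) ∧
      x ∈ m.zeros w.2.1.1 w.2.1.2 w.2.2.1 w.2.2.2 := by
    intro w
    by_cases hw : w ∈ inversions n m.height
    · have hw' := hw
      simp only [inversions, Finset.mem_filter, Finset.mem_product] at hw'
      obtain ⟨⟨-, h1, h2⟩, h3, h4⟩ := hw'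
      obtain ⟨x, hx⟩ := m.exists_zero_of_inverted h1 h2 (by rintro h; rw [h] at h4; omega) h3
      exact ⟨x, fun _ => hx⟩
    · exact ⟨0, fun h => absurd h hw⟩
  choose ξ hξ using hw
  rw [← Set.encard_coe_eq_coe_finsetCard, Drawing.cr]
  have hedge : ∀ p ∈ edgesBelow n, ∀ q ∈ edgesBelow n, m.edge p.1 p.2 = m.edge q.1 q.2 → p = q :=
    fun p hp q hq h => by
      rw [mem_edgesBelow] at hp hq
      exact Prod.ext_iff.2 (m.edge_inj hp.1 hp.2 hq.1 hq.2 h)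
  refine Set.encard_le_encard_of_injOn (f := fun w => (ξ w, m.F w.2.1.1 w.2.1.2 (ξ w))) ?_ ?_
  · intro w hw
    have hx := (hξ w hw).2
    simp only [inversions, Finset.mem_coe, Finset.mem_filter, Finset.mem_product] at hw
    obtain ⟨⟨-, h1, h2⟩, -, h4⟩ := hw
    have hne : w.2.1 ≠ w.2.2 := by intro h; rw [h] at h4; omega
    refine ⟨m.edge w.2.1.1 w.2.1.2, m.edge w.2.2.1 w.2.2.2, fun h => hne (hedge _ h1 _ h2 h), ?_⟩
    rw [mem_edgesBelow] at h1 h2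
    rw [m.crossings_eq h1.1 h1.2 h2.1 h2.2 hne]
    exact mem_image_of_mem _ hx
  · rintro ⟨t, p, q⟩ hw ⟨t', p', q'⟩ hw' heq
    obtain ⟨⟨hl, hu⟩, hz⟩ := hξ _ hw
    obtain ⟨⟨hl', hu'⟩, hz'⟩ := hξ _ hw'
    simp only [inversions, Finset.mem_coe, Finset.mem_filter, Finset.mem_product,
      Finset.mem_range] at hw hw'
    obtain ⟨⟨-, h1, h2⟩, ⟨⟨-, h7⟩, -⟩, h4⟩ := hw
    obtain ⟨⟨-, h1', h2'⟩, ⟨⟨-, h7'⟩, -⟩, h4'⟩ := hw'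
    have hne : p ≠ q := by rintro rfl; omega
    have hne' : p' ≠ q' := by rintro rfl; omega
    dsimp only at heq hl hu hz hl' hu' hz' h7 h7'
    generalize ξ (t, p, q) = x at *
    generalize ξ (t', p', q') = x' at *
    rw [Prod.mk.injEq] at heq
    obtain ⟨rfl, hy⟩ := heq
    have hint : ∀ r ∈ edgesBelow n, x ∈ Ioo (m.X r.1) (m.X r.2) →
        m.F p.1 p.2 x = m.F r.1 r.2 x → (x, m.F p.1 p.2 x) ∈ D.edgeInterior (m.edge r.1 r.2) :=
      fun r hr hxr hxy => (m.mem_edgeInterior (mem_edgesBelow.1 hr).1 (mem_edgesBelow.1 hr).2).2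
        ⟨hxr, hxy⟩
    have ip := hint p h1 hz.1 rfl
    have iq := hint q h2 hz.2.1 hz.2.2
    have htriple : ∀ r ∈ edgesBelow n, x ∈ Ioo (m.X r.1) (m.X r.2) →
        m.F p.1 p.2 x = m.F r.1 r.2 x → r = p ∨ r = q := by
      intro r hr hxr hxy
      by_contra! hcon
      have hemp := D.no_triple (m.edge p.1 p.2) (m.edge q.1 q.2) (m.edge r.1 r.2)
        (fun h => hne (hedge _ h1 _ h2 h)) (fun h => hcon.1 (hedge _ h1 _ hr h).symm)
        (fun h => hcon.2 (hedge _ h2 _ hr h).symm)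
      have : (x, m.F p.1 p.2 x) ∈ (∅ : Set (ℝ × ℝ)) := by
        rw [← hemp]; exact ⟨⟨ip, iq⟩, hint r hr hxr hxy⟩
      exact this
    have ep := htriple p' h1' hz'.1 hy
    have eq := htriple q' h2' hz'.2.1 (hy.trans hz'.2.2)
    have hpq : p' = p ∧ q' = q := by
      rcases ep with rfl | rfl <;> rcases eq with rfl | rfl
      · exact absurd rfl hne'
      · exact ⟨rfl, rfl⟩
      · omega
      · exact absurd rfl hne'
    obtain ⟨rfl, rfl⟩ := hpq
    have hp' := mem_edgesBelow.1 h1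
    have htt : t = t' := by
      rcases lt_trichotomy t t' with h | h | h
      · have := m.sample_mono p' q' (show t + 1 ≤ t' from h) (by omega)
        linarith
      · exact h
      · have := m.sample_mono p' q' (show t' + 1 ≤ t from h) (by omega)
        linarith
    rw [htt]

end MonotoneModel

theorem hillZ_le_cr {n : ℕ} (D : Drawing (⊤ : SimpleGraph (Fin n))) (hm : D.IsMonotone) :
    (hillZ n : ℕ∞) ≤ D.cr := by
  rcases lt_or_ge n 4 with hn | hn
  · simp [hillZ_eq_zero_of_lt hn]
  obtain ⟨m⟩ := hm.nonempty_model (by omega)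
  exact (Nat.cast_le.2 m.heightSystem.hillZ_le_card_inversions).trans m.card_inversions_le_cr

end CrossingBound

/-! ### Parabolic arcs and generic abscissas -/

section Parabolas

open Set Filter Topology

/-- A quadratic polynomial with roots `a` and `c`. -/
def parabola (κ a c t : ℝ) : ℝ := κ * ((t - a) * (t - c))

theorem continuous_parabola (κ a c : ℝ) : Continuous (parabola κ a c) := by
  unfold parabola; fun_prop

/-- The arc of a parabola between two points of the `x`-axis. -/
def parabolaArc (κ a c : ℝ) : Set (ℝ × ℝ) := {z | z.1 ∈ Icc a c ∧ z.2 = parabola κ a c z.1}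

theorem IsSimpleArc.symm {A : Set (ℝ × ℝ)} {p q : ℝ × ℝ} (h : IsSimpleArc A p q) :
    IsSimpleArc A q p := by
  obtain ⟨γ, h1, h2⟩ := h
  refine ⟨γ.symm, fun s t hst => ?_, by rw [Path.symm_range, h2]⟩
  exact unitInterval.symm_bijective.injective (h1 hst)

theorem isSimpleArc_graph {F : ℝ → ℝ} (hF : Continuous F) {a c : ℝ} (hac : a < c) :
    IsSimpleArc {z | z.1 ∈ Icc a c ∧ z.2 = F z.1} (a, F a) (c, F c) := by
  have hpos : 0 < c - a := sub_pos.2 hac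
  refine ⟨⟨⟨fun t => (a + t * (c - a), F (a + t * (c - a))), by fun_prop⟩, by simp, by simp⟩,
    fun s t hst => ?_, ?_⟩
  · have h := congrArg Prod.fst hst
    simp only [Path.coe_mk_mk, add_right_inj, mul_eq_mul_right_iff, hpos.ne', or_false] at h
    exact Subtype.ext h
  · ext z
    constructor
    · rintro ⟨t, rfl⟩
      simp only [Path.coe_mk_mk, mem_ofPred_eq, mem_Icc, and_true]
      have h0 := t.2.1
      have h1 := t.2.2
      constructor <;> nlinarith
    · rintro ⟨⟨h1, h2⟩, h3⟩
      refine ⟨⟨(z.1 - a) / (c - a), div_nonneg (by linarith) hpos.le,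
        (div_le_one hpos).2 (by linarith)⟩, ?_⟩
      have : a + (z.1 - a) / (c - a) * (c - a) = z.1 := by field_simp; ring
      simp only [Path.coe_mk_mk, this]
      exact Prod.ext rfl h3.symm

theorem isSimpleArc_parabolaArc (κ : ℝ) {a c : ℝ} (hac : a < c) :
    IsSimpleArc (parabolaArc κ a c) (a, 0) (c, 0) := by
  have h := isSimpleArc_graph (continuous_parabola κ a c) hac
  rw [show parabola κ a c a = 0 by simp [parabola],
    show parabola κ a c c = 0 by simp [parabola]] at h
  exact h

theorem mem_parabolaArc_diff {κ a c : ℝ} {z : ℝ × ℝ} :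
    z ∈ parabolaArc κ a c \ {(a, 0), (c, 0)} ↔ z.1 ∈ Ioo a c ∧ z.2 = parabola κ a c z.1 := by
  simp only [parabolaArc, Set.mem_sdiff, mem_ofPred_eq, mem_insert_iff, mem_singleton_iff, not_or,
    mem_Icc, mem_Ioo]
  constructor
  · rintro ⟨⟨⟨h1, h2⟩, h3⟩, h4, h5⟩
    refine ⟨⟨lt_of_le_of_ne h1 fun h => h4 ?_, lt_of_le_of_ne h2 fun h => h5 ?_⟩, h3⟩
    · exact Prod.ext h.symm (by rw [h3, ← h]; simp [parabola])
    · exact Prod.ext h (by rw [h3, h]; simp [parabola])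
  · rintro ⟨⟨h1, h2⟩, h3⟩
    refine ⟨⟨⟨h1.le, h2.le⟩, h3⟩, fun h => ?_, fun h => ?_⟩
    · rw [h] at h1; exact h1.false
    · rw [h] at h2; exact h2.false

/-- Graphs whose difference is a nonzero multiple of `x - p.1` cross properly at `p`. -/
theorem crossProperlyAt_of_sub_eq {A B U : Set (ℝ × ℝ)} {p : ℝ × ℝ} {f g : ℝ → ℝ} {k : ℝ}
    (hU : IsOpen U) (hp : p ∈ U) (hg : Continuous g)
    (hA : ∀ q ∈ U, q ∈ A ↔ q.2 = f q.1) (hB : ∀ q ∈ U, q ∈ B ↔ q.2 = g q.1) (hpg : p.2 = g p.1)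
    (hk : k ≠ 0) (hfg : ∀ x, f x - g x = k * (x - p.1)) : CrossProperlyAt A B p := by
  have hf : f = fun x => g x + k * (x - p.1) := funext fun x => by rw [← hfg]; ring
  have hfc : Continuous f := by rw [hf]; fun_prop
  -- The new coordinates are the heights above the two graphs. Their difference is `k * (x - p.1)`,
  -- from which `x` is recovered.
  let h : (ℝ × ℝ) ≃ₜ (ℝ × ℝ) :=
    { toFun := fun z => (z.2 - g z.1, z.2 - f z.1)
      invFun := fun w => (p.1 + (w.1 - w.2) / k, w.1 + g (p.1 + (w.1 - w.2) / k))
      left_inv := fun z => by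
        have h1 : p.1 + ((z.2 - g z.1) - (z.2 - f z.1)) / k = z.1 := by
          rw [show (z.2 - g z.1) - (z.2 - f z.1) = k * (z.1 - p.1) by rw [← hfg]; ring]
          field_simp
          ring
        simp only [h1]
        exact Prod.ext rfl (by simp)
      right_inv := fun w => by
        have h1 := hfg (p.1 + (w.1 - w.2) / k)
        have h2 : k * (p.1 + (w.1 - w.2) / k - p.1) = w.1 - w.2 := by field_simp; ring
        rw [h2] at h1
        refine Prod.ext ?_ ?_ <;> simp only <;> linarith
      continuous_toFun := by fun_prop
      continuous_invFun := by fun_prop }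
  have hpf : p.2 = f p.1 := by have := hfg p.1; rw [sub_self, mul_zero] at this; linarith
  refine ⟨h.toOpenPartialHomeomorph.restrOpen U hU, ?_, ?_, ?_⟩
  · simp [hp]
  · change (p.2 - g p.1, p.2 - f p.1) = (0, 0)
    rw [← hpg, ← hpf]; simp
  · intro q hq
    have hqU : q ∈ U := by simpa using hq
    change (q ∈ A ↔ q.2 - f q.1 = 0) ∧ (q ∈ B ↔ q.2 - g q.1 = 0)
    rw [hA q hqU, hB q hqU, sub_eq_zero, sub_eq_zero]
    exact ⟨Iff.rfl, Iff.rfl⟩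

/-- Two parabolic arcs over intervals of which one contains the other do not cross. -/
theorem parabola_ne_of_le {a b c d t : ℝ} (hb : b < t) (hd : t < d) (hab : a ≤ b) (hdc : d ≤ c)
    (h : (t - a) * (t - c) = (t - b) * (t - d)) : a = b ∧ c = d := by
  have h1 : (t - a) * (c - t) = (t - b) * (d - t) := by linarith
  constructor
  · nlinarith [mul_nonneg (sub_nonneg.2 hab) (sub_nonneg.2 hdc)]
  · nlinarith [mul_nonneg (sub_nonneg.2 hab) (sub_nonneg.2 hdc)]

/-- Arcs in opposite half-planes have interior values of opposite sign, and in the same half-plane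
`parabola_ne_of_le` excludes intervals of which one contains the other. -/
theorem interleaved_of_parabola_eq {κ μ a b c d t : ℝ} (hκ : κ = 1 ∨ κ = -1) (hμ : μ = 1 ∨ μ = -1)
    (h1 : t ∈ Ioo a c) (h2 : t ∈ Ioo b d) (hne : ¬ (a = b ∧ c = d))
    (h : parabola κ a c t = parabola μ b d t) :
    κ = μ ∧ (t - a) * (t - c) = (t - b) * (t - d) ∧ (a < b ∧ c < d ∨ b < a ∧ d < c) := by
  obtain ⟨ha, hc⟩ := h1
  obtain ⟨hb, hd⟩ := h2
  have e1 : (t - a) * (t - c) < 0 := mul_neg_of_pos_of_neg (by linarith) (by linarith)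
  have e2 : (t - b) * (t - d) < 0 := mul_neg_of_pos_of_neg (by linarith) (by linarith)
  unfold parabola at h
  have hκμ : κ = μ ∧ (t - a) * (t - c) = (t - b) * (t - d) := by
    rcases hκ with rfl | rfl <;> rcases hμ with rfl | rfl
    · exact ⟨rfl, by linarith⟩
    · linarith
    · linarith
    · exact ⟨rfl, by linarith⟩
  refine ⟨hκμ.1, hκμ.2, ?_⟩
  rcases le_or_gt a b with hab | hab
  · have hcd : c < d := lt_of_not_ge fun hdc => hne (parabola_ne_of_le hb hd hab hdc hκμ.2)
    refine Or.inl ⟨lt_of_le_of_ne hab fun hab' => ?_, hcd⟩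
    have := parabola_ne_of_le ha hc hab'.symm.le hcd.le hκμ.2.symm
    exact hcd.ne this.2.symm
  · refine Or.inr ⟨hab, lt_of_not_ge fun hcd => ?_⟩
    exact hab.ne (parabola_ne_of_le ha hc hab.le hcd hκμ.2.symm).1

/-- The condition on the abscissas that excludes three concurrent parabolas. -/
def IsGenericSequence {n : ℕ} (x : Fin n → ℝ) : Prop :=
  ∀ a b c d e f : Fin n, a ≠ c → a ≠ e → a ≠ f → b ≠ c → b ≠ e → b ≠ f → d ≠ c → d ≠ e → d ≠ f →
    ((x c + x d) - (x a + x b)) * (x e * x f - x a * x b) -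
      ((x e + x f) - (x a + x b)) * (x c * x d - x a * x b) ≠ 0

-- The forbidden coincidences are finitely many nonzero polynomial conditions, so a product of
-- infinite sets contains a point that avoids them all. The unit intervals `(i, i + 1)` make the
-- sequence increasing.
open MvPolynomial in
theorem exists_generic_strictMono (n : ℕ) :
    ∃ x : Fin n → ℝ, StrictMono x ∧ IsGenericSequence x := by
  classical
  let P : (Fin 6 → Fin n) → MvPolynomial (Fin n) ℝ := fun i =>
    ((X (i 2) + X (i 3)) - (X (i 0) + X (i 1))) * (X (i 4) * X (i 5) - X (i 0) * X (i 1)) -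
      ((X (i 4) + X (i 5)) - (X (i 0) + X (i 1))) * (X (i 2) * X (i 3) - X (i 0) * X (i 1))
  let S : Finset (Fin 6 → Fin n) := {i | i 0 ≠ i 2 ∧ i 0 ≠ i 4 ∧ i 0 ≠ i 5 ∧ i 1 ≠ i 2 ∧
    i 1 ≠ i 4 ∧ i 1 ≠ i 5 ∧ i 3 ≠ i 2 ∧ i 3 ≠ i 4 ∧ i 3 ≠ i 5}
  have hP : ∀ i ∈ S, P i ≠ 0 := by
    intro i hi h0
    obtain ⟨h1, h2, h3, h4, h5, h6, h7, h8, h9⟩ := (Finset.mem_filter.1 hi).2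
    -- With the value one at the indices `2`, `4`, `5` and zero at `0`, `1`, `3`, the polynomial
    -- equals one. The inequalities in `S` are what this evaluation needs.
    have := congrArg (eval fun v => if v = i 2 ∨ v = i 4 ∨ v = i 5 then (1 : ℝ) else 0) h0
    simp [P, h1, h2, h3, h4, h5, h6, h7, h8, h9] at this
  have hprod : ∏ i ∈ S, P i ≠ 0 := Finset.prod_ne_zero_iff.2 hP
  obtain ⟨x, hx, hx0⟩ : ∃ x ∈ Set.pi univ (fun i : Fin n => Ioo (i : ℝ) (i + 1)),
      eval x (∏ i ∈ S, P i) ≠ 0 := by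
    by_contra! hcon
    exact hprod (funext_set (fun i : Fin n => Ioo (i : ℝ) (i + 1))
      (fun i => Ioo_infinite (lt_add_one _)) fun x hx => by rw [hcon x hx, map_zero])
  refine ⟨x, fun i j hij => ?_, fun a b c d e f h1 h2 h3 h4 h5 h6 h7 h8 h9 => ?_⟩
  · have hi := (hx i (mem_univ i)).2
    have hj := (hx j (mem_univ j)).1
    have : (i : ℝ) + 1 ≤ j := by exact_mod_cast hij
    linarith
  · rw [map_prod, Finset.prod_ne_zero_iff] at hx0
    have := hx0 ![a, b, c, d, e, f] (by
      simp only [S, Finset.mem_filter, Finset.mem_univ, true_and]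
      exact ⟨h1, h2, h3, h4, h5, h6, h7, h8, h9⟩)
    simpa [P] using this

end Parabolas

/-! ### The optimal drawing and the theorem -/

section ParabolaDrawing

open Set Filter Topology

theorem Sym2.mem_iff_eq_inf_or_eq_sup {α : Type*} [LinearOrder α] (e : Sym2 α) (v : α) :
    v ∈ e ↔ v = e.inf ∨ v = e.sup := by
  induction e with
  | _ a b =>
    rw [Sym2.mem_iff, Sym2.inf_mk, Sym2.sup_mk]
    rcases le_total a b with h | h
    · rw [inf_eq_left.2 h, sup_eq_right.2 h]
    · rw [inf_eq_right.2 h, sup_eq_left.2 h, or_comm]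

theorem Sym2.mk_inf_sup {α : Type*} [LinearOrder α] (e : Sym2 α) : s(e.inf, e.sup) = e := by
  rw [← Sym2.inf_eq_inf_and_sup_eq_sup]
  have h := e.inf_le_sup
  rw [Sym2.inf_mk, Sym2.sup_mk]
  exact ⟨inf_eq_left.2 h, sup_eq_right.2 h⟩

theorem Sym2.inf_lt_sup_of_not_isDiag {α : Type*} [LinearOrder α] {e : Sym2 α} (h : ¬ e.IsDiag) :
    e.inf < e.sup := by
  refine lt_of_le_of_ne e.inf_le_sup fun h' => h ?_
  rw [← e.mk_inf_sup, Sym2.mk_isDiag_iff]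
  exact h'

theorem inf_lt_sup_of_mem_edgeSet {n : ℕ} (e : (⊤ : SimpleGraph (Fin n)).edgeSet) :
    (e : Sym2 (Fin n)).inf < (e : Sym2 (Fin n)).sup :=
  Sym2.inf_lt_sup_of_not_isDiag (SimpleGraph.not_isDiag_of_mem_edgeSet _ e.2)

/-- The parabolic arc representing a pair of points `(x v, 0)`; `κ` selects the half-plane. -/
def pairArc {n : ℕ} (x : Fin n → ℝ) (κ : Fin n → Fin n → ℝ) (e : Sym2 (Fin n)) : Set (ℝ × ℝ) :=
  parabolaArc (κ e.inf e.sup) (x e.inf) (x e.sup)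

theorem mem_pairArc_diff {n : ℕ} (x : Fin n → ℝ) (κ : Fin n → Fin n → ℝ) (e : Sym2 (Fin n))
    (z : ℝ × ℝ) :
    z ∈ pairArc x κ e \ (fun v => (x v, (0 : ℝ))) '' {v | v ∈ e} ↔
      z.1 ∈ Ioo (x e.inf) (x e.sup) ∧
        z.2 = parabola (κ e.inf e.sup) (x e.inf) (x e.sup) z.1 := by
  have : (fun v => (x v, (0 : ℝ))) '' {v | v ∈ e} = {(x e.inf, 0), (x e.sup, 0)} := by
    rw [← image_pair (fun v => (x v, (0 : ℝ)))]
    congr 1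
    ext v
    exact e.mem_iff_eq_inf_or_eq_sup v
  rw [this]
  exact mem_parabolaArc_diff

/-- Two interior points of parabolic arcs that coincide come from interleaved pairs. -/
theorem interleaved_pairs {n : ℕ} {x : Fin n → ℝ} {κ : Fin n → Fin n → ℝ} (hx : StrictMono x)
    (hκ : ∀ a c, κ a c = 1 ∨ κ a c = -1) {e f : Sym2 (Fin n)} (hef : e ≠ f) {t : ℝ}
    (he : t ∈ Ioo (x e.inf) (x e.sup)) (hf : t ∈ Ioo (x f.inf) (x f.sup))
    (h : parabola (κ e.inf e.sup) (x e.inf) (x e.sup) t =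
      parabola (κ f.inf f.sup) (x f.inf) (x f.sup) t) :
    κ e.inf e.sup = κ f.inf f.sup ∧
      (t - x e.inf) * (t - x e.sup) = (t - x f.inf) * (t - x f.sup) ∧
      (e.inf < f.inf ∧ f.inf < e.sup ∧ e.sup < f.sup ∨
        f.inf < e.inf ∧ e.inf < f.sup ∧ f.sup < e.sup) := by
  obtain ⟨h1, h2, h3⟩ := interleaved_of_parabola_eq (hκ _ _) (hκ _ _) he hf (fun ⟨h1, h2⟩ =>
    hef (Sym2.inf_eq_inf_and_sup_eq_sup.1 ⟨hx.injective h1, hx.injective h2⟩)) h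
  refine ⟨h1, h2, ?_⟩
  simp only [hx.lt_iff_lt] at h3
  have h4 : f.inf < e.sup := hx.lt_iff_lt.1 (hf.1.trans he.2)
  have h5 : e.inf < f.sup := hx.lt_iff_lt.1 (he.1.trans hf.2)
  rcases h3 with h3 | h3
  · exact Or.inl ⟨h3.1, h4, h3.2⟩
  · exact Or.inr ⟨h3.1, h5, h3.2⟩

theorem endpoints_ne_of_interleaved {n : ℕ} {e f : Sym2 (Fin n)}
    (he : e.inf < e.sup) (hf : f.inf < f.sup)
    (h : e.inf < f.inf ∧ f.inf < e.sup ∧ e.sup < f.sup ∨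
      f.inf < e.inf ∧ e.inf < f.sup ∧ f.sup < e.sup) :
    e.inf ≠ f.inf ∧ e.inf ≠ f.sup ∧ e.sup ≠ f.inf ∧ e.sup ≠ f.sup := by
  refine ⟨fun h' => ?_, fun h' => ?_, fun h' => ?_, fun h' => ?_⟩ <;> simp only [h'] at * <;> omega

theorem sum_ne_of_interleaved {n : ℕ} {x : Fin n → ℝ} (hx : StrictMono x) {e f : Sym2 (Fin n)}
    (h : e.inf < f.inf ∧ f.inf < e.sup ∧ e.sup < f.sup ∨
      f.inf < e.inf ∧ e.inf < f.sup ∧ f.sup < e.sup) :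
    (x e.inf + x e.sup) - (x f.inf + x f.sup) ≠ 0 := by
  rcases h with ⟨h1, -, h2⟩ | ⟨h1, -, h2⟩
  · have := hx h1; have := hx h2; exact (by linarith : _ < (0 : ℝ)).ne
  · have := hx h1; have := hx h2; exact (by linarith : (0 : ℝ) < _).ne'

theorem abscissa_of_interleaved {n : ℕ} {x : Fin n → ℝ} (hx : StrictMono x) {e f : Sym2 (Fin n)}
    (h : e.inf < f.inf ∧ f.inf < e.sup ∧ e.sup < f.sup ∨
      f.inf < e.inf ∧ e.inf < f.sup ∧ f.sup < e.sup) {t : ℝ}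
    (ht : (t - x e.inf) * (t - x e.sup) = (t - x f.inf) * (t - x f.sup)) :
    t = (x e.inf * x e.sup - x f.inf * x f.sup) /
      ((x e.inf + x e.sup) - (x f.inf + x f.sup)) := by
  rw [eq_div_iff (sum_ne_of_interleaved hx h)]
  linarith

theorem finite_pairArc_inter {n : ℕ} {x : Fin n → ℝ} {κ : Fin n → Fin n → ℝ} (hx : StrictMono x)
    (hκ : ∀ a c, κ a c = 1 ∨ κ a c = -1) {e f : Sym2 (Fin n)} (hef : e ≠ f) :
    (pairArc x κ e ∩ pairArc x κ f).Finite := by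
  refine Set.Finite.subset (Set.Finite.image
    (fun t => (t, parabola (κ e.inf e.sup) (x e.inf) (x e.sup) t))
    (Set.toFinite {x e.inf, x e.sup, x f.inf, x f.sup,
      (x e.inf * x e.sup - x f.inf * x f.sup) /
        ((x e.inf + x e.sup) - (x f.inf + x f.sup))})) ?_
  rintro z ⟨⟨⟨h1, h2⟩, h3⟩, ⟨⟨h4, h5⟩, h6⟩⟩
  refine ⟨z.1, ?_, Prod.ext rfl h3.symm⟩
  simp only [mem_insert_iff, mem_singleton_iff]
  rcases h1.eq_or_lt with h1 | h1
  · exact Or.inl h1.symm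
  rcases h2.eq_or_lt with h2 | h2
  · exact Or.inr (Or.inl h2)
  rcases h4.eq_or_lt with h4 | h4
  · exact Or.inr (Or.inr (Or.inl h4.symm))
  rcases h5.eq_or_lt with h5 | h5
  · exact Or.inr (Or.inr (Or.inr (Or.inl h5)))
  obtain ⟨-, h7, h8⟩ := interleaved_pairs hx hκ hef ⟨h1, h2⟩ ⟨h4, h5⟩ (h3.symm.trans h6)
  exact Or.inr (Or.inr (Or.inr (Or.inr (abscissa_of_interleaved hx h8 h7))))

theorem crossProperlyAt_pairArc {n : ℕ} {x : Fin n → ℝ} {κ : Fin n → Fin n → ℝ} (hx : StrictMono x)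
    (hκ : ∀ a c, κ a c = 1 ∨ κ a c = -1) {e f : Sym2 (Fin n)} (hef : e ≠ f) {z : ℝ × ℝ}
    (he : z.1 ∈ Ioo (x e.inf) (x e.sup))
    (he' : z.2 = parabola (κ e.inf e.sup) (x e.inf) (x e.sup) z.1)
    (hf : z.1 ∈ Ioo (x f.inf) (x f.sup))
    (hf' : z.2 = parabola (κ f.inf f.sup) (x f.inf) (x f.sup) z.1) :
    CrossProperlyAt (pairArc x κ e) (pairArc x κ f) z := by
  obtain ⟨h1, h2, h3⟩ := interleaved_pairs hx hκ hef he hf (he'.symm.trans hf')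
  have hκ0 : κ f.inf f.sup ≠ 0 := by rcases hκ f.inf f.sup with h | h <;> rw [h] <;> norm_num
  -- The two parabolas have the same leading coefficient, so their difference is affine; `k` is its
  -- slope, nonzero for interleaved pairs.
  refine crossProperlyAt_of_sub_eq
    (U := Prod.fst ⁻¹' (Ioo (x e.inf) (x e.sup) ∩ Ioo (x f.inf) (x f.sup)))
    (k := -(κ f.inf f.sup * ((x e.inf + x e.sup) - (x f.inf + x f.sup))))
    ((isOpen_Ioo.inter isOpen_Ioo).preimage continuous_fst) ⟨he, hf⟩
    (continuous_parabola (κ f.inf f.sup) (x f.inf) (x f.sup))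
    (f := parabola (κ e.inf e.sup) (x e.inf) (x e.sup)) ?_ ?_ hf' ?_ ?_
  · exact fun q hq => and_iff_right (Ioo_subset_Icc_self hq.1)
  · exact fun q hq => and_iff_right (Ioo_subset_Icc_self hq.2)
  · exact neg_ne_zero.2 (mul_ne_zero hκ0 (sum_ne_of_interleaved hx h3))
  · intro t
    unfold parabola
    rw [h1]
    linear_combination (κ f.inf f.sup) * h2

/-- Three concurrent arcs are pairwise interleaved. Equating the parabolas gives two linear
equations for the common abscissa, and eliminating it contradicts genericity. -/
theorem pairArc_no_triple {n : ℕ} {x : Fin n → ℝ} {κ : Fin n → Fin n → ℝ} (hx : StrictMono x)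
    (hg : IsGenericSequence x) (hκ : ∀ a c, κ a c = 1 ∨ κ a c = -1) {e f g : Sym2 (Fin n)}
    (hef : e ≠ f) (heg : e ≠ g) (hfg : f ≠ g) {z : ℝ × ℝ}
    (he : z.1 ∈ Ioo (x e.inf) (x e.sup))
    (he' : z.2 = parabola (κ e.inf e.sup) (x e.inf) (x e.sup) z.1)
    (hf : z.1 ∈ Ioo (x f.inf) (x f.sup))
    (hf' : z.2 = parabola (κ f.inf f.sup) (x f.inf) (x f.sup) z.1)
    (hgz : z.1 ∈ Ioo (x g.inf) (x g.sup))
    (hg' : z.2 = parabola (κ g.inf g.sup) (x g.inf) (x g.sup) z.1) : False := by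
  have le := hx.lt_iff_lt.1 (he.1.trans he.2)
  have lf := hx.lt_iff_lt.1 (hf.1.trans hf.2)
  have lg := hx.lt_iff_lt.1 (hgz.1.trans hgz.2)
  obtain ⟨-, h1, h2⟩ := interleaved_pairs hx hκ hef he hf (he'.symm.trans hf')
  obtain ⟨-, h3, h4⟩ := interleaved_pairs hx hκ heg he hgz (he'.symm.trans hg')
  obtain ⟨-, h5, h6⟩ := interleaved_pairs hx hκ hfg hf hgz (hf'.symm.trans hg')
  obtain ⟨a1, a2, a3, a4⟩ := endpoints_ne_of_interleaved le lf h2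
  obtain ⟨b1, b2, b3, b4⟩ := endpoints_ne_of_interleaved le lg h4
  obtain ⟨c1, c2, c3, c4⟩ := endpoints_ne_of_interleaved lf lg h6
  refine hg e.inf e.sup f.inf f.sup g.inf g.sup a1 b1 b2 a3 b3 b4 lf.ne' c3 c4 ?_
  have e1 : x f.inf * x f.sup - x e.inf * x e.sup =
    z.1 * ((x f.inf + x f.sup) - (x e.inf + x e.sup)) := by linarith
  have e2 : x g.inf * x g.sup - x e.inf * x e.sup =
    z.1 * ((x g.inf + x g.sup) - (x e.inf + x e.sup)) := by linarith
  rw [e1, e2]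
  ring

/-- The drawing of the complete graph by parabolic arcs with endpoints on the `x`-axis. -/
noncomputable def parabolaDrawing {n : ℕ} (x : Fin n → ℝ) (κ : Fin n → Fin n → ℝ)
    (hx : StrictMono x) (hg : IsGenericSequence x) (hκ : ∀ a c, κ a c = 1 ∨ κ a c = -1) :
    Drawing (⊤ : SimpleGraph (Fin n)) where
  point v := (x v, 0)
  arc e := pairArc x κ e
  point_injective u v h := hx.injective (congrArg Prod.fst h)
  isSimpleArc u v huv := by
    rcases lt_or_gt_of_ne (show u ≠ v from huv) with h | h
    · simp only [pairArc, Sym2.inf_mk, Sym2.sup_mk, inf_eq_left.2 h.le, sup_eq_right.2 h.le]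
      exact isSimpleArc_parabolaArc _ (hx h)
    · simp only [pairArc, Sym2.inf_mk, Sym2.sup_mk, inf_eq_right.2 h.le, sup_eq_left.2 h.le]
      exact (isSimpleArc_parabolaArc _ (hx h)).symm
  mem_of_point_mem e w hw := by
    have h : (0 : ℝ) = κ _ _ * ((x w - _) * (x w - _)) := hw.2
    rw [Sym2.mem_iff_eq_inf_or_eq_sup]
    rcases mul_eq_zero.1 h.symm with h | h
    · rcases hκ (e : Sym2 (Fin n)).inf (e : Sym2 (Fin n)).sup with h' | h' <;>
        rw [h'] at h <;> norm_num at h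
    · exact (mul_eq_zero.1 h).imp (fun h => hx.injective (sub_eq_zero.1 h))
        fun h => hx.injective (sub_eq_zero.1 h)
  finite_inter e f hef := finite_pairArc_inter hx hκ (Subtype.coe_ne_coe.2 hef)
  not_touch e f hef p hp := by
    obtain ⟨h1, h2⟩ := (mem_pairArc_diff x κ e p).1 hp.1
    obtain ⟨h3, h4⟩ := (mem_pairArc_diff x κ f p).1 hp.2
    exact crossProperlyAt_pairArc hx hκ (Subtype.coe_ne_coe.2 hef) h1 h2 h3 h4
  no_triple e f g hef heg hfg := by
    refine eq_empty_of_forall_notMem fun p hp => ?_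
    obtain ⟨h1, h2⟩ := (mem_pairArc_diff x κ e p).1 hp.1.1
    obtain ⟨h3, h4⟩ := (mem_pairArc_diff x κ f p).1 hp.1.2
    obtain ⟨h5, h6⟩ := (mem_pairArc_diff x κ g p).1 hp.2
    exact pairArc_no_triple hx hg hκ (Subtype.coe_ne_coe.2 hef) (Subtype.coe_ne_coe.2 heg)
      (Subtype.coe_ne_coe.2 hfg) h1 h2 h3 h4 h5 h6

section parabolaDrawing

variable {n : ℕ} {x : Fin n → ℝ} {κ : Fin n → Fin n → ℝ}
    {hx : StrictMono x} {hg : IsGenericSequence x} {hκ : ∀ a c, κ a c = 1 ∨ κ a c = -1}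

theorem parabolaDrawing_isMonotone : (parabolaDrawing x κ hx hg hκ).IsMonotone :=
  ⟨fun _ _ h => hx.injective h, fun _ _ hp _ hq hpq =>
    Prod.ext hpq (hp.2.trans ((congrArg _ hpq).trans hq.2.symm))⟩

theorem mem_crossings_parabolaDrawing {e f : (⊤ : SimpleGraph (Fin n)).edgeSet} {z : ℝ × ℝ}
    (h : z ∈ (parabolaDrawing x κ hx hg hκ).crossings e f) :
    (z.1 ∈ Ioo (x e.1.inf) (x e.1.sup) ∧
        z.2 = parabola (κ e.1.inf e.1.sup) (x e.1.inf) (x e.1.sup) z.1) ∧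
      z.1 ∈ Ioo (x f.1.inf) (x f.1.sup) ∧
        z.2 = parabola (κ f.1.inf f.1.sup) (x f.1.inf) (x f.1.sup) z.1 :=
  ⟨(mem_pairArc_diff x κ e z).1 h.1.1, (mem_pairArc_diff x κ f z).1 h.1.2⟩

theorem parabolaDrawing_isSemisimple : (parabolaDrawing x κ hx hg hκ).IsSemisimple := by
  rintro e f hef ⟨v, hve, hvf⟩
  refine eq_empty_of_forall_notMem fun z hz => ?_
  obtain ⟨⟨h1, h2⟩, h3, h4⟩ := mem_crossings_parabolaDrawing hz
  obtain ⟨-, -, h5⟩ := interleaved_pairs hx hκ (Subtype.coe_ne_coe.2 hef) h1 h3 (h2.symm.trans h4)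
  obtain ⟨a1, a2, a3, a4⟩ := endpoints_ne_of_interleaved (inf_lt_sup_of_mem_edgeSet e)
    (inf_lt_sup_of_mem_edgeSet f) h5
  rw [Sym2.mem_iff_eq_inf_or_eq_sup] at hve hvf
  rcases hve with rfl | rfl <;> rcases hvf with h | h <;> contradiction

theorem exists_quadruple_of_mem_crossings {e f : (⊤ : SimpleGraph (Fin n)).edgeSet} (hef : e ≠ f)
    {z : ℝ × ℝ} (hz : z ∈ (parabolaDrawing x κ hx hg hκ).crossings e f) :
    ∃ a b c d : Fin n, (a < b ∧ b < c ∧ c < d ∧ κ a c = κ b d) ∧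
      s(e.1, f.1) = s(s(a, c), s(b, d)) ∧
      z.1 = (x a * x c - x b * x d) / ((x a + x c) - (x b + x d)) ∧
      z.2 = parabola (κ a c) (x a) (x c) z.1 := by
  obtain ⟨⟨h1, h2⟩, h3, h4⟩ := mem_crossings_parabolaDrawing hz
  have hef' := Subtype.coe_ne_coe.2 hef
  obtain ⟨hk, ht, h5⟩ := interleaved_pairs hx hκ hef' h1 h3 (h2.symm.trans h4)
  rcases h5 with h5 | h5
  · exact ⟨_, _, _, _, ⟨h5.1, h5.2.1, h5.2.2, hk⟩, by rw [Sym2.mk_inf_sup, Sym2.mk_inf_sup],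
      abscissa_of_interleaved hx (Or.inl h5) ht, h2⟩
  · exact ⟨_, _, _, _, ⟨h5.1, h5.2.1, h5.2.2, hk.symm⟩,
      by rw [Sym2.mk_inf_sup, Sym2.mk_inf_sup, Sym2.eq_swap],
      abscissa_of_interleaved hx (Or.inl h5) ht.symm, h4⟩

open Classical in
variable (κ) in
/-- The interleaved quadruples whose two crossing pairs lie in the same half-plane. -/
noncomputable def crossingQuadruples : Finset (Fin n × Fin n × Fin n × Fin n) :=
  {q | q.1 < q.2.1 ∧ q.2.1 < q.2.2.1 ∧ q.2.2.1 < q.2.2.2 ∧ κ q.1 q.2.2.1 = κ q.2.1 q.2.2.2}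

/-- The quadruple of ends determines the crossing point by an explicit formula, so the crossings lie
in an image of the set of quadruples. -/
theorem cr_parabolaDrawing_le :
    (parabolaDrawing x κ hx hg hκ).cr ≤ ((crossingQuadruples κ).card : ℕ∞) := by
  classical
  let t : Fin n × Fin n × Fin n × Fin n → ℝ := fun q =>
    (x q.1 * x q.2.2.1 - x q.2.1 * x q.2.2.2) / ((x q.1 + x q.2.2.1) - (x q.2.1 + x q.2.2.2))
  let g : Fin n × Fin n × Fin n × Fin n → ℝ × ℝ := fun q =>
    (t q, parabola (κ q.1 q.2.2.1) (x q.1) (x q.2.2.1) (t q))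
  refine le_trans (Set.encard_le_encard (t := g '' crossingQuadruples κ) ?_)
    ((Set.encard_image_le _ _).trans (Set.encard_coe_eq_coe_finsetCard _).le)
  rintro z ⟨e, f, hef, hz⟩
  obtain ⟨a, b, c, d, h1, -, h2, h3⟩ := exists_quadruple_of_mem_crossings hef hz
  refine ⟨(a, b, c, d), by simpa [crossingQuadruples] using h1, ?_⟩
  rw [h2] at h3
  exact Prod.ext h2.symm h3.symm

theorem ocr_parabolaDrawing_le :
    (parabolaDrawing x κ hx hg hκ).ocr ≤ ((crossingQuadruples κ).card : ℕ∞) := by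
  classical
  let g : Fin n × Fin n × Fin n × Fin n → Sym2 (Sym2 (Fin n)) := fun q =>
    s(s(q.1, q.2.2.1), s(q.2.1, q.2.2.2))
  rw [Drawing.ocr, ← (Sym2.map.injective Subtype.val_injective).encard_image]
  refine le_trans (Set.encard_le_encard (t := g '' crossingQuadruples κ) ?_)
    ((Set.encard_image_le _ _).trans (Set.encard_coe_eq_coe_finsetCard _).le)
  rintro _ ⟨_, ⟨e, f, rfl, hef, hodd⟩, rfl⟩
  obtain ⟨z, hz⟩ := Set.nonempty_of_ncard_ne_zero hodd.pos.ne'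
  obtain ⟨a, b, c, d, h1, h2, -⟩ := exists_quadruple_of_mem_crossings hef hz
  exact ⟨(a, b, c, d), by simpa [crossingQuadruples] using h1, h2.symm⟩

end parabolaDrawing

theorem exists_drawing_le_hillZ (n : ℕ) : ∃ D : Drawing (⊤ : SimpleGraph (Fin n)),
    D.IsMonotone ∧ D.IsSemisimple ∧ D.cr ≤ hillZ n ∧ D.ocr ≤ hillZ n := by
  classical
  obtain ⟨up, hup⟩ := exists_page_crossCount_le n
  obtain ⟨x, hx, hg⟩ := exists_generic_strictMono n
  -- The product `(t - a) * (t - c)` is negative between the roots, so upper edges take the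
  -- coefficient `-1`.
  let κ : Fin n → Fin n → ℝ := fun a c => if up a c then -1 else 1
  have hκ : ∀ a c, κ a c = 1 ∨ κ a c = -1 := fun a c => by
    by_cases h : up a c <;> simp [κ, h]
  have hcard : (crossingQuadruples κ).card ≤ hillZ n := by
    refine le_trans (Finset.card_le_card_of_injOn
      (fun q => ((q.1 : ℕ), (q.2.1 : ℕ), (q.2.2.1 : ℕ), (q.2.2.2 : ℕ))) ?_ ?_) hup
    · rintro ⟨a, b, c, d⟩ hq
      obtain ⟨h1, h2, h3, h4⟩ : a < b ∧ b < c ∧ c < d ∧ κ a c = κ b d := by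
        simpa [crossingQuadruples] using hq
      refine Finset.mem_coe.2 (Finset.mem_filter.2 ⟨mem_quads.2 ⟨h1, h2, h3, d.2⟩, ?_⟩)
      rw [isCrossing_pageSignature]
      simp only [κ] at h4
      by_cases ha : up a c <;> by_cases hb : up b d <;> simp [ha, hb] at h4 ⊢ <;> norm_num at h4
    · rintro ⟨a, b, c, d⟩ - ⟨a', b', c', d'⟩ - h
      simpa [Fin.ext_iff] using h
  have hcard' : ((crossingQuadruples κ).card : ℕ∞) ≤ hillZ n := by exact_mod_cast hcard
  exact ⟨parabolaDrawing x κ hx hg hκ, parabolaDrawing_isMonotone, parabolaDrawing_isSemisimple,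
    cr_parabolaDrawing_le.trans hcard', ocr_parabolaDrawing_le.trans hcard'⟩

end ParabolaDrawing

theorem theorem1 (n : ℕ) :
    monOcrPlusMinus (⊤ : SimpleGraph (Fin n)) = monOcrPlus (⊤ : SimpleGraph (Fin n)) ∧
      monOcrPlus (⊤ : SimpleGraph (Fin n)) = monCr (⊤ : SimpleGraph (Fin n)) ∧
      monCr (⊤ : SimpleGraph (Fin n)) = (hillZ n : ℕ∞) := by
  obtain ⟨D, hm, hs, hcr, hocr⟩ := exists_drawing_le_hillZ n
  have h1 : (hillZ n : ℕ∞) ≤ monOcrPlusMinus (⊤ : SimpleGraph (Fin n)) :=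
    le_iInf₂ fun D hD => hillZ_le_ocr D hD.1 hD.2
  have h2 : monOcrPlusMinus (⊤ : SimpleGraph (Fin n)) ≤ monOcrPlus (⊤ : SimpleGraph (Fin n)) :=
    le_iInf₂ fun D hD => iInf₂_le D ⟨hD.1, fun e f hef hv => by simp [hD.2 e f hef hv]⟩
  have h3 : monOcrPlus (⊤ : SimpleGraph (Fin n)) ≤ hillZ n := (iInf₂_le D ⟨hm, hs⟩).trans hocr
  have h4 : monCr (⊤ : SimpleGraph (Fin n)) = hillZ n :=
    le_antisymm ((iInf₂_le D hm).trans hcr) (le_iInf₂ fun D hD => hillZ_le_cr D hD)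
  have h5 : monOcrPlus (⊤ : SimpleGraph (Fin n)) = hillZ n := le_antisymm h3 (h1.trans h2)
  exact ⟨le_antisymm h2 (h3.trans h1), h5.trans h4.symm, h4⟩
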